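/- Let $G$ be a (possibly infinite-dimensional) Lie group with Lie algebra $\mathfrak g$ and let $\pi:P\to M$ be a smooth principal $G$-bundle, where $M$, $P$, $G$ are smooth manifolds modelled on convenient vector spaces in the sense of Kriegl--Michor (for instance Fréchet or Banach manifolds). Let $\mathcal C(P)$ be the set of principal connections $\theta\in\Omega^1(P,\mathfrak g)$, with curvature $F(\theta)=d\theta+\frac12[\theta,\theta]$ and covariant derivative $\nabla^\theta$ on the adjoint bundle $\mathrm{Ad}\,P=(P\times\mathfrak g)/G$. For $k\ge 1$ let $\mathfrak{Pol}^k(P)$ be the space of smooth maps $f:P\times\mathfrak g^k\to\mathbb C$, $k$-linear over $\mathbb{R}$ and symmetric in the second variable, which descend to $(\mathrm{Ad}\,P)^{\times k}$, i.e. $f(p\cdot g;\mathrm{Ad}_{g^{-1}}a_1,\dots,\mathrm{Ad}_{g^{-1}}a_k)=f(p;a_1,\dots,a_k)$, and which are invariant under the adjoint action of $G$ on $\mathfrak g^k$, i.e. $f(p;\mathrm{Ad}_{g}a_1,\dots,\mathrm{Ad}_{g}a_k)=f(p;a_1,\dots,a_k)$; let $\mathfrak{Pol}(P)=\bigoplus_{k\ge1}\mathfrak{Pol}^k(P)$.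 For $f\in\mathfrak{Pol}^k(P)$ put $Ch(\theta,f)=\mathrm{Alt}\,f(F(\theta),\dots,F(\theta))$, where $\mathrm{Alt}$ is the skew-symmetric part, and extend linearly to $\mathfrak{Pol}(P)$. We write $[\nabla^\theta,f]=0$ if, for each homogeneous component $f_k$ of $f$ and all smooth sections $s_1,\dots,s_k$ of $\mathrm{Ad}\,P$ over any open subset of $M$, $d\big(f_k(s_1,\dots,s_k)\big)=\sum_{i=1}^k f_k(s_1,\dots,\nabla^\theta s_i,\dots,s_k)$. **Theorem.** Let $f\in\mathfrak{Pol}(P)$ be such that $[\nabla^{\theta_0},f]=0$ for some $\theta_0\in\mathcal C(P)$. Then: 1. $[\nabla^{\theta},f]=0$ for every $\theta\in\mathcal C(P)$. 2. For every $\theta\in\mathcal C(P)$, $Ch(\theta,f)$ is a smooth closed differential form on $P$; it vanishes as soon as one of its arguments is vertical (tangent to the fibres of $\pi$), and it is the pullback by $\pi$ of a unique differential form on $M$, which is closed. 3. The de Rham cohomology class of this form on $M$ does not depend on $\theta$: for $\theta,\theta'\in\mathcal C(P)$ the forms on $M$ induced by $Ch(\theta,f)$ and $Ch(\theta',f)$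 differ by an exact form. Moreover, let $k\ge1$ and let $\phi:\mathfrak g^k\to\mathbb C$ be a smooth $k$-linear (over $\mathbb R$) symmetric $\mathrm{Ad}$-invariant form. Then $f(p;a_1,\dots,a_k)=\phi(a_1,\dots,a_k)$ defines an element of $\mathfrak{Pol}^k(P)$ with $[\nabla^\theta,f]=0$ for every $\theta\in\mathcal C(P)$; in particular $f$ satisfies the hypothesis above whenever $P$ admits a connection. -/

import Mathlib

open scoped ContDiff Topology DirectSum
open Diffeology

noncomputable section

namespace ChernWeil

/-! ### Smoothness and convenient vector spaces

Smooth structures are carried by Mathlib's `DiffeologicalSpace`: a map is smooth (`DSmooth`) if it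
sends smooth plots `ℝⁿ → X` to smooth plots `ℝⁿ → Y`. On convenient vector spaces and manifolds this
is, by Boman's theorem, the same as sending smooth curves to smooth curves, and the
D-topology is the `c^∞`-topology. -/

/-- Smoothness of `f` on the subset `U` (used for D-open subsets). -/
def DSmoothOn {X Y : Type*} [DiffeologicalSpace X] [DiffeologicalSpace Y]
    (f : X → Y) (U : Set X) : Prop :=
  ∀ (n : ℕ) (p : EuclideanSpace ℝ (Fin n) → X), IsPlot p → (∀ r, p r ∈ U) → IsPlot (f ∘ p)

/-- The product diffeology. -/
instance instDiffeologicalSpaceProd {X Y : Type*} [DiffeologicalSpace X] [DiffeologicalSpace Y] :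
    DiffeologicalSpace (X × Y) where
  plots _ := {p | IsPlot (fun r => (p r).1) ∧ IsPlot (fun r => (p r).2)}
  constant_plots _ := ⟨isPlot_const, isPlot_const⟩
  plot_reparam hp hf := ⟨isPlot_reparam hp.1 hf, isPlot_reparam hp.2 hf⟩
  locality {n p} hp := by
    constructor
    · refine DiffeologicalSpace.locality (p := fun r => (p r).1) fun x => ?_
      obtain ⟨u, hu, hx, h⟩ := hp x
      exact ⟨u, hu, hx, fun hf hc => (h hf hc).1⟩
    · refine DiffeologicalSpace.locality (p := fun r => (p r).2) fun x => ?_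
      obtain ⟨u, hu, hx, h⟩ := hp x
      exact ⟨u, hu, hx, fun hf hc => (h hf hc).2⟩

/-- The product diffeology on a power `X^ι`. -/
instance instDiffeologicalSpacePi {ι X : Type*} [DiffeologicalSpace X] :
    DiffeologicalSpace (ι → X) where
  plots _ := {p | ∀ i, IsPlot (fun r => p r i)}
  constant_plots _ := fun _ => isPlot_const
  plot_reparam hp hf := fun i => isPlot_reparam (hp i) hf
  locality {n p} hp := fun i => by
    refine DiffeologicalSpace.locality (p := fun r => p r i) fun x => ?_
    obtain ⟨u, hu, hx, h⟩ := hp x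
    exact ⟨u, hu, hx, fun hf hc => h hf hc i⟩

instance instDiffeologicalSpaceComplex : DiffeologicalSpace ℂ := NormedSpace.toDiffeology ℂ

/-- Convenient vector spaces: Hausdorff locally convex spaces `E` that are `c^∞`-complete, i.e.
every scalarwise smooth curve in `E` is differentiable (hence smooth). The diffeology is the
standard one, whose plots are the (scalarwise) smooth maps `ℝⁿ → E`. Every Fréchet space and
every Banach space is convenient. -/
class ConvenientSpace (E : Type*) [AddCommGroup E] [Module ℝ E] [TopologicalSpace E]
    [DiffeologicalSpace E] : Prop extends
    IsTopologicalAddGroup E, ContinuousSMul ℝ E, LocallyConvexSpace ℝ E, T2Space E where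
  isPlot_iff : ∀ (n : ℕ) (p : EuclideanSpace ℝ (Fin n) → E),
    IsPlot p ↔ ∀ l : E →L[ℝ] ℝ, ContDiff ℝ ∞ (fun r => l (p r))
  complete : ∀ c : ℝ → E, (∀ l : E →L[ℝ] ℝ, ContDiff ℝ ∞ (fun t => l (c t))) → Differentiable ℝ c

theorem contDiff_of_scalarwise {X E : Type*} [NormedAddCommGroup X] [NormedSpace ℝ X]
    [NormedAddCommGroup E] [NormedSpace ℝ E] [FiniteDimensional ℝ E] (p : X → E)
    (h : ∀ l : E →L[ℝ] ℝ, ContDiff ℝ ∞ (fun r => l (p r))) : ContDiff ℝ ∞ p := by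
  let e : E ≃L[ℝ] (Fin (Module.finrank ℝ E) → ℝ) :=
    ContinuousLinearEquiv.ofFinrankEq (by simp)
  rw [← e.comp_contDiff_iff, contDiff_pi]
  intro i
  exact h ((ContinuousLinearMap.proj (R := ℝ) (φ := fun _ => ℝ) i).comp (e : E →L[ℝ] _))

instance instConvenientSpaceFiniteDimensional {E : Type*} [NormedAddCommGroup E] [NormedSpace ℝ E]
    [FiniteDimensional ℝ E] [DiffeologicalSpace E] [IsContDiffCompatible E] :
    ConvenientSpace E where
  isPlot_iff n p := by
    rw [isPlot_iff_contDiff]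
    exact ⟨fun h l => l.contDiff.comp h, contDiff_of_scalarwise p⟩
  complete c h := (contDiff_of_scalarwise c h).differentiable (by simp)

instance instIsContDiffCompatibleComplex : IsContDiffCompatible ℂ where
  isPlot_iff := Iff.rfl

/-! ### Manifolds, tangent maps and differential forms -/

/-- `M` is a smooth manifold modelled on the convenient vector space `E`: every point lies in the
D-open domain of a chart, a diffeomorphism onto a D-open (that is, `c^∞`-open) subset of `E`.
As in Mathlib, one chart `chart x` around each point `x` is singled out; it is used to represent
the (kinematic) tangent vectors at `x` by elements of `E`. -/
class ConvManifold (E M : Type*) [AddCommGroup E] [Module ℝ E] [TopologicalSpace E]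
    [DiffeologicalSpace E] [ConvenientSpace E] [DiffeologicalSpace M] where
  chart : M → PartialEquiv M E
  mem_source : ∀ x, x ∈ (chart x).source
  isOpen_source : ∀ x, IsOpen[dTopology] (chart x).source
  isOpen_target : ∀ x, IsOpen[dTopology] (chart x).target
  smooth_chart : ∀ x, DSmoothOn (chart x) (chart x).source
  smooth_symm : ∀ x, DSmoothOn (chart x).symm (chart x).target

/-- A convenient vector space is a manifold modelled on itself, with the identity chart. -/
instance instConvManifoldSelf (E : Type*) [AddCommGroup E] [Module ℝ E] [TopologicalSpace E]
    [DiffeologicalSpace E] [ConvenientSpace E] : ConvManifold E E where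
  chart _ := PartialEquiv.refl E
  mem_source _ := Set.mem_univ _
  isOpen_source _ := @isOpen_univ _ dTopology
  isOpen_target _ := @isOpen_univ _ dTopology
  smooth_chart _ := fun _ _ hp _ => hp
  smooth_symm _ := fun _ _ hp _ => hp

section Manifolds

variable (E F : Type*)
  [AddCommGroup E] [Module ℝ E] [TopologicalSpace E] [DiffeologicalSpace E] [ConvenientSpace E]
  [AddCommGroup F] [Module ℝ F] [TopologicalSpace F] [DiffeologicalSpace F] [ConvenientSpace F]
  {M N : Type*} [DiffeologicalSpace M] [ConvManifold E M] [DiffeologicalSpace N] [ConvManifold F N]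

/-- The tangent map `T_x f : T_x M → T_{f x} N`, tangent vectors being read in the charts
`chart x` and `chart (f x)`. -/
def tmap (f : M → N) (x : M) (v : E) : F :=
  deriv (fun t : ℝ => (ConvManifold.chart (E := F) (f x))
    (f ((ConvManifold.chart (E := E) x).symm (ConvManifold.chart (E := E) x x + t • v)))) 0

/-- The pullback `f^* α` of a `k`-form `α` on `N` (given by its values on tangent vectors). -/
def pullback {k : ℕ} {V : Type*} (f : M → N) (α : N → (Fin k → F) → V) :
    M → (Fin k → E) → V :=
  fun x v => α (f x) (fun i => tmap E F f x (v i))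

end Manifolds

section Forms

variable {E : Type*} [AddCommGroup E] [Module ℝ E] [TopologicalSpace E] [DiffeologicalSpace E]
  [ConvenientSpace E] {M : Type*} [DiffeologicalSpace M] [ConvManifold E M] {V : Type*}

/-- The expression of `α` in the chart around `x₀`: the pullback of `α` by the inverse chart. -/
def localRep {k : ℕ} (α : M → (Fin k → E) → V) (x₀ : M) : E → (Fin k → E) → V :=
  pullback E E (ConvManifold.chart (E := E) x₀).symm α

/-- The exterior derivative, computed at `x` in the chart around `x`:
`dα(v₀,…,v_k) = ∑ (-1)^i D_{v_i} α(v₀,…,v̂_i,…,v_k)`. -/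
def extd [AddCommGroup V] [Module ℝ V] [TopologicalSpace V] {k : ℕ}
    (α : M → (Fin k → E) → V) : M → (Fin (k + 1) → E) → V :=
  fun x v => ∑ i : Fin (k + 1), (-1 : ℝ) ^ (i : ℕ) •
    deriv (fun t : ℝ => localRep α x (ConvManifold.chart (E := E) x x + t • v i)
      (fun j => v (i.succAbove j))) 0

variable (E M V) in
/-- Smooth `V`-valued differential `k`-forms on `M`: fibrewise `k`-linear and alternating, and
smooth in each chart as maps of the point and of the `k` tangent vectors. -/
@[ext]
structure DForm [AddCommGroup V] [Module ℝ V] [DiffeologicalSpace V] (k : ℕ) where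
  toAlt : M → (E [⋀^Fin k]→ₗ[ℝ] V)
  smooth : ∀ x₀ : M, DSmoothOn
    (fun z : E × (Fin k → E) => localRep (fun x v => toAlt x v) x₀ z.1 z.2)
    {z | z.1 ∈ (ConvManifold.chart (E := E) x₀).target}

instance instCoeFunDForm [AddCommGroup V] [Module ℝ V] [DiffeologicalSpace V] {k : ℕ} :
    CoeFun (DForm E M V k) (fun _ => M → (Fin k → E) → V) where
  coe α := fun x v => α.toAlt x v

/-- The `n`-forms `α` and `α'` differ by an exact form `dη`. -/
def Cohomologous [AddCommGroup V] [Module ℝ V] [TopologicalSpace V] [DiffeologicalSpace V] {n : ℕ}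
    (α α' : DForm E M V n) : Prop :=
  ∃ (m : ℕ) (h : m + 1 = n) (η : DForm E M V m),
    ∀ (x : M) (v : Fin n → E), α x v - α' x v = extd η x (fun i => v (Fin.cast h i))

end Forms

/-! ### Lie groups -/

/-- A Lie group: a group and a manifold (see `ConvManifold`) with smooth operations. -/
class ConvLieGroup (G : Type*) [Group G] [DiffeologicalSpace G] : Prop where
  smooth_mul : DSmooth (fun z : G × G => z.1 * z.2)
  smooth_inv : DSmooth (fun g : G => g⁻¹)

section LieGroups

/- The Lie algebra of `G` is `T_1 G`, identified with the model space `𝔤` by the chart at `1`. -/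
variable {𝔤 : Type*} [AddCommGroup 𝔤] [Module ℝ 𝔤] [TopologicalSpace 𝔤] [DiffeologicalSpace 𝔤]
  [ConvenientSpace 𝔤] {G : Type*} [Group G] [DiffeologicalSpace G] [ConvManifold 𝔤 G]

/-- The adjoint action: `Ad_g` is the tangent map at `1` of `h ↦ g h g⁻¹`. -/
def Ad (g : G) (X : 𝔤) : 𝔤 := tmap 𝔤 𝔤 (fun h : G => g * h * g⁻¹) 1 X

variable (G) in
/-- The Lie bracket `[X, Y] = ad_X Y`, where `ad` is the tangent map of `Ad` at `1`. -/
def lieBracket (X Y : 𝔤) : 𝔤 := tmap 𝔤 𝔤 (fun g : G => Ad g Y) 1 X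

end LieGroups

/-! ### Principal bundles, connections and invariant polynomials -/

/-- Principal `G`-bundles `proj : P → M`. The local triviality over `U` is given by a
local section `s` and the map `τ : P|_U → G` with `p = s(proj p) · τ(p)`, so that
`(x, g) ↦ s(x) · g` is an equivariant diffeomorphism `U × G → P|_U`. -/
structure PrincipalBundle (M P G : Type*) [DiffeologicalSpace M] [DiffeologicalSpace P]
    [DiffeologicalSpace G] [Group G] where
  proj : P → M
  act : P → G → P
  smooth_proj : DSmooth proj
  smooth_act : DSmooth (fun z : P × G => act z.1 z.2)
  act_one : ∀ p, act p 1 = p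
  act_mul : ∀ p g h, act p (g * h) = act (act p g) h
  proj_act : ∀ p g, proj (act p g) = proj p
  locally_trivial : ∀ x : M, ∃ U : Set M, IsOpen[dTopology] U ∧ x ∈ U ∧
    ∃ (s : M → P) (τ : P → G), DSmoothOn s U ∧ DSmoothOn τ (proj ⁻¹' U) ∧
      (∀ y ∈ U, proj (s y) = y) ∧
      (∀ p ∈ proj ⁻¹' U, act (s (proj p)) (τ p) = p) ∧
      (∀ y ∈ U, ∀ g, τ (act (s y) g) = g)

section Bundles

variable {EP 𝔤 M P G : Type*}
  [AddCommGroup EP] [Module ℝ EP] [TopologicalSpace EP] [DiffeologicalSpace EP]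
  [ConvenientSpace EP]
  [AddCommGroup 𝔤] [Module ℝ 𝔤] [TopologicalSpace 𝔤] [DiffeologicalSpace 𝔤] [ConvenientSpace 𝔤]
  [DiffeologicalSpace M]
  [DiffeologicalSpace P] [ConvManifold EP P]
  [Group G] [DiffeologicalSpace G] [ConvManifold 𝔤 G]

variable (EP 𝔤) in
/-- Principal connections, as `𝔤`-valued `1`-forms `θ` on `P` that reproduce the generators of the
fundamental vector fields and are equivariant: `R_g^* θ = Ad_{g⁻¹} θ`. -/
structure Connection (B : PrincipalBundle M P G) where
  form : DForm EP P 𝔤 1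
  fundamental : ∀ (p : P) (X : 𝔤), form p ![tmap 𝔤 EP (fun g : G => B.act p g) 1 X] = X
  equivariant : ∀ (p : P) (g : G) (v : EP),
    form (B.act p g) ![tmap EP EP (fun q : P => B.act q g) p v] = Ad g⁻¹ (form p ![v])

/-- The curvature `F(θ) = dθ + ½[θ, θ]`. -/
def Connection.curvature {B : PrincipalBundle M P G} (θ : Connection EP 𝔤 B) (p : P)
    (u v : EP) : 𝔤 :=
  extd θ.form p ![u, v] + lieBracket G (θ.form p ![u]) (θ.form p ![v])

/-- The covariant derivative `∇^θ s = ds + [θ, s]` of a (local) section of the adjoint bundle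
`Ad P`, given as an equivariant function `s : P → 𝔤`. -/
def Connection.covDeriv {B : PrincipalBundle M P G} (θ : Connection EP 𝔤 B) (s : P → 𝔤)
    (p : P) (v : EP) : 𝔤 :=
  tmap EP 𝔤 s p v + lieBracket G (θ.form p ![v]) (s p)

variable (𝔤) in
/-- The invariant polynomials of degree `k` on `P`: smooth maps `f : P × 𝔤^k → ℂ` that are `k`-linear
and symmetric in the second variable, that descend to the bundle `(Ad P)^k = (P × 𝔤^k) / G`,
and that are invariant under the action of `G` on `𝔤^k`. -/
def invPoly (B : PrincipalBundle M P G) (k : ℕ) :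
    Submodule ℂ (P → MultilinearMap ℝ (fun _ : Fin k => 𝔤) ℂ) where
  carrier := {f |
    DSmooth (fun z : P × (Fin k → 𝔤) => f z.1 z.2) ∧
    (∀ p (σ : Equiv.Perm (Fin k)) (a : Fin k → 𝔤), f p (fun i => a (σ i)) = f p a) ∧
    (∀ p (g : G) (a : Fin k → 𝔤), f (B.act p g) (fun i => Ad g⁻¹ (a i)) = f p a) ∧
    (∀ p (g : G) (a : Fin k → 𝔤), f p (fun i => Ad g (a i)) = f p a)}
  add_mem' {f f'} hf hf' := by
    refine ⟨fun n p hp => ?_, fun p σ a => ?_, fun p g a => ?_, fun p g a => ?_⟩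
    · exact isPlot_iff_contDiff.2
        ((isPlot_iff_contDiff.1 (hf.1 n p hp)).add (isPlot_iff_contDiff.1 (hf'.1 n p hp)))
    · simp [hf.2.1 p σ a, hf'.2.1 p σ a]
    · simp [hf.2.2.1 p g a, hf'.2.2.1 p g a]
    · simp [hf.2.2.2 p g a, hf'.2.2.2 p g a]
  zero_mem' :=
    ⟨fun n p _ => isPlot_const, fun _ _ _ => rfl, fun _ _ _ => rfl, fun _ _ _ => rfl⟩
  smul_mem' c f hf := by
    refine ⟨fun n p hp => ?_, fun p σ a => ?_, fun p g a => ?_, fun p g a => ?_⟩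
    · exact isPlot_iff_contDiff.2
        (contDiff_const.mul (isPlot_iff_contDiff.1 (hf.1 n p hp)))
    · simp [hf.2.1 p σ a]
    · simp [hf.2.2.1 p g a]
    · simp [hf.2.2.2 p g a]

variable (𝔤) in
/-- The invariant polynomials on `P`: the direct sum of the homogeneous parts of degree `k ≥ 1`. -/
abbrev InvPolynomial (B : PrincipalBundle M P G) : Type _ :=
  ⨁ k : ℕ+, invPoly 𝔤 B k

/-- The commutator `[∇^θ, f](s₁,…,s_k) = d(f(s₁,…,s_k)) - ∑ f(s₁,…,∇^θ s_i,…,s_k)`, evaluated on the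
tangent vector `v` at `p`; the `s_i` are (local) sections of the adjoint bundle. -/
def commutator {B : PrincipalBundle M P G} (θ : Connection EP 𝔤 B) {k : ℕ} (f : invPoly 𝔤 B k)
    (s : Fin k → P → 𝔤) (p : P) (v : EP) : ℂ :=
  tmap EP ℂ (fun q : P => f.1 q (fun i => s i q)) p v
    - ∑ i : Fin k, f.1 p (Function.update (fun j => s j p) i (θ.covDeriv (s i) p v))

/-- `[∇^θ, f] = 0`: in each degree the commutator vanishes on all smooth sections of the adjoint
bundle over all open subsets `U` of `M`. -/
def CommutesWith {B : PrincipalBundle M P G} (θ : Connection EP 𝔤 B)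
    (f : InvPolynomial 𝔤 B) : Prop :=
  ∀ (k : ℕ+) (U : Set M), IsOpen[dTopology] U → ∀ s : Fin k → P → 𝔤,
    (∀ i, DSmoothOn (s i) (B.proj ⁻¹' U)) →
    (∀ i, ∀ p ∈ B.proj ⁻¹' U, ∀ g : G, s i (B.act p g) = Ad g⁻¹ (s i p)) →
    ∀ p ∈ B.proj ⁻¹' U, ∀ v : EP, commutator θ (f k) s p v = 0

/-- `Ch(θ, f) = Alt f(F(θ),…,F(θ))` for `f` of degree `k`, as a function on `P` of `2k` tangent
vectors; `Alt` is the projection onto the skew-symmetric part. -/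
def chernForm {B : PrincipalBundle M P G} (θ : Connection EP 𝔤 B) {k : ℕ} (f : invPoly 𝔤 B k) :
    P → (Fin (2 * k) → EP) → ℂ :=
  fun p v => ((Nat.factorial (2 * k) : ℕ) : ℂ)⁻¹ * ∑ σ : Equiv.Perm (Fin (2 * k)),
    ((Equiv.Perm.sign σ : ℤ) : ℂ) * f.1 p (fun i : Fin k =>
      θ.curvature p (v (σ ⟨2 * (i : ℕ), by omega⟩)) (v (σ ⟨2 * (i : ℕ) + 1, by omega⟩)))

end Bundles

end ChernWeil

end

open ChernWeil

/-! All computations take place along plots. A tangent vector is the velocity `vel` of a smooth map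
`p : W → M` from a finite-dimensional space, tangent maps send velocities to velocities
(`tmap_vel`), and an alternating form that is smooth on velocities of plots is a smooth form
(`DForm.ofPlots`). Exterior derivatives become sums of directional derivatives on `W`
(`extd_eq_sum_dd`, `DForm.extd_vel`), and identities in convenient spaces are tested by continuous
functionals.

Differentiating the `Ad`-invariance of `f` gives `∑ f(a₁,…,[X,aᵢ],…,a_k) = 0`
(`sum_update_lieBracket_eq_zero`). Hence the connection form drops out of the commutator, which does
not depend on `θ`. Testing the hypothesis on the sections `Ad(τ(q)⁻¹τ(p)) aᵢ`, which `f` cannot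
distinguish from constants, shows that `q ↦ f(q; a)` has zero derivative, so `f` is constant along
every plot (`invPoly_eq_of_plot`).

Along a plot, `Ch(θ, f)` is therefore `Alt φ(F,…,F)` for one fixed invariant `φ` and the curvature
`F` of a `𝔤`-valued 1-form on a vector space. Invariance turns the derivative of `F` into its
covariant derivative, whose cyclic sums vanish by the Bianchi identity; this gives closedness
(`sum_dd_altSum_eq_zero`). The skew-symmetry of the bracket needed there is read off from `dθ` on
fundamental vectors (`lieBracket_anticomm`). The curvature is horizontal, because `dθ(X, ·) = -[X,
θ]` for fundamental `X` (`extd_fundamentalVector`), and equivariant, so `Ch(θ, f)` is basic and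
descends to `M` (`IsBasic.exists_dForm`).

For two connections the same computation is made for `(1 - t)θ + tθ'` over `ℝ × P`. Closedness there
and integration over `[0, 1]` of the contraction with `∂/∂t` yield a basic form whose differential
is the difference of the two Chern forms (`sum_dd_transgression`). A single connection is the
degenerate segment at `t = 0`, so closedness is proved only once. For constant `f = φ` the
commutator vanishes by the Leibniz rule. -/

noncomputable section

namespace ChernWeil

open Filter

set_option linter.unusedSectionVars false

/-! ### Germs of smooth maps out of finite-dimensional spaces -/

section Germs

variable {W W' : Type*} [NormedAddCommGroup W] [NormedSpace ℝ W]
  [NormedAddCommGroup W'] [NormedSpace ℝ W']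
  {X Y Z : Type*} [DiffeologicalSpace X] [DiffeologicalSpace Y] [DiffeologicalSpace Z]

/-- Smoothness of a map from a normed space to a diffeological space. -/
def IsSmooth (p : W → X) : Prop :=
  ∀ (n : ℕ) (φ : EuclideanSpace ℝ (Fin n) → W), ContDiff ℝ ∞ φ → IsPlot (p ∘ φ)

/-- `p` agrees near `r` with a smooth map. -/
def IsSmoothAt (p : W → X) (r : W) : Prop := ∃ q : W → X, IsSmooth q ∧ p =ᶠ[𝓝 r] q

/-- `f` sends germs of plots at `x` to germs of plots at `f x`. -/
def MapSmoothAt (f : X → Y) (x : X) : Prop :=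
  ∀ (n : ℕ) (p : EuclideanSpace ℝ (Fin n) → X) (r : EuclideanSpace ℝ (Fin n)),
    IsSmoothAt p r → p r = x → IsSmoothAt (f ∘ p) r

theorem isSmooth_const (x : X) : IsSmooth (fun _ : W => x) := fun _ _ _ => isPlot_const

theorem IsSmooth.comp {p : W → X} (hp : IsSmooth p) {φ : W' → W} (hφ : ContDiff ℝ ∞ φ) :
    IsSmooth (fun r => p (φ r)) :=
  fun n ψ hψ => hp n (fun r => φ (ψ r)) (hφ.comp hψ)

theorem isSmooth_iff_isPlot {n : ℕ} {p : EuclideanSpace ℝ (Fin n) → X} :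
    IsSmooth p ↔ IsPlot p :=
  ⟨fun h => h n id contDiff_id, fun h _ _ hφ => isPlot_reparam h hφ⟩

theorem IsSmooth.map {f : X → Y} {p : W → X} (hp : IsSmooth p) (hf : DSmooth f) :
    IsSmooth (fun r => f (p r)) :=
  fun n φ hφ => hf n _ (hp n φ hφ)

theorem IsSmooth.prodMk {p : W → X} {q : W → Y} (hp : IsSmooth p) (hq : IsSmooth q) :
    IsSmooth (fun r => (p r, q r)) :=
  fun n φ hφ => ⟨hp n φ hφ, hq n φ hφ⟩

theorem IsSmooth.pi {ι : Type*} {p : W → ι → X} (hp : ∀ i, IsSmooth (fun r => p r i)) :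
    IsSmooth p :=
  fun n φ hφ i => hp i n φ hφ

theorem IsSmooth.fst {p : W → X × Y} (hp : IsSmooth p) : IsSmooth (fun r => (p r).1) :=
  fun n φ hφ => (hp n φ hφ).1

theorem IsSmooth.snd {p : W → X × Y} (hp : IsSmooth p) : IsSmooth (fun r => (p r).2) :=
  fun n φ hφ => (hp n φ hφ).2

theorem IsSmooth.isSmoothAt {p : W → X} (hp : IsSmooth p) (r : W) : IsSmoothAt p r :=
  ⟨p, hp, EventuallyEq.rfl⟩

theorem IsSmoothAt.congr {p q : W → X} {r : W} (hp : IsSmoothAt p r) (h : p =ᶠ[𝓝 r] q) :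
    IsSmoothAt q r := by
  obtain ⟨p', hp', e⟩ := hp
  exact ⟨p', hp', h.symm.trans e⟩

theorem IsSmoothAt.comp {p : W → X} {φ : W' → W} {r : W'} (hp : IsSmoothAt p (φ r))
    (hφ : ContDiff ℝ ∞ φ) : IsSmoothAt (fun s => p (φ s)) r := by
  obtain ⟨q, hq, e⟩ := hp
  exact ⟨fun s => q (φ s), hq.comp hφ, hφ.continuous.continuousAt.eventually e⟩

theorem IsSmoothAt.comp' {p : W → X} {φ : W' → W} {r : W'} {s : W} (hp : IsSmoothAt p s)
    (hφ : ContDiff ℝ ∞ φ) (h : φ r = s) : IsSmoothAt (fun s => p (φ s)) r := by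
  subst h
  exact hp.comp hφ

theorem IsSmoothAt.prodMk {p : W → X} {q : W → Y} {r : W} (hp : IsSmoothAt p r)
    (hq : IsSmoothAt q r) : IsSmoothAt (fun s => (p s, q s)) r := by
  obtain ⟨p', hp', e⟩ := hp
  obtain ⟨q', hq', e'⟩ := hq
  exact ⟨_, hp'.prodMk hq', by filter_upwards [e, e'] with s h h'; rw [h, h']⟩

theorem IsSmoothAt.pi {ι : Type*} [Finite ι] {p : W → ι → X} {r : W}
    (hp : ∀ i, IsSmoothAt (fun s => p s i) r) : IsSmoothAt p r := by
  choose q hq e using hp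
  refine ⟨fun s i => q i s, IsSmooth.pi hq, ?_⟩
  filter_upwards [eventually_all.2 e] with s h
  exact funext h

theorem IsSmoothAt.map {f : X → Y} {p : W → X} {r : W}
    (hp : IsSmoothAt p r) (hf : DSmooth f) : IsSmoothAt (fun s => f (p s)) r := by
  obtain ⟨q, hq, e⟩ := hp
  exact ⟨_, hq.map hf, e.fun_comp f⟩

theorem isSmooth_of_isSmoothAt {p : W → X} (hp : ∀ r, IsSmoothAt p r) : IsSmooth p := by
  intro n φ hφ
  refine DiffeologicalSpace.locality fun x => ?_
  obtain ⟨q, hq, e⟩ := hp (φ x)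
  obtain ⟨u, hu, huo, hxu⟩ := eventually_nhds_iff.1 e
  refine ⟨φ ⁻¹' u, huo.preimage hφ.continuous, hxu, fun {m f} hf hc => ?_⟩
  have : (p ∘ φ) ∘ f = q ∘ (φ ∘ f) := funext fun y => hu _ (hf y)
  rw [this]
  exact hq m _ (hφ.comp hc)

/-- A smooth map with values in a given neighbourhood of `r` that is the identity near `r`. -/
theorem exists_contraction [FiniteDimensional ℝ W] {O : Set W} {r : W} (hO : O ∈ 𝓝 r) :
    ∃ ρ : W → W, ContDiff ℝ ∞ ρ ∧ (∀ᶠ s in 𝓝 r, ρ s = s) ∧ ∀ s, ρ s ∈ O := by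
  obtain ⟨ε, hε, hb⟩ := Metric.mem_nhds_iff.1 hO
  -- The map contracts radially towards `r`: it is the identity where the bump is 1, constant equal
  -- to `r` where the bump vanishes, and its displacement from `r` stays below `ε` in between.
  let β : ContDiffBump r := ⟨ε / 4, ε / 2, by positivity, by linarith⟩
  refine ⟨fun s => r + β s • (s - r), ?_, ?_, fun s => hb ?_⟩
  · exact contDiff_const.add (β.contDiff.smul (contDiff_id.sub contDiff_const))
  · filter_upwards [β.eventuallyEq_one] with s hs
    simp [hs]
  · rw [Metric.mem_ball, dist_eq_norm, add_sub_cancel_left, norm_smul, Real.norm_eq_abs,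
      abs_of_nonneg β.nonneg]
    by_cases h : dist s r < ε / 2
    · calc β s * ‖s - r‖ ≤ 1 * ‖s - r‖ := by gcongr; exact β.le_one
        _ < ε := by rw [one_mul, ← dist_eq_norm]; linarith
    · rw [β.zero_of_le_dist (not_lt.1 h)]
      simpa using hε

theorem IsSmooth.isOpen_preimage [FiniteDimensional ℝ W] {p : W → X} (hp : IsSmooth p) {U : Set X}
    (hU : IsOpen[dTopology] U) : IsOpen (p ⁻¹' U) := by
  have h := isOpen_iff_preimages_plots.1 hU _ _
    (hp _ (toEuclidean (E := W)).symm (toEuclidean (E := W)).symm.contDiff)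
  have := h.preimage (toEuclidean (E := W)).continuous
  rwa [← Set.preimage_comp, Function.comp_assoc,
    show ((toEuclidean (E := W)).symm ∘ toEuclidean (E := W)) = id from
      funext fun x => by simp, Function.comp_id] at this

theorem IsSmoothAt.eventually_mem [FiniteDimensional ℝ W] {p : W → X} {r : W}
    (hp : IsSmoothAt p r) {U : Set X} (hU : IsOpen[dTopology] U) (hr : p r ∈ U) :
    ∀ᶠ s in 𝓝 r, p s ∈ U := by
  obtain ⟨q, hq, e⟩ := hp
  have : q ⁻¹' U ∈ 𝓝 r := (hq.isOpen_preimage hU).mem_nhds (by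
    show q r ∈ U
    rwa [← e.eq_of_nhds])
  filter_upwards [e, this] with s h h'
  rw [h]
  exact h'

/-- `DSmoothOn` only tests plots lying entirely in `U`. Precomposing with a contraction forces a
plot that is in `U` at `r` to stay in `U`, without changing its germ. -/
theorem isSmoothAt_of_dSmoothOn [FiniteDimensional ℝ W] {f : X → Y} {U : Set X}
    (hf : DSmoothOn f U) (hU : IsOpen[dTopology] U) {p : W → X} {r : W} (hp : IsSmoothAt p r)
    (hr : p r ∈ U) : IsSmoothAt (fun s => f (p s)) r := by
  have hm := hp.eventually_mem hU hr
  obtain ⟨q, hq, e⟩ := hp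
  obtain ⟨ρ, hρ, hρr, hρO⟩ := exists_contraction (hm.and e)
  refine ⟨fun s => f (q (ρ s)), fun n φ hφ => ?_, ?_⟩
  · refine hf n (fun s => q (ρ (φ s))) (hq n _ (hρ.comp hφ)) fun s => ?_
    rw [← (hρO (φ s)).2]
    exact (hρO (φ s)).1
  · filter_upwards [hρr, e] with s h h'
    rw [h, h']

theorem DSmoothOn.mapSmoothAt {f : X → Y} {U : Set X} (hf : DSmoothOn f U)
    (hU : IsOpen[dTopology] U) {x : X} (hx : x ∈ U) : MapSmoothAt f x :=
  fun _ _ _ hp hr => isSmoothAt_of_dSmoothOn hf hU hp (hr ▸ hx)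

theorem mapSmoothAt_of_dSmooth {f : X → Y} (hf : DSmooth f) (x : X) : MapSmoothAt f x :=
  fun _ _ _ hp _ => hp.map hf

/-- Transport along `toEuclidean`: tests on Euclidean spaces suffice for parameter spaces such as `ℝ
× W` or `ι → ℝ`. -/
theorem MapSmoothAt.isSmoothAt [FiniteDimensional ℝ W] {f : X → Y} {p : W → X} {r : W}
    (hf : MapSmoothAt f (p r)) (hp : IsSmoothAt p r) : IsSmoothAt (fun s => f (p s)) r := by
  have h1 := hf _ (fun s => p ((toEuclidean (E := W)).symm s)) (toEuclidean r)
    (hp.comp' (toEuclidean (E := W)).symm.contDiff (by simp)) (by simp)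
  simpa [Function.comp_def] using h1.comp (r := r) (φ := toEuclidean (E := W))
    (toEuclidean (E := W)).contDiff

theorem MapSmoothAt.isSmoothAt' [FiniteDimensional ℝ W] {f : X → Y} {p : W → X} {r : W} {x : X}
    (hf : MapSmoothAt f x) (hp : IsSmoothAt p r) (h : p r = x) :
    IsSmoothAt (fun s => f (p s)) r := by
  subst h
  exact hf.isSmoothAt hp

theorem MapSmoothAt.comp {f : X → Y} {g : Y → Z} {x : X} (hg : MapSmoothAt g (f x))
    (hf : MapSmoothAt f x) : MapSmoothAt (fun x => g (f x)) x := by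
  intro n p r hp hr
  subst hr
  exact hg.isSmoothAt (p := fun s => f (p s)) (hf.isSmoothAt hp)

theorem mapSmoothAt_id (x : X) : MapSmoothAt (fun x : X => x) x := fun _ _ _ hp _ => hp

theorem dSmoothOn_of_isSmoothAt {f : X → Y} {U : Set X}
    (h : ∀ (n : ℕ) (p : EuclideanSpace ℝ (Fin n) → X), IsSmooth p → (∀ r, p r ∈ U) →
      ∀ r, IsSmoothAt (fun s => f (p s)) r) : DSmoothOn f U := fun n p hp hU =>
  isSmooth_iff_isPlot.1 (isSmooth_of_isSmoothAt (h n p (isSmooth_iff_isPlot.2 hp) hU))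

theorem isSmooth_iff_contDiff [FiniteDimensional ℝ W] {V : Type*} [NormedAddCommGroup V]
    [NormedSpace ℝ V] [DiffeologicalSpace V] [IsContDiffCompatible V] {f : W → V} :
    IsSmooth f ↔ ContDiff ℝ ∞ f := by
  refine ⟨fun h => ?_, fun h n φ hφ => isPlot_iff_contDiff.2 (h.comp hφ)⟩
  have := isPlot_iff_contDiff.1 (h _ (toEuclidean (E := W)).symm (toEuclidean (E := W)).symm.contDiff)
  have := this.comp (toEuclidean (E := W)).contDiff
  simpa [Function.comp_def] using this

end Germs

/-! ### Parametric integrals -/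

section ParametricIntegral

open MeasureTheory

/-- Differentiation under the integral sign; the dominating constant comes from compactness of `[0,
1]` times a closed ball around `r`. -/
theorem hasFDerivAt_parametric_integral {W F : Type*} [NormedAddCommGroup W] [NormedSpace ℝ W]
    [FiniteDimensional ℝ W] [NormedAddCommGroup F] [NormedSpace ℝ F]
    {g : ℝ × W → F} (hg : ContDiff ℝ 1 g) (r : W) :
    HasFDerivAt (fun r => ∫ t in (0 : ℝ)..1, g (t, r))
      (∫ t in (0 : ℝ)..1, (fderiv ℝ g (t, r)).comp (ContinuousLinearMap.inr ℝ ℝ W)) r := by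
  have hc : Continuous fun z : ℝ × W => (fderiv ℝ g z).comp (ContinuousLinearMap.inr ℝ ℝ W) :=
    (hg.continuous_fderiv (by simp)).clm_comp continuous_const
  obtain ⟨C, hC⟩ := ((isCompact_Icc (a := (0 : ℝ)) (b := 1)).prod
    (isCompact_closedBall r 1)).exists_bound_of_continuousOn hc.continuousOn
  refine intervalIntegral.hasFDerivAt_integral_of_dominated_of_fderiv_le
    (s := Metric.closedBall r 1) (bound := fun _ => C)
    (F := fun r t => g (t, r))
    (F' := fun r t => (fderiv ℝ g (t, r)).comp (ContinuousLinearMap.inr ℝ ℝ W))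
    (Metric.closedBall_mem_nhds r one_pos) ?_ ?_ ?_ ?_ ?_ ?_
  · exact Eventually.of_forall fun x =>
      (hg.continuous.comp (by fun_prop : Continuous fun t : ℝ => (t, x))).aestronglyMeasurable
  · exact (hg.continuous.comp (by fun_prop : Continuous fun t : ℝ => (t, r))).intervalIntegrable _ _
  · exact (hc.comp (by fun_prop : Continuous fun t : ℝ => (t, r))).aestronglyMeasurable
  · refine Eventually.of_forall fun t ht x hx => hC (t, x) ⟨?_, hx⟩
    rw [Set.uIoc_of_le zero_le_one] at ht
    exact ⟨ht.1.le, ht.2⟩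
  · exact intervalIntegrable_const
  · refine Eventually.of_forall fun t _ x _ => ?_
    exact ((hg.differentiable (by simp)) (t, x)).hasFDerivAt.comp x
      (hasFDerivAt_prodMk_right t x)

/-- The target `F` is quantified inside the induction because the derivative is a parametric
integral with values in `W →L[ℝ] F`. -/
theorem contDiff_parametric_integral_nat {W : Type} [NormedAddCommGroup W] [NormedSpace ℝ W]
    [FiniteDimensional ℝ W] (n : ℕ) : ∀ {F : Type} [NormedAddCommGroup F] [NormedSpace ℝ F]
    {g : ℝ × W → F}, ContDiff ℝ ∞ g → ContDiff ℝ n (fun r => ∫ t in (0 : ℝ)..1, g (t, r)) := by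
  induction n with
  | zero =>
    intro F _ _ g hg
    rw [Nat.cast_zero, contDiff_zero, continuous_iff_continuousAt]
    exact fun r => (hasFDerivAt_parametric_integral (hg.of_le (by simp)) r).continuousAt
  | succ n ih =>
    intro F _ _ g hg
    have hd := fun r => hasFDerivAt_parametric_integral (hg.of_le (by simp)) r
    rw [Nat.cast_succ, contDiff_succ_iff_fderiv]
    refine ⟨fun r => (hd r).differentiableAt, by simp, ?_⟩
    rw [funext fun r => (hd r).fderiv]
    exact ih (g := fun z => (fderiv ℝ g z).comp (ContinuousLinearMap.inr ℝ ℝ W))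
      ((hg.fderiv_right (by simp)).clm_comp contDiff_const)

theorem contDiff_parametric_integral {W F : Type} [NormedAddCommGroup W] [NormedSpace ℝ W]
    [FiniteDimensional ℝ W] [NormedAddCommGroup F] [NormedSpace ℝ F]
    {g : ℝ × W → F} (hg : ContDiff ℝ ∞ g) :
    ContDiff ℝ ∞ (fun r => ∫ t in (0 : ℝ)..1, g (t, r)) :=
  contDiff_infty.2 fun n => contDiff_parametric_integral_nat n hg

end ParametricIntegral

/-! ### Calculus in convenient vector spaces -/

section Calculus

variable {W W' : Type*} [NormedAddCommGroup W] [NormedSpace ℝ W]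
  [NormedAddCommGroup W'] [NormedSpace ℝ W']
  {E F : Type*}
  [AddCommGroup E] [Module ℝ E] [TopologicalSpace E] [DiffeologicalSpace E] [ConvenientSpace E]
  [AddCommGroup F] [Module ℝ F] [TopologicalSpace F] [DiffeologicalSpace F] [ConvenientSpace F]

/-- Hahn–Banach. It reduces identities between derivatives in `E` to calculus of real-valued
functions. -/
theorem eq_of_forall_dual {x y : E} (h : ∀ l : E →L[ℝ] ℝ, l x = l y) : x = y :=
  (SeparatingDual.eq_iff_forall_dual_eq (R := ℝ)).2 h

theorem isSmooth_iff_scalarwise [FiniteDimensional ℝ W] {p : W → E} :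
    IsSmooth p ↔ ∀ l : E →L[ℝ] ℝ, ContDiff ℝ ∞ (fun r => l (p r)) := by
  refine ⟨fun h l => ?_, fun h n φ hφ => (ConvenientSpace.isPlot_iff n _).2 fun l =>
    (h l).comp hφ⟩
  have := (ConvenientSpace.isPlot_iff _ _).1
    (h _ (toEuclidean (E := W)).symm (toEuclidean (E := W)).symm.contDiff) l
  simpa [Function.comp_def] using this.comp (toEuclidean (E := W)).contDiff

theorem IsSmooth.add [FiniteDimensional ℝ W] {p q : W → E} (hp : IsSmooth p) (hq : IsSmooth q) :
    IsSmooth (fun r => p r + q r) :=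
  isSmooth_iff_scalarwise.2 fun l => by
    simpa using (isSmooth_iff_scalarwise.1 hp l).add (isSmooth_iff_scalarwise.1 hq l)

theorem IsSmooth.sub [FiniteDimensional ℝ W] {p q : W → E} (hp : IsSmooth p) (hq : IsSmooth q) :
    IsSmooth (fun r => p r - q r) :=
  isSmooth_iff_scalarwise.2 fun l => by
    simpa using (isSmooth_iff_scalarwise.1 hp l).sub (isSmooth_iff_scalarwise.1 hq l)

theorem IsSmooth.smul [FiniteDimensional ℝ W] {a : W → ℝ} {p : W → E} (ha : ContDiff ℝ ∞ a)
    (hp : IsSmooth p) : IsSmooth (fun r => a r • p r) :=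
  isSmooth_iff_scalarwise.2 fun l => by
    simpa using ha.mul (isSmooth_iff_scalarwise.1 hp l)

theorem IsSmooth.sum [FiniteDimensional ℝ W] {ι : Type*} (s : Finset ι) {p : ι → W → E}
    (hp : ∀ i ∈ s, IsSmooth (p i)) : IsSmooth (fun r => ∑ i ∈ s, p i r) :=
  isSmooth_iff_scalarwise.2 fun l => by
    simpa using ContDiff.sum fun i hi => isSmooth_iff_scalarwise.1 (hp i hi) l

theorem IsSmoothAt.add [FiniteDimensional ℝ W] {p q : W → E} {r : W} (hp : IsSmoothAt p r)
    (hq : IsSmoothAt q r) : IsSmoothAt (fun r => p r + q r) r := by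
  obtain ⟨p', hp', e⟩ := hp
  obtain ⟨q', hq', e'⟩ := hq
  exact ⟨_, hp'.add hq', e.add e'⟩

theorem IsSmoothAt.smul [FiniteDimensional ℝ W] {a : W → ℝ} {p : W → E} {r : W}
    (ha : ContDiff ℝ ∞ a) (hp : IsSmoothAt p r) : IsSmoothAt (fun r => a r • p r) r := by
  obtain ⟨p', hp', e⟩ := hp
  exact ⟨_, IsSmooth.smul ha hp', (EventuallyEq.refl _ a).smul e⟩

/-- This is where `c^∞`-completeness enters: scalarwise smoothness yields a genuine derivative in
`E`. -/
theorem IsSmooth.hasDerivAt {c : ℝ → E} (hc : IsSmooth c) (t : ℝ) :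
    HasDerivAt c (deriv c t) t := by
  have h := ConvenientSpace.complete c (isSmooth_iff_scalarwise.1 hc) t
  rw [hasDerivAt_iff_hasFDerivAt]
  convert! h.hasFDerivAt using 1
  ext
  simp [deriv]

theorem apply_deriv_of_isSmooth {c : ℝ → E} (hc : IsSmooth c) (l : E →L[ℝ] ℝ) (t : ℝ) :
    l (deriv c t) = deriv (fun s => l (c s)) t := by
  have h := (hc.hasDerivAt t)
  rw [hasDerivAt_iff_hasFDerivAt, hasFDerivAt_iff_isLittleOTVS] at h
  have h2 := l.isBigOTVS_comp.trans_isLittleOTVS h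
  symm
  apply HasDerivAt.deriv
  rw [hasDerivAt_iff_hasFDerivAt, hasFDerivAt_iff_isLittleOTVS]
  convert! h2 using 1
  ext s
  simp

/-- The derivative of `p` at `r` in the direction `w`. -/
def dd (p : W → E) (r w : W) : E := deriv (fun t : ℝ => p (r + t • w)) 0

theorem line_tendsto (r w : W) : Tendsto (fun t : ℝ => r + t • w) (𝓝 0) (𝓝 r) := by
  have : Continuous fun t : ℝ => r + t • w := by fun_prop
  simpa using this.tendsto 0

/-- The non-differentiable case matters too: then both sides take the default value 0. -/
theorem deriv_congr_of_eventuallyEq {f g : ℝ → E} {t : ℝ} (h : f =ᶠ[𝓝 t] g) :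
    deriv f t = deriv g t := by
  by_cases hf : DifferentiableAt ℝ f t
  · have hg : HasFDerivAt g (fderiv ℝ f t) t := by
      have := hf.hasFDerivAt
      rw [hasFDerivAt_iff_isLittleOTVS] at this ⊢
      refine this.congr' ?_ EventuallyEq.rfl
      filter_upwards [h] with s hs
      rw [hs, h.eq_of_nhds]
    rw [deriv, deriv, hg.unique hg.differentiableAt.hasFDerivAt]
  · have hg : ¬ DifferentiableAt ℝ g t := by
      rintro ⟨g', hg⟩
      refine hf ⟨g', ?_⟩
      rw [hasFDerivAt_iff_isLittleOTVS] at hg ⊢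
      refine hg.congr' ?_ EventuallyEq.rfl
      filter_upwards [h] with s hs
      rw [hs, h.eq_of_nhds]
    rw [deriv, deriv, fderiv_zero_of_not_differentiableAt hf,
      fderiv_zero_of_not_differentiableAt hg]

theorem dd_congr {p q : W → E} {r : W} (h : p =ᶠ[𝓝 r] q) (w : W) : dd p r w = dd q r w :=
  deriv_congr_of_eventuallyEq ((line_tendsto r w).eventually h)

theorem apply_dd [FiniteDimensional ℝ W] {p : W → E} (hp : IsSmooth p) (l : E →L[ℝ] ℝ) (r w : W) :
    l (dd p r w) = fderiv ℝ (fun s => l (p s)) r w := by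
  have hl := isSmooth_iff_scalarwise.1 hp l
  have hc : ContDiff ℝ ∞ fun t : ℝ => r + t • w := by fun_prop
  rw [dd, apply_deriv_of_isSmooth (hp.comp hc)]
  have h1 : HasFDerivAt (fun s => l (p s)) (fderiv ℝ (fun s => l (p s)) r) (r + (0 : ℝ) • w) := by
    rw [zero_smul, add_zero]
    exact (hl.differentiable (by simp) r).hasFDerivAt
  have h2 : HasDerivAt (fun t : ℝ => r + t • w) w 0 := by
    simpa using ((hasDerivAt_id (0 : ℝ)).smul_const w).const_add r
  exact (h1.comp_hasDerivAt (0 : ℝ) h2).deriv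

theorem IsSmooth.dd [FiniteDimensional ℝ W] [FiniteDimensional ℝ W'] {p : W → E} (hp : IsSmooth p)
    {φ v : W' → W} (hφ : ContDiff ℝ ∞ φ) (hv : ContDiff ℝ ∞ v) :
    IsSmooth (fun s => dd p (φ s) (v s)) :=
  isSmooth_iff_scalarwise.2 fun l => by
    simp_rw [apply_dd hp]
    exact (((isSmooth_iff_scalarwise.1 hp l).fderiv_right (m := ∞) (by simp)).comp hφ).clm_apply hv

theorem IsSmoothAt.dd [FiniteDimensional ℝ W] [FiniteDimensional ℝ W'] {p : W → E}
    {φ v : W' → W} {s : W'} (hp : IsSmoothAt p (φ s)) (hφ : ContDiff ℝ ∞ φ)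
    (hv : ContDiff ℝ ∞ v) : IsSmoothAt (fun s => dd p (φ s) (v s)) s := by
  obtain ⟨q, hq, e⟩ := hp
  refine ⟨_, hq.dd hφ hv, ?_⟩
  filter_upwards [hφ.continuous.continuousAt.eventually e.eventually_nhds] with s' hs'
  exact dd_congr hs' _

theorem dd_add_right [FiniteDimensional ℝ W] {p : W → E} {r : W} (hp : IsSmoothAt p r) (v w : W) :
    dd p r (v + w) = dd p r v + dd p r w := by
  obtain ⟨q, hq, e⟩ := hp
  simp_rw [dd_congr e]
  exact eq_of_forall_dual fun l => by simp [apply_dd hq]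

theorem dd_smul_right [FiniteDimensional ℝ W] {p : W → E} {r : W} (hp : IsSmoothAt p r) (a : ℝ)
    (w : W) : dd p r (a • w) = a • dd p r w := by
  obtain ⟨q, hq, e⟩ := hp
  simp_rw [dd_congr e]
  exact eq_of_forall_dual fun l => by simp [apply_dd hq]

theorem dd_sum_right [FiniteDimensional ℝ W] {p : W → E} {r : W} (hp : IsSmoothAt p r)
    {ι : Type*} (s : Finset ι) (w : ι → W) : dd p r (∑ i ∈ s, w i) = ∑ i ∈ s, dd p r (w i) := by
  obtain ⟨q, hq, e⟩ := hp
  simp_rw [dd_congr e]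
  exact eq_of_forall_dual fun l => by simp [apply_dd hq]

theorem deriv_const' (x : E) (t : ℝ) : deriv (fun _ => x) t = 0 :=
  eq_of_forall_dual fun l => by rw [apply_deriv_of_isSmooth (isSmooth_const x)]; simp

theorem dd_const [FiniteDimensional ℝ W] (x : E) (r w : W) : dd (fun _ => x) r w = 0 :=
  deriv_const' x 0

theorem dd_add [FiniteDimensional ℝ W] {p q : W → E} (hp : IsSmooth p) (hq : IsSmooth q)
    (r w : W) : dd (fun s => p s + q s) r w = dd p r w + dd q r w :=
  eq_of_forall_dual fun l => by
    rw [map_add, apply_dd hp, apply_dd hq, apply_dd (hp.add hq)]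
    simp_rw [map_add]
    rw [fderiv_fun_add ((isSmooth_iff_scalarwise.1 hp l).differentiable (by simp) r)
      ((isSmooth_iff_scalarwise.1 hq l).differentiable (by simp) r)]
    rfl

theorem dd_sub [FiniteDimensional ℝ W] {p q : W → E} (hp : IsSmooth p) (hq : IsSmooth q)
    (r w : W) : dd (fun s => p s - q s) r w = dd p r w - dd q r w :=
  eq_of_forall_dual fun l => by
    rw [map_sub, apply_dd hp, apply_dd hq, apply_dd (hp.sub hq)]
    simp_rw [map_sub]
    rw [fderiv_fun_sub ((isSmooth_iff_scalarwise.1 hp l).differentiable (by simp) r)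
      ((isSmooth_iff_scalarwise.1 hq l).differentiable (by simp) r)]
    rfl

theorem dd_smul [FiniteDimensional ℝ W] {a : W → ℝ} {p : W → E} (ha : ContDiff ℝ ∞ a)
    (hp : IsSmooth p) (r w : W) :
    dd (fun s => a s • p s) r w = fderiv ℝ a r w • p r + a r • dd p r w :=
  eq_of_forall_dual fun l => by
    rw [map_add, map_smul, map_smul, apply_dd hp, apply_dd (IsSmooth.smul ha hp)]
    simp_rw [map_smul, smul_eq_mul]
    rw [fderiv_fun_mul (ha.differentiable (by simp) r)
      ((isSmooth_iff_scalarwise.1 hp l).differentiable (by simp) r)]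
    simp
    ring

theorem dd_comm [FiniteDimensional ℝ W] {p : W → E} (hp : IsSmooth p) (r v w : W) :
    dd (fun s => dd p s v) r w = dd (fun s => dd p s w) r v :=
  eq_of_forall_dual fun l => by
    have hl := isSmooth_iff_scalarwise.1 hp l
    have hd : ∀ u : W, fderiv ℝ (fun s => l (dd p s u)) r =
        (fderiv ℝ (fderiv ℝ fun s => l (p s)) r).flip u := by
      intro u
      simp_rw [apply_dd hp]
      exact ((((hl.fderiv_right (m := ∞) (by simp)).differentiable (by simp) r).hasFDerivAt).clm_apply
        (hasFDerivAt_const u r)).fderiv.trans (by ext; simp)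
    rw [apply_dd (hp.dd (φ := fun s => s) contDiff_id contDiff_const),
      apply_dd (hp.dd (φ := fun s => s) contDiff_id contDiff_const), hd, hd]
    exact (second_derivative_symmetric (f := fun s => l (p s)) (f' := fderiv ℝ fun s => l (p s))
      (fun y => (hl.differentiable (by simp) y).hasFDerivAt)
      ((hl.fderiv_right (m := ∞) (by simp)).differentiable (by simp) r).hasFDerivAt _ _)

/-- Hadamard's lemma for curves. -/
theorem exists_hadamard {c : ℝ → E} (hc : IsSmooth c) :
    ∃ γ : ℝ → E, IsSmooth γ ∧ (∀ t, c t = c 0 + t • γ t) ∧ γ 0 = deriv c 0 := by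
  classical
  refine ⟨fun t => if t = 0 then deriv c 0 else t⁻¹ • (c t - c 0), ?_, fun t => ?_, by simp⟩
  · refine isSmooth_iff_scalarwise.2 fun l => ?_
    have hl := isSmooth_iff_scalarwise.1 hc l
    have hl' : ContDiff ℝ ∞ (deriv fun s => l (c s)) := by
      simpa using hl.iterate_deriv 1
    -- After applying `l`, the difference quotient is the mean of `(l ∘ c)'` over the segment from 0
    -- to `t`, which is smooth in `t`, also at 0. No integral in `E` is needed.
    have key : (fun t => l (if t = 0 then deriv c 0 else t⁻¹ • (c t - c 0))) =
        fun t => ∫ s in (0 : ℝ)..1, deriv (fun s => l (c s)) (s * t) := by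
      funext t
      split_ifs with h
      · simp [h, apply_deriv_of_isSmooth hc]
      · rw [intervalIntegral.integral_comp_mul_right _ h, zero_mul, one_mul,
          intervalIntegral.integral_deriv_eq_sub
            (fun x _ => hl.differentiable (by simp) x)
            (hl'.continuous.intervalIntegrable _ _)]
        simp
    rw [key]
    exact contDiff_parametric_integral (g := fun z : ℝ × ℝ => deriv (fun s => l (c s)) (z.1 * z.2))
      (hl'.comp (contDiff_fst.mul contDiff_snd))
  · by_cases h : t = 0
    · simp [h]
    · simp [h, smul_smul]

theorem exists_hadamard_of_isSmoothAt {c : ℝ → E} (hc : IsSmoothAt c 0) :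
    ∃ γ : ℝ → E, IsSmooth γ ∧ (∀ᶠ t in 𝓝 0, c t = c 0 + t • γ t) ∧ γ 0 = deriv c 0 := by
  obtain ⟨q, hq, e⟩ := hc
  obtain ⟨γ, hγ, h, h0⟩ := exists_hadamard hq
  refine ⟨γ, hγ, ?_, by rw [h0, deriv_congr_of_eventuallyEq e]⟩
  filter_upwards [e] with t ht
  rw [ht, e.eq_of_nhds, h]

/-- Linearity of the directional derivative applied to `(1, 1) = (1, 0) + (0, 1)`. The chain and
Leibniz rules below arise by giving different occurrences of the time variable independent names. -/
theorem deriv_diag {h : ℝ × ℝ → E} (hh : IsSmoothAt h 0) :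
    deriv (fun t => h (t, t)) 0 = deriv (fun t => h (t, 0)) 0 + deriv (fun t => h (0, t)) 0 := by
  have := dd_add_right hh (1, 0) (0, 1)
  simpa [dd] using this

theorem deriv_diag_pi {ι : Type*} [Fintype ι] [DecidableEq ι] {h : (ι → ℝ) → E}
    (hh : IsSmoothAt h 0) :
    deriv (fun t => h (fun _ => t)) 0 = ∑ i, deriv (fun t => h (Pi.single i t)) 0 := by
  have := dd_sum_right hh Finset.univ (fun i => Pi.single i (1 : ℝ))
  rw [Finset.univ_sum_single (fun _ : ι => (1 : ℝ))] at this
  have h1 : ∀ (t : ℝ) (i : ι), t • Pi.single i (1 : ℝ) = (Pi.single i t : ι → ℝ) := fun t i => by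
    rw [← Pi.single_smul, smul_eq_mul, mul_one]
  have h2 : ∀ t : ℝ, t • (fun _ : ι => (1 : ℝ)) = fun _ => t := fun t => by
    ext
    simp
  simpa only [dd, zero_add, h1, h2] using this

/-- The chain rule along curves. -/
theorem deriv_comp_curve {f : E → F} {x : E} (hf : MapSmoothAt f x) {c : ℝ → E}
    (hc : IsSmoothAt c 0) (hx : c 0 = x) :
    deriv (fun t => f (c t)) 0 = deriv (fun t : ℝ => f (x + t • deriv c 0)) 0 := by
  obtain ⟨γ, hγ, h, h0⟩ := exists_hadamard_of_isSmoothAt hc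
  -- On the diagonal this family is the curve `c`. At `z.1 = 0` it is constant, so only the
  -- derivative in `z.1` survives, which is the derivative of `f` along a line with direction `γ 0 =
  -- c'(0)`.
  have hs : IsSmooth fun z : ℝ × ℝ => x + z.1 • γ z.2 :=
    (isSmooth_const x).add (IsSmooth.smul contDiff_fst (hγ.comp contDiff_snd))
  have hh : IsSmoothAt (fun z : ℝ × ℝ => f (x + z.1 • γ z.2)) 0 :=
    hf.isSmoothAt' (hs.isSmoothAt 0) (by simp)
  have := deriv_diag hh
  simp only [zero_smul, add_zero, deriv_const', h0] at this
  rw [← this]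
  refine deriv_congr_of_eventuallyEq ?_
  filter_upwards [h] with t ht
  rw [ht, hx]

theorem deriv_line (x v : E) : deriv (fun t : ℝ => x + t • v) 0 = v :=
  eq_of_forall_dual fun l => by
    rw [apply_deriv_of_isSmooth ((isSmooth_const x).add (IsSmooth.smul (a := fun t => t)
      contDiff_id (isSmooth_const v)))]
    simp

/-- Smooth linear maps commute with derivatives of curves. -/
theorem deriv_linear (L : E →ₗ[ℝ] F) (hL : DSmooth L) {c : ℝ → E} (hc : IsSmoothAt c 0) :
    deriv (fun t => L (c t)) 0 = L (deriv c 0) := by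
  rw [deriv_comp_curve (f := L) (mapSmoothAt_of_dSmooth hL _) hc rfl]
  simp [deriv_line]

theorem dd_linear [FiniteDimensional ℝ W] (L : E →ₗ[ℝ] F) (hL : DSmooth L) {p : W → E} {r : W}
    (hp : IsSmoothAt p r) (w : W) : dd (fun s => L (p s)) r w = L (dd p r w) :=
  deriv_linear L hL (hp.comp' (by fun_prop) (by simp))

/-- The Leibniz rule for smooth multilinear maps. -/
theorem deriv_multilinear {k : ℕ} (φ : MultilinearMap ℝ (fun _ : Fin k => E) F)
    (hφ : DSmooth (fun a : Fin k → E => φ a)) {c : ℝ → Fin k → E}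
    (hc : ∀ i, IsSmoothAt (fun t => c t i) 0) :
    deriv (fun t => φ (c t)) 0 =
      ∑ i, φ (Function.update (c 0) i (deriv (fun t => c t i) 0)) := by
  -- Each argument gets its own time variable; the diagonal derivative is then the sum of the
  -- partial ones.
  have hh : IsSmoothAt (fun x : Fin k → ℝ => φ (fun i => c (x i) i)) 0 :=
    IsSmoothAt.map (IsSmoothAt.pi fun i => (hc i).comp' (φ := fun x : Fin k → ℝ => x i)
      (contDiff_apply ℝ ℝ i) rfl) hφ
  have := deriv_diag_pi hh
  refine this.trans (Finset.sum_congr rfl fun i _ => ?_)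
  have hL : DSmooth (φ.toLinearMap (c 0) i) := by
    intro n p hp
    refine hφ n (fun r => Function.update (c 0) i (p r)) fun j => ?_
    by_cases h : j = i
    · subst h
      simpa using hp
    · simpa [h] using isPlot_const
  rw [← MultilinearMap.toLinearMap_apply, ← deriv_linear _ hL (hc i)]
  congr 1
  funext t
  rw [MultilinearMap.toLinearMap_apply]
  congr 1
  funext j
  by_cases h : j = i
  · subst h
    simp
  · simp [h]

theorem dd_multilinear [FiniteDimensional ℝ W] {k : ℕ}
    (φ : MultilinearMap ℝ (fun _ : Fin k => E) F)
    (hφ : DSmooth (fun a : Fin k → E => φ a)) {c : W → Fin k → E}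
    {r : W} (hc : ∀ i, IsSmoothAt (fun s => c s i) r) (w : W) :
    dd (fun s => φ (c s)) r w = ∑ i, φ (Function.update (c r) i (dd (fun s => c s i) r w)) := by
  have := deriv_multilinear φ hφ (c := fun t : ℝ => c (r + t • w))
    fun i => (hc i).comp' (φ := fun t : ℝ => r + t • w) (by fun_prop) (by simp)
  simpa [dd] using this

/-- The Leibniz rule for smooth bilinear maps. -/
theorem deriv_bilinear {E' : Type*} [AddCommGroup E'] [Module ℝ E'] [TopologicalSpace E']
    [DiffeologicalSpace E'] [ConvenientSpace E'] (b : E →ₗ[ℝ] E' →ₗ[ℝ] F)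
    (hb : DSmooth (fun z : E × E' => b z.1 z.2)) {x : ℝ → E} {y : ℝ → E'}
    (hx : IsSmoothAt x 0) (hy : IsSmoothAt y 0) :
    deriv (fun t => b (x t) (y t)) 0 = b (deriv x 0) (y 0) + b (x 0) (deriv y 0) := by
  have hh : IsSmoothAt (fun z : ℝ × ℝ => b (x z.1) (y z.2)) 0 :=
    IsSmoothAt.map ((hx.comp' contDiff_fst rfl).prodMk (hy.comp' contDiff_snd rfl)) hb
  rw [deriv_diag hh]
  congr 1
  · refine deriv_linear (b.flip (y 0)) (fun n p hp => ?_) hx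
    exact hb n (fun r => (p r, y 0)) ⟨hp, isPlot_const⟩
  · refine deriv_linear (b (x 0)) (fun n p hp => ?_) hy
    exact hb n (fun r => (x 0, p r)) ⟨isPlot_const, hp⟩

theorem dd_bilinear [FiniteDimensional ℝ W] {E' : Type*} [AddCommGroup E'] [Module ℝ E']
    [TopologicalSpace E'] [DiffeologicalSpace E'] [ConvenientSpace E'] (b : E →ₗ[ℝ] E' →ₗ[ℝ] F)
    (hb : DSmooth (fun z : E × E' => b z.1 z.2)) {x : W → E} {y : W → E'} {r : W}
    (hx : IsSmoothAt x r) (hy : IsSmoothAt y r) (w : W) :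
    dd (fun s => b (x s) (y s)) r w = b (dd x r w) (y r) + b (x r) (dd y r w) := by
  have := deriv_bilinear b hb (x := fun t : ℝ => x (r + t • w)) (y := fun t : ℝ => y (r + t • w))
    (hx.comp' (by fun_prop) (by simp)) (hy.comp' (by fun_prop) (by simp))
  simpa [dd] using this

/-- The directional derivative of a map between convenient spaces is linear. -/
theorem deriv_line_add {f : E → F} {x : E} (hf : MapSmoothAt f x) (v w : E) :
    deriv (fun t : ℝ => f (x + t • (v + w))) 0 =
      deriv (fun t : ℝ => f (x + t • v)) 0 + deriv (fun t : ℝ => f (x + t • w)) 0 := by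
  have hh : IsSmoothAt (fun z : ℝ × ℝ => f (x + (z.1 • v + z.2 • w))) 0 :=
    hf.isSmoothAt' (((isSmooth_const x).add
      ((IsSmooth.smul contDiff_fst (isSmooth_const v)).add
        (IsSmooth.smul contDiff_snd (isSmooth_const w)))).isSmoothAt 0) (by simp)
  simpa using deriv_diag hh

theorem deriv_line_smul {f : E → F} {x : E} (hf : MapSmoothAt f x) (a : ℝ) (v : E) :
    deriv (fun t : ℝ => f (x + t • (a • v))) 0 = a • deriv (fun t : ℝ => f (x + t • v)) 0 := by
  have hh : IsSmoothAt (fun t : ℝ => f (x + t • v)) 0 :=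
    hf.isSmoothAt' (((isSmooth_const x).add
      (IsSmooth.smul contDiff_id (isSmooth_const v))).isSmoothAt 0) (by simp)
  have := dd_smul_right hh a 1
  simpa [dd, smul_smul] using this

end Calculus

/-! ### Velocities of plots and tangent maps -/

section Manifold

variable {W W' : Type*} [NormedAddCommGroup W] [NormedSpace ℝ W] [FiniteDimensional ℝ W]
  [NormedAddCommGroup W'] [NormedSpace ℝ W'] [FiniteDimensional ℝ W']
  {E F H : Type*}
  [AddCommGroup E] [Module ℝ E] [TopologicalSpace E] [DiffeologicalSpace E] [ConvenientSpace E]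
  [AddCommGroup F] [Module ℝ F] [TopologicalSpace F] [DiffeologicalSpace F] [ConvenientSpace F]
  [AddCommGroup H] [Module ℝ H] [TopologicalSpace H] [DiffeologicalSpace H] [ConvenientSpace H]
  {M N Q : Type*} [DiffeologicalSpace M] [ConvManifold E M] [DiffeologicalSpace N]
  [ConvManifold F N] [DiffeologicalSpace Q] [ConvManifold H Q]

open ConvManifold

theorem dd_comm_of_isSmoothAt {p : W → E} {r : W} (hp : IsSmoothAt p r) (v w : W) :
    dd (fun s => dd p s v) r w = dd (fun s => dd p s w) r v := by
  obtain ⟨q, hq, e⟩ := hp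
  rw [dd_congr (q := fun s => dd q s v) (e.eventually_nhds.mono fun s hs => dd_congr hs v) w,
    dd_congr (q := fun s => dd q s w) (e.eventually_nhds.mono fun s hs => dd_congr hs w) v,
    dd_comm hq]

theorem mapSmoothAt_chart {x y : M} (hy : y ∈ (chart (E := E) x).source) :
    MapSmoothAt (chart (E := E) x) y :=
  (smooth_chart x).mapSmoothAt (isOpen_source x) hy

theorem mapSmoothAt_chart_symm {x : M} {e : E} (he : e ∈ (chart (E := E) x).target) :
    MapSmoothAt (chart (E := E) x).symm e :=
  (smooth_symm x).mapSmoothAt (isOpen_target x) he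

theorem chart_self_mem_target (x : M) : chart (E := E) x x ∈ (chart (E := E) x).target :=
  (chart x).map_source (mem_source x)

theorem chart_symm_chart_self (x : M) : (chart (E := E) x).symm (chart (E := E) x x) = x :=
  (chart x).left_inv (mem_source x)

variable (E) in
/-- The velocity of `p : W → M` at `r` in the direction `w`, read in `chart (p r)`. -/
def vel (p : W → M) (r w : W) : E := dd (fun s => chart (E := E) (p r) (p s)) r w

theorem vel_eq_deriv (p : W → M) (r w : W) :
    vel E p r w = deriv (fun t : ℝ => chart (E := E) (p r) (p (r + t • w))) 0 := rfl

theorem vel_model (p : W → E) (r w : W) : vel E p r w = dd p r w := rfl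

theorem vel_congr {p q : W → M} {r : W} (h : p =ᶠ[𝓝 r] q) (w : W) : vel E p r w = vel E q r w := by
  rw [vel, vel, h.eq_of_nhds]
  exact dd_congr (h.fun_comp _) w

theorem IsSmoothAt.chart {p : W → M} {r : W} (hp : IsSmoothAt p r) {x : M}
    (hx : p r ∈ (chart (E := E) x).source) :
    IsSmoothAt (fun s => ConvManifold.chart (E := E) x (p s)) r :=
  isSmoothAt_of_dSmoothOn (smooth_chart x) (isOpen_source x) hp hx

theorem vel_add {p : W → M} {r : W} (hp : IsSmoothAt p r) (v w : W) :
    vel E p r (v + w) = vel E p r v + vel E p r w :=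
  dd_add_right (hp.chart (mem_source _)) v w

theorem vel_smul {p : W → M} {r : W} (hp : IsSmoothAt p r) (a : ℝ) (w : W) :
    vel E p r (a • w) = a • vel E p r w :=
  dd_smul_right (hp.chart (mem_source _)) a w

theorem vel_comp_linear {p : W → M} (L : W' →L[ℝ] W) (r w : W') :
    vel E (fun s => p (L s)) r w = vel E p (L r) (L w) := by
  simp [vel, dd]

theorem vel_comp_line (p : W → M) (r w : W) :
    vel E (fun t : ℝ => p (r + t • w)) 0 1 = vel E p r w := by
  simp [vel, dd]

/-- The tangent map sends velocities to velocities. -/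
theorem tmap_vel {f : M → N} {p : W → M} {r : W} (hf : MapSmoothAt f (p r)) (hp : IsSmoothAt p r)
    (w : W) : tmap E F f (p r) (vel E p r w) = vel F (fun s => f (p s)) r w := by
  set x := p r with hx
  have hF : MapSmoothAt (fun e => chart (E := F) (f x) (f ((chart (E := E) x).symm e)))
      (chart (E := E) x x) := by
    have h2 : MapSmoothAt (fun e => f ((chart (E := E) x).symm e)) (chart (E := E) x x) := by
      refine MapSmoothAt.comp ?_ (mapSmoothAt_chart_symm (chart_self_mem_target x))
      rwa [chart_symm_chart_self]
    refine MapSmoothAt.comp (g := chart (E := F) (f x)) ?_ h2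
    rw [chart_symm_chart_self]
    exact mapSmoothAt_chart (mem_source _)
  have hc : IsSmoothAt (fun t : ℝ => chart (E := E) x (p (r + t • w))) 0 := by
    refine IsSmoothAt.comp' (hp.chart (E := E) (x := x) (hx ▸ mem_source _))
      (φ := fun t : ℝ => r + t • w) (by fun_prop) (by simp)
  -- The chain rule for the coordinate expression of `f` along the coordinate expression of `p`.
  have := deriv_comp_curve hF hc (by simp [hx])
  rw [tmap, vel, dd]
  refine Eq.trans this.symm (deriv_congr_of_eventuallyEq ?_)
  have hm := (line_tendsto r w).eventually
    (hp.eventually_mem (isOpen_source (E := E) x) (hx ▸ mem_source _))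
  filter_upwards [hm] with t ht
  rw [(chart (E := E) x).left_inv ht]

theorem tmap_vel' {f : M → N} {p : W → M} {r : W} {x : M} (hf : MapSmoothAt f x)
    (hp : IsSmoothAt p r) (h : p r = x) (w : W) :
    tmap E F f x (vel E p r w) = vel F (fun s => f (p s)) r w := by
  subst h
  exact tmap_vel hf hp w

theorem mapSmoothAt_localForm {f : M → N} {x : M} (hf : MapSmoothAt f x) :
    MapSmoothAt (fun e => chart (E := F) (f x) (f ((chart (E := E) x).symm e)))
      (chart (E := E) x x) := by
  have h2 : MapSmoothAt (fun e => f ((chart (E := E) x).symm e)) (chart (E := E) x x) := by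
    refine MapSmoothAt.comp ?_ (mapSmoothAt_chart_symm (chart_self_mem_target x))
    rwa [chart_symm_chart_self]
  refine MapSmoothAt.comp (g := chart (E := F) (f x)) ?_ h2
  rw [chart_symm_chart_self]
  exact mapSmoothAt_chart (mem_source _)

/-- The tangent map as a linear map. -/
def tmapLinear {f : M → N} {x : M} (hf : MapSmoothAt f x) : E →ₗ[ℝ] F where
  toFun := tmap E F f x
  map_add' := deriv_line_add (mapSmoothAt_localForm hf)
  map_smul' := deriv_line_smul (mapSmoothAt_localForm hf)

theorem tmap_add {f : M → N} {x : M} (hf : MapSmoothAt f x) (v w : E) :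
    tmap E F f x (v + w) = tmap E F f x v + tmap E F f x w := (tmapLinear hf).map_add v w

theorem tmap_sub {f : M → N} {x : M} (hf : MapSmoothAt f x) (v w : E) :
    tmap E F f x (v - w) = tmap E F f x v - tmap E F f x w := (tmapLinear hf).map_sub v w

theorem tmap_smul {f : M → N} {x : M} (hf : MapSmoothAt f x) (a : ℝ) (v : E) :
    tmap E F f x (a • v) = a • tmap E F f x v := (tmapLinear hf).map_smul a v

theorem tmap_zero {f : M → N} {x : M} (hf : MapSmoothAt f x) : tmap E F f x 0 = 0 :=
  (tmapLinear hf).map_zero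

/-- Plots with prescribed velocities, affine in a chart. -/
theorem exists_affine_plot (x : M) {ι : Type*} [Fintype ι] [DecidableEq ι] (v : ι → E) :
    ∃ q : (ι → ℝ) → M, IsSmooth q ∧ q 0 = x ∧
      (∀ᶠ t in 𝓝 0, (chart (E := E) x).symm (chart (E := E) x x + ∑ i, t i • v i) = q t ∧
        ∀ i, tmap E E (chart (E := E) x).symm (chart (E := E) x x + ∑ i, t i • v i) (v i) =
          vel E q t (Pi.single i 1)) ∧
      ∀ i, vel E q 0 (Pi.single i 1) = v i := by
  have ha : IsSmooth fun t : ι → ℝ => chart (E := E) x x + ∑ i, t i • v i :=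
    (isSmooth_const _).add (IsSmooth.sum _ fun i _ =>
      IsSmooth.smul (contDiff_apply ℝ ℝ i) (isSmooth_const _))
  have h0 : chart (E := E) x x + ∑ i, (0 : ι → ℝ) i • v i = chart (E := E) x x := by simp
  have hda : ∀ (t : ι → ℝ) (i : ι),
      dd (fun t : ι → ℝ => chart (E := E) x x + ∑ i, t i • v i) t (Pi.single i 1) = v i := by
    intro t i
    have : ∀ s : ℝ, chart (E := E) x x + ∑ j, (t + s • Pi.single i (1 : ℝ) : ι → ℝ) j • v j =
        (chart (E := E) x x + ∑ i, t i • v i) + s • v i := by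
      intro s
      simp only [Pi.add_apply, add_smul, Finset.sum_add_distrib, ← add_assoc, Pi.smul_apply]
      congr 1
      rw [Finset.sum_eq_single i (fun j _ hj => by simp [hj]) (by simp)]
      simp
    simp_rw [dd, this]
    exact deriv_line _ _
  -- The inverse chart is smooth only on its target, so the affine family is replaced by a globally
  -- smooth `q` with the same germ at 0.
  obtain ⟨q, hq, e⟩ : IsSmoothAt
      (fun t : ι → ℝ => (chart (E := E) x).symm (chart (E := E) x x + ∑ i, t i • v i)) 0 :=
    (mapSmoothAt_chart_symm (chart_self_mem_target x)).isSmoothAt' (ha.isSmoothAt 0) h0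
  have hq0 : q 0 = x := by
    rw [← e.eq_of_nhds]
    simp [chart_symm_chart_self]
  have hev : ∀ᶠ t : ι → ℝ in 𝓝 0, chart (E := E) x x + ∑ i, t i • v i ∈ (chart (E := E) x).target :=
    (ha.isSmoothAt 0).eventually_mem (isOpen_target x) (by simpa using chart_self_mem_target x)
  have key : ∀ᶠ t in 𝓝 0, (chart (E := E) x).symm (chart (E := E) x x + ∑ i, t i • v i) = q t ∧
        ∀ i, tmap E E (chart (E := E) x).symm (chart (E := E) x x + ∑ i, t i • v i) (v i) =
          vel E q t (Pi.single i 1) := by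
    filter_upwards [e.eventually_nhds, hev] with t ht htt
    replace ht : (fun t : ι → ℝ => (chart (E := E) x).symm
      (chart (E := E) x x + ∑ i, t i • v i)) =ᶠ[𝓝 t] q := ht
    refine ⟨ht.eq_of_nhds, fun i => ?_⟩
    rw [← vel_congr ht]
    have := tmap_vel' (E := E) (F := E) (mapSmoothAt_chart_symm htt) (ha.isSmoothAt t) rfl
      (Pi.single i 1)
    rwa [vel_model, hda] at this
  refine ⟨q, hq, hq0, key, fun i => ?_⟩
  rw [← vel_congr e, vel]
  have : (fun t : ι → ℝ => chart (E := E)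
        ((chart (E := E) x).symm (chart (E := E) x x + ∑ i, (0 : ι → ℝ) i • v i))
        ((chart (E := E) x).symm (chart (E := E) x x + ∑ i, t i • v i))) =ᶠ[𝓝 0]
      fun t : ι → ℝ => chart (E := E) x x + ∑ i, t i • v i := by
    filter_upwards [hev] with t ht
    rw [h0, chart_symm_chart_self, (chart (E := E) x).right_inv ht]
  rw [dd_congr this, hda]

/-- A curve with prescribed velocity. -/
theorem exists_curve (x : M) (v : E) :
    ∃ c : ℝ → M, IsSmooth c ∧ c 0 = x ∧ vel E c 0 1 = v ∧
      ∀ᶠ t in 𝓝 0, c t = (chart (E := E) x).symm (chart (E := E) x x + t • v) := by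
  obtain ⟨q, hq, hq0, hev, hv⟩ := exists_affine_plot x (fun _ : Unit => v)
  let L : ℝ →L[ℝ] (Unit → ℝ) := ContinuousLinearMap.pi fun _ => ContinuousLinearMap.id ℝ ℝ
  have hL : (fun t => L t) = fun t : ℝ => (fun _ : Unit => t) := rfl
  refine ⟨fun t => q (L t), hq.comp L.contDiff, by simpa using hq0, ?_, ?_⟩
  · rw [vel_comp_linear, map_zero, ← hv ()]
    congr 1
  · have : Tendsto (fun t => L t) (𝓝 0) (𝓝 0) := L.continuous.tendsto' 0 0 (map_zero _)
    filter_upwards [this.eventually hev] with t ht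
    simpa [L] using ht.1.symm

/-- Every tangent vector is the velocity of a curve, so functoriality reduces to `tmap_vel`. -/
theorem tmap_comp {f : M → N} {g : N → Q} {x : M} (hg : MapSmoothAt g (f x))
    (hf : MapSmoothAt f x) (v : E) :
    tmap F H g (f x) (tmap E F f x v) = tmap E H (fun y => g (f y)) x v := by
  obtain ⟨c, hc, hc0, hv, -⟩ := exists_curve x v
  subst hc0
  rw [← hv, tmap_vel hf (hc.isSmoothAt 0), tmap_vel (hg.comp hf) (hc.isSmoothAt 0)]
  exact tmap_vel' hg (hf.isSmoothAt (hc.isSmoothAt 0)) rfl 1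

theorem tmap_congr {f g : M → N} {x : M} {U : Set M} (hU : IsOpen[dTopology] U) (hx : x ∈ U)
    (h : ∀ y ∈ U, f y = g y) (hf : MapSmoothAt f x) (hg : MapSmoothAt g x) (v : E) :
    tmap E F f x v = tmap E F g x v := by
  obtain ⟨c, hc, hc0, hv, -⟩ := exists_curve x v
  subst hc0
  rw [← hv, tmap_vel hf (hc.isSmoothAt 0), tmap_vel hg (hc.isSmoothAt 0)]
  refine vel_congr ?_ _
  filter_upwards [(hc.isSmoothAt 0).eventually_mem hU hx] with t ht using h _ ht

theorem tmap_id (x : M) (v : E) : tmap E E (fun y : M => y) x v = v := by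
  obtain ⟨c, hc, hc0, hv, -⟩ := exists_curve x v
  subst hc0
  rw [← hv, tmap_vel (mapSmoothAt_id _) (hc.isSmoothAt 0)]

end Manifold

/-! ### Differential forms on plots -/

section FormsOnPlots

open ConvManifold

variable {W : Type*} [NormedAddCommGroup W] [NormedSpace ℝ W] [FiniteDimensional ℝ W]
  {E V : Type*}
  [AddCommGroup E] [Module ℝ E] [TopologicalSpace E] [DiffeologicalSpace E] [ConvenientSpace E]
  [AddCommGroup V] [Module ℝ V] [TopologicalSpace V] [DiffeologicalSpace V] [ConvenientSpace V]
  {M : Type*} [DiffeologicalSpace M] [ConvManifold E M]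

/-- Near `r` the plot is the inverse chart applied to its coordinates, so the tangent map of the
inverse chart takes coordinate velocities to velocities. This passes between smoothness in charts
and smoothness along plots. -/
theorem form_vel_eq_localRep {k : ℕ} {V : Type*} (α : M → (Fin k → E) → V) {p : W → M} {r : W}
    (hp : IsSmoothAt p r) {x : M} (hx : p r ∈ (chart (E := E) x).source) (w : Fin k → W) :
    α (p r) (fun i => vel E p r (w i)) = localRep α x (chart (E := E) x (p r))
      (fun i => dd (fun s => chart (E := E) x (p s)) r (w i)) := by
  rw [localRep, pullback, (chart (E := E) x).left_inv hx]
  congr 1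
  funext i
  have := tmap_vel' (E := E) (F := E) (mapSmoothAt_chart_symm ((chart (E := E) x).map_source hx))
    (hp.chart hx) rfl (w i)
  rw [vel_model] at this
  rw [this]
  refine vel_congr ?_ _
  filter_upwards [hp.eventually_mem (isOpen_source (E := E) x) hx] with s hs
  rw [(chart (E := E) x).left_inv hs]

theorem isOpen_fst_preimage {X Y : Type*} [DiffeologicalSpace X] [DiffeologicalSpace Y]
    {U : Set X} (hU : IsOpen[dTopology] U) : IsOpen[dTopology] {z : X × Y | z.1 ∈ U} :=
  isOpen_iff_preimages_plots.2 fun n _ hp => isOpen_iff_preimages_plots.1 hU n _ hp.1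

theorem DForm.isSmooth_vel {k : ℕ} (α : DForm E M V k) {p : W → M} (hp : IsSmooth p)
    (w : Fin k → W) : IsSmooth (fun r => α (p r) (fun i => vel E p r (w i))) := by
  refine isSmooth_of_isSmoothAt fun r => ?_
  have hc := (hp.isSmoothAt r).chart (E := E) (mem_source (p r))
  have h1 : IsSmoothAt (fun s => (chart (E := E) (p r) (p s),
      fun i : Fin k => dd (fun s => chart (E := E) (p r) (p s)) s (w i))) r :=
    hc.prodMk (IsSmoothAt.pi fun i => hc.dd (φ := fun s => s) contDiff_id contDiff_const)
  refine (isSmoothAt_of_dSmoothOn (α.smooth (p r)) (isOpen_fst_preimage (isOpen_target (p r))) h1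
    (chart_self_mem_target (p r))).congr ?_
  filter_upwards [(hp.isSmoothAt r).eventually_mem (isOpen_source (E := E) (p r))
    (mem_source (p r))] with s hs
  exact (form_vel_eq_localRep (fun x v => α x v) (hp.isSmoothAt s) hs w).symm

/-- A fibrewise alternating form that is smooth along plots is a smooth form. -/
def DForm.ofPlots {k : ℕ} (α : M → (E [⋀^Fin k]→ₗ[ℝ] V))
    (h : ∀ (n : ℕ) (p : EuclideanSpace ℝ (Fin n) × (Fin k → ℝ) → M), IsSmooth p →
      ∀ w : Fin k → EuclideanSpace ℝ (Fin n) × (Fin k → ℝ),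
      IsSmooth (fun r => α (p r) (fun i => vel E p r (w i)))) : DForm E M V k where
  toAlt := α
  smooth x := by
    refine dSmoothOn_of_isSmoothAt fun n z hz hzU r₀ => ?_
    -- The extra parameters `Fin k → ℝ` realize the `k` vector arguments as velocities: at `(r, 0)`
    -- the coordinate derivative in the `i`-th extra direction is the `i`-th vector.
    have ha : IsSmooth fun s : EuclideanSpace ℝ (Fin n) × (Fin k → ℝ) =>
        (z s.1).1 + ∑ i, s.2 i • (z s.1).2 i :=
      (hz.fst.comp contDiff_fst).add (IsSmooth.sum _ fun i _ =>
        IsSmooth.smul (a := fun s : EuclideanSpace ℝ (Fin n) × (Fin k → ℝ) => s.2 i)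
          ((contDiff_apply ℝ ℝ i).comp contDiff_snd)
          (fun m φ hφ => (hz m _ (contDiff_fst.comp hφ)).2 i))
    obtain ⟨q, hq, e⟩ : IsSmoothAt (fun s : EuclideanSpace ℝ (Fin n) × (Fin k → ℝ) =>
        (chart (E := E) x).symm ((z s.1).1 + ∑ i, s.2 i • (z s.1).2 i)) (r₀, 0) :=
      (mapSmoothAt_chart_symm (hzU r₀)).isSmoothAt' (ha.isSmoothAt _) (by simp)
    refine (((h n q hq fun i => (0, Pi.single i 1)).comp
      (φ := fun r : EuclideanSpace ℝ (Fin n) => (r, (0 : Fin k → ℝ)))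
      (contDiff_id.prodMk contDiff_const)).isSmoothAt r₀).congr ?_
    have ht : Tendsto (fun r : EuclideanSpace ℝ (Fin n) => (r, (0 : Fin k → ℝ))) (𝓝 r₀)
        (𝓝 (r₀, 0)) := by
      have : Continuous fun r : EuclideanSpace ℝ (Fin n) => (r, (0 : Fin k → ℝ)) := by fun_prop
      exact this.tendsto _
    filter_upwards [ht.eventually e.eventually_nhds] with r hr
    replace hr : (fun s : EuclideanSpace ℝ (Fin n) × (Fin k → ℝ) =>
      (chart (E := E) x).symm ((z s.1).1 + ∑ i, s.2 i • (z s.1).2 i)) =ᶠ[𝓝 (r, 0)] q := hr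
    have hr0 : q (r, 0) = (chart (E := E) x).symm (z r).1 := by
      rw [← hr.eq_of_nhds]
      simp
    rw [localRep, pullback, hr0]
    congr 1
    funext i
    rw [← vel_congr hr, vel_eq_deriv, tmap]
    congr 1
    funext t
    have : ∑ j, ((0 : Fin k → ℝ) + t • Pi.single i (1 : ℝ) : Fin k → ℝ) j • (z r).2 j =
        t • (z r).2 i := by
      rw [Finset.sum_eq_single i (fun j _ hj => by simp [hj]) (by simp)]
      simp
    simp only [Prod.mk_add_mk, Prod.smul_mk, smul_zero, add_zero, this]
    simp
    rfl

/-- The exterior derivative in terms of a plot that is affine in the chart. -/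
theorem extd_eq_sum_dd {k : ℕ} (α : M → (Fin k → E) → V) (x : M) (v : Fin (k + 1) → E)
    {q : (Fin (k + 1) → ℝ) → M}
    (hq : ∀ᶠ t in 𝓝 0, (chart (E := E) x).symm (chart (E := E) x x + ∑ i, t i • v i) = q t ∧
        ∀ i, tmap E E (chart (E := E) x).symm (chart (E := E) x x + ∑ i, t i • v i) (v i) =
          vel E q t (Pi.single i 1)) :
    extd α x v = ∑ i : Fin (k + 1), (-1 : ℝ) ^ (i : ℕ) •
      dd (fun t => α (q t) (fun j => vel E q t (Pi.single (i.succAbove j) 1))) 0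
        (Pi.single i 1) := by
  rw [extd]
  refine Finset.sum_congr rfl fun i _ => ?_
  congr 1
  refine deriv_congr_of_eventuallyEq ?_
  filter_upwards [(line_tendsto (0 : Fin (k + 1) → ℝ) (Pi.single i 1)).eventually hq] with t ht
  have h1 : ∑ j, (0 + t • Pi.single i (1 : ℝ) : Fin (k + 1) → ℝ) j • v j = t • v i := by
    rw [Finset.sum_eq_single i (fun j _ hj => by simp [hj]) (by simp)]
    simp
  rw [h1] at ht
  rw [localRep, pullback, ht.1]
  congr 1
  funext j
  rw [← ht.2]

theorem update_fin_one (x v : E) : Function.update ![x] 0 v = ![v] := by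
  funext i
  fin_cases i
  rfl

/-- An alternating map of one argument as a linear map. -/
def oneFormLinear (a : E [⋀^Fin 1]→ₗ[ℝ] V) : E →ₗ[ℝ] V where
  toFun v := a ![v]
  map_add' v w := by
    have := a.map_update_add ![0] 0 v w
    rwa [update_fin_one, update_fin_one, update_fin_one] at this
  map_smul' c v := by
    have := a.map_update_smul ![0] 0 c v
    rwa [update_fin_one, update_fin_one] at this

theorem oneFormLinear_apply (a : E [⋀^Fin 1]→ₗ[ℝ] V) (v : E) : oneFormLinear a v = a ![v] := rfl

/-- The exterior derivative of a `1`-form along a plot. -/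
theorem DForm.extd_vel (θ : DForm E M V 1) {p : W → M} (hp : IsSmooth p) (r u w : W) :
    extd θ (p r) ![vel E p r u, vel E p r w] =
      dd (fun s => θ (p s) ![vel E p s w]) r u - dd (fun s => θ (p s) ![vel E p s u]) r w := by
  set x := p r with hx
  set c : W → E := fun s => chart (E := E) x (p s) with hcdef
  have hxs : p r ∈ (chart (E := E) x).source := hx ▸ mem_source _
  have hc : IsSmoothAt c r := (hp.isSmoothAt r).chart hxs
  have hcr : c r = chart (E := E) x x := rfl
  let β : E → E → V := fun e v => localRep θ x e ![v]
  -- The derivative splits into one part from the coefficients of the form and one from a second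
  -- derivative of the coordinate plot.
  have hA : ∀ u w : W, dd (fun s => θ (p s) ![vel E p s w]) r u =
      deriv (fun t : ℝ => β (c r + t • dd c r u) (dd c r w)) 0 +
        β (c r) (dd (fun s => dd c s w) r u) := by
    intro u w
    have h1 : dd (fun s => θ (p s) ![vel E p s w]) r u =
        deriv (fun t : ℝ => β (c (r + t • u)) (dd c (r + t • u) w)) 0 := by
      refine deriv_congr_of_eventuallyEq ?_
      filter_upwards [(line_tendsto r u).eventually ((hp.isSmoothAt r).eventually_mem
        (isOpen_source (E := E) x) hxs)] with t ht
      have := form_vel_eq_localRep (fun x v => θ x v) (hp.isSmoothAt _) ht (fun _ : Fin 1 => w)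
      simp only [β]
      convert this using 2
      · funext i
        simp
      · funext i
        simp [c]
    rw [h1]
    have hs1 : IsSmoothAt (fun z : ℝ × ℝ => c (r + z.1 • u)) 0 :=
      hc.comp' (φ := fun z : ℝ × ℝ => r + z.1 • u) (by fun_prop) (by simp)
    have hs2 : IsSmoothAt (fun z : ℝ × ℝ => dd c (r + z.2 • u) w) 0 :=
      IsSmoothAt.dd (φ := fun z : ℝ × ℝ => r + z.2 • u) (by simpa using hc) (by fun_prop)
        contDiff_const
    have hβ : IsSmoothAt (fun z : ℝ × ℝ => β (c (r + z.1 • u)) (dd c (r + z.2 • u) w)) 0 := by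
      refine isSmoothAt_of_dSmoothOn (θ.smooth x) (isOpen_fst_preimage (isOpen_target x))
        (hs1.prodMk (IsSmoothAt.pi (p := fun z : ℝ × ℝ => ![dd c (r + z.2 • u) w])
          fun i => ?_)) ?_
      · simpa using hs2
      · simpa [hcr] using chart_self_mem_target x
    have hd := deriv_diag hβ
    simp only at hd
    rw [hd]
    congr 1
    · simp only [zero_smul, add_zero]
      have hf : MapSmoothAt (fun e => β e (dd c r w)) (c r) := by
        intro n q s hq hqs
        refine isSmoothAt_of_dSmoothOn (θ.smooth x) (isOpen_fst_preimage (isOpen_target x))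
          (hq.prodMk ((isSmooth_const ![dd c r w]).isSmoothAt s)) ?_
        simpa [hqs, hcr] using chart_self_mem_target x
      exact deriv_comp_curve hf (c := fun t : ℝ => c (r + t • u))
        (hc.comp' (φ := fun t : ℝ => r + t • u) (by fun_prop) (by simp)) (by simp)
    · simp only [zero_smul, add_zero]
      have hsymm : MapSmoothAt (chart (E := E) x).symm (c r) :=
        mapSmoothAt_chart_symm (chart_self_mem_target x)
      let L : E →ₗ[ℝ] V :=
        (oneFormLinear (θ.toAlt ((chart (E := E) x).symm (c r)))).comp (tmapLinear hsymm)
      have hLβ : ∀ v, L v = β (c r) v := by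
        intro v
        simp only [L, β, localRep, pullback, LinearMap.comp_apply, oneFormLinear_apply]
        congr 1
        funext i
        fin_cases i
        rfl
      simp_rw [← hLβ]
      have hL : DSmooth L := by
        intro n q hq
        rw [show L ∘ q = fun s => β (c r) (q s) from funext fun s => hLβ _]
        refine θ.smooth x n (fun s => (c r, ![q s])) ⟨isPlot_const, fun i => ?_⟩
          fun _ => chart_self_mem_target x
        simpa using hq
      exact deriv_linear L hL (c := fun t : ℝ => dd c (r + t • u) w)
        (IsSmoothAt.dd (φ := fun t : ℝ => r + t • u) (by simpa using hc) (by fun_prop)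
        contDiff_const)
  -- The second derivatives are symmetric in `u` and `w` and cancel in the difference; the
  -- coefficient parts are the chart formula for the exterior derivative.
  rw [hA, hA, dd_comm_of_isSmoothAt hc, add_sub_add_right_eq_sub, extd, Fin.sum_univ_two]
  have e1 : (fun j : Fin 1 => (![vel E p r u, vel E p r w] : Fin 2 → E) (Fin.succAbove 0 j)) =
      ![vel E p r w] := by
    funext j
    fin_cases j
    rfl
  have e2 : (fun j : Fin 1 => (![vel E p r u, vel E p r w] : Fin 2 → E) (Fin.succAbove 1 j)) =
      ![vel E p r u] := by
    funext j
    fin_cases j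
    rfl
  rw [e1, e2]
  simp only [Fin.val_zero, pow_zero, one_smul, Fin.val_one, pow_one, neg_smul, sub_eq_add_neg]
  rfl

end FormsOnPlots

/-! ### The adjoint action and the Lie bracket -/

section LieGroup

variable {W : Type*} [NormedAddCommGroup W] [NormedSpace ℝ W] [FiniteDimensional ℝ W]
  {𝔤 : Type*} [AddCommGroup 𝔤] [Module ℝ 𝔤] [TopologicalSpace 𝔤] [DiffeologicalSpace 𝔤]
  [ConvenientSpace 𝔤] {G : Type*} [Group G] [DiffeologicalSpace G] [ConvManifold 𝔤 G]
  [ConvLieGroup G]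

open ConvManifold

theorem dd_add_of_isSmoothAt {p q : W → 𝔤} {r : W} (hp : IsSmoothAt p r) (hq : IsSmoothAt q r)
    (w : W) : dd (fun s => p s + q s) r w = dd p r w + dd q r w := by
  obtain ⟨p', hp', e⟩ := hp
  obtain ⟨q', hq', e'⟩ := hq
  rw [dd_congr e, dd_congr e', ← dd_add hp' hq']
  exact dd_congr (e.add e') w

theorem IsSmoothAt.mul {g h : W → G} {r : W} (hg : IsSmoothAt g r) (hh : IsSmoothAt h r) :
    IsSmoothAt (fun s => g s * h s) r :=
  (hg.prodMk hh).map ConvLieGroup.smooth_mul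

theorem IsSmoothAt.inv {g : W → G} {r : W} (hg : IsSmoothAt g r) :
    IsSmoothAt (fun s => (g s)⁻¹) r :=
  hg.map ConvLieGroup.smooth_inv

theorem mapSmoothAt_conj (g h : G) : MapSmoothAt (fun h : G => g * h * g⁻¹) h :=
  fun _ _ _ hp _ => (((isSmooth_const g).isSmoothAt _).mul hp).mul
    ((isSmooth_const g⁻¹).isSmoothAt _)

variable (𝔤) in
/-- `Ad g` as a linear map. -/
def AdLinear (g : G) : 𝔤 →ₗ[ℝ] 𝔤 := tmapLinear (E := 𝔤) (F := 𝔤) (mapSmoothAt_conj g 1)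

theorem AdLinear_apply (g : G) (X : 𝔤) : AdLinear 𝔤 g X = Ad g X := rfl

theorem Ad_vel (g : G) {h : W → G} {r : W} (hh : IsSmoothAt h r) (h1 : h r = 1) (w : W) :
    Ad g (vel 𝔤 h r w) = vel 𝔤 (fun s => g * h s * g⁻¹) r w :=
  tmap_vel' (mapSmoothAt_conj g 1) hh h1 w

theorem Ad_one (X : 𝔤) : Ad (1 : G) X = X := by
  obtain ⟨c, hc, hc0, hv, -⟩ := exists_curve (1 : G) X
  rw [← hv, Ad_vel _ (hc.isSmoothAt 0) hc0]
  simp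

theorem Ad_mul (g h : G) (X : 𝔤) : Ad (g * h) X = Ad g (Ad h X) := by
  obtain ⟨c, hc, hc0, hv, -⟩ := exists_curve (1 : G) X
  rw [← hv, Ad_vel _ (hc.isSmoothAt 0) hc0, Ad_vel _ (hc.isSmoothAt 0) hc0,
    Ad_vel _ ((mapSmoothAt_conj h 1).isSmoothAt' (hc.isSmoothAt 0) hc0) (by simp [hc0])]
  congr 1
  funext s
  group

theorem Ad_Ad_inv (g : G) (X : 𝔤) : Ad g (Ad g⁻¹ X) = X := by
  rw [← Ad_mul, mul_inv_cancel, Ad_one]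

/-- `Ad` and the bracket are derivatives at time 0 along such lines. Joint smoothness in the
parameter and the time makes these derivatives smooth in the parameter. -/
theorem isSmoothAt_chart_symm_line {x : G} {Y : W → 𝔤} {r : W} (hY : IsSmoothAt Y r) :
    IsSmoothAt (fun z : W × ℝ => (chart (E := 𝔤) x).symm (chart (E := 𝔤) x x + z.2 • Y z.1))
      (r, 0) := by
  refine (mapSmoothAt_chart_symm (chart_self_mem_target x)).isSmoothAt'
    (IsSmoothAt.add ((isSmooth_const _).isSmoothAt _)
      (IsSmoothAt.smul (a := fun z : W × ℝ => z.2) contDiff_snd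
        (hY.comp' contDiff_fst rfl))) (by simp)

theorem dSmooth_Ad : DSmooth (fun z : G × 𝔤 => Ad z.1 z.2) := by
  intro n z hz
  refine isSmooth_iff_isPlot.1 (isSmooth_of_isSmoothAt fun r => ?_)
  have hz1 : IsSmooth (fun s => (z s).1) := (isSmooth_iff_isPlot.2 hz).fst
  have hz2 : IsSmooth (fun s => (z s).2) := (isSmooth_iff_isPlot.2 hz).snd
  have hg : IsSmoothAt (fun s : EuclideanSpace ℝ (Fin n) × ℝ => (z s.1).1) (r, 0) :=
    (hz1.comp contDiff_fst).isSmoothAt _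
  have hH := (hg.mul (isSmoothAt_chart_symm_line (x := (1 : G)) (hz2.isSmoothAt r))).mul hg.inv
  have h1 := hH.chart (E := 𝔤) (x := (1 : G)) (by
    simpa [chart_symm_chart_self] using mem_source (E := 𝔤) (1 : G))
  refine (IsSmoothAt.dd (φ := fun s : EuclideanSpace ℝ (Fin n) => (s, (0 : ℝ)))
    (v := fun _ => (0, 1)) h1 (by fun_prop) contDiff_const).congr (Eventually.of_forall fun s => ?_)
  simp [dd, Ad, tmap]

theorem IsSmoothAt.Ad {g : W → G} {Y : W → 𝔤} {r : W} (hg : IsSmoothAt g r)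
    (hY : IsSmoothAt Y r) : IsSmoothAt (fun s => Ad (g s) (Y s)) r :=
  (hg.prodMk hY).map dSmooth_Ad

theorem dSmooth_AdLinear (g : G) : DSmooth (AdLinear 𝔤 g) :=
  fun n p hp => dSmooth_Ad n (fun s => (g, p s)) ⟨isPlot_const, hp⟩

theorem mapSmoothAt_Ad_left (g : G) (Y : 𝔤) : MapSmoothAt (fun g : G => Ad g Y) g :=
  fun _ _ _ hp _ => hp.Ad ((isSmooth_const Y).isSmoothAt _)

theorem dd_Ad_left {g : W → G} {r : W} (hg : IsSmoothAt g r) (h1 : g r = 1) (Y : 𝔤) (w : W) :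
    dd (fun s => Ad (g s) Y) r w = lieBracket G (vel 𝔤 g r w) Y := by
  rw [lieBracket, tmap_vel' (mapSmoothAt_Ad_left 1 Y) hg h1]
  rfl

variable (G) in
theorem dSmooth_lieBracket : DSmooth (fun z : 𝔤 × 𝔤 => lieBracket G z.1 z.2) := by
  intro n z hz
  refine isSmooth_iff_isPlot.1 (isSmooth_of_isSmoothAt fun r => ?_)
  have hz1 : IsSmooth (fun s => (z s).1) := (isSmooth_iff_isPlot.2 hz).fst
  have hz2 : IsSmooth (fun s => (z s).2) := (isSmooth_iff_isPlot.2 hz).snd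
  have hH := (isSmoothAt_chart_symm_line (x := (1 : G)) (hz1.isSmoothAt r)).Ad
    (Y := fun s : EuclideanSpace ℝ (Fin n) × ℝ => (z s.1).2)
    ((hz2.comp contDiff_fst).isSmoothAt _)
  refine (IsSmoothAt.dd (φ := fun s : EuclideanSpace ℝ (Fin n) => (s, (0 : ℝ)))
    (v := fun _ => (0, 1)) hH (by fun_prop) contDiff_const).congr (Eventually.of_forall fun s => ?_)
  simp [dd, lieBracket, tmap]
  rfl

variable (𝔤 G) in
/-- The Lie bracket as a bilinear map. -/
def bracket : 𝔤 →ₗ[ℝ] 𝔤 →ₗ[ℝ] 𝔤 :=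
  LinearMap.mk₂ ℝ (lieBracket G)
    (fun X Y Z => tmap_add (mapSmoothAt_Ad_left 1 Z) X Y)
    (fun a X Z => tmap_smul (mapSmoothAt_Ad_left 1 Z) a X)
    -- Linearity in the second slot is inherited from the linearity of each `Ad (c s)` by
    -- differentiating along a curve with velocity `X`.
    (fun X Y Z => by
      obtain ⟨c, hc, hc0, hv, -⟩ := exists_curve (1 : G) X
      subst hv
      simp_rw [← dd_Ad_left (hc.isSmoothAt 0) hc0]
      rw [← dd_add_of_isSmoothAt ((hc.isSmoothAt 0).Ad ((isSmooth_const Y).isSmoothAt 0))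
        ((hc.isSmoothAt 0).Ad ((isSmooth_const Z).isSmoothAt 0))]
      congr 1
      funext s
      exact (AdLinear 𝔤 (c s)).map_add Y Z)
    (fun a X Y => by
      obtain ⟨c, hc, hc0, hv, -⟩ := exists_curve (1 : G) X
      subst hv
      simp_rw [← dd_Ad_left (hc.isSmoothAt 0) hc0]
      have hs : DSmooth (a • LinearMap.id : 𝔤 →ₗ[ℝ] 𝔤) := fun n p hp =>
        isSmooth_iff_isPlot.1 (IsSmooth.smul contDiff_const (isSmooth_iff_isPlot.2 hp))
      refine Eq.trans ?_ (dd_linear (a • LinearMap.id : 𝔤 →ₗ[ℝ] 𝔤) hs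
        ((hc.isSmoothAt 0).Ad ((isSmooth_const Y).isSmoothAt 0)) 1)
      congr 1
      funext s
      exact (AdLinear 𝔤 (c s)).map_smul a Y)

theorem bracket_apply (X Y : 𝔤) : bracket 𝔤 G X Y = lieBracket G X Y := rfl

variable (𝔤 G) in
theorem dSmooth_bracket : DSmooth (fun z : 𝔤 × 𝔤 => bracket 𝔤 G z.1 z.2) :=
  dSmooth_lieBracket G

/-- Differentiate `Ad_g Ad_{c(s)} Y = Ad_{g c(s) g⁻¹} Ad_g Y` at `s = 0`. -/
theorem Ad_lieBracket (g : G) (X Y : 𝔤) :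
    Ad g (lieBracket G X Y) = lieBracket G (Ad g X) (Ad g Y) := by
  obtain ⟨c, hc, hc0, hv, -⟩ := exists_curve (1 : G) X
  rw [← hv, ← dd_Ad_left (hc.isSmoothAt 0) hc0, ← AdLinear_apply,
    ← dd_linear _ (dSmooth_AdLinear g)
      ((hc.isSmoothAt 0).Ad ((isSmooth_const Y).isSmoothAt 0)),
    Ad_vel _ (hc.isSmoothAt 0) hc0,
    ← dd_Ad_left ((mapSmoothAt_conj g 1).isSmoothAt' (hc.isSmoothAt 0) hc0) (by simp [hc0])]
  congr 1
  funext s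
  rw [AdLinear_apply, ← Ad_mul, ← Ad_mul]
  congr 1
  group

/-- The Jacobi identity: `ad` acts by derivations. -/
theorem lieBracket_jacobi (Z X Y : 𝔤) :
    lieBracket G Z (lieBracket G X Y) =
      lieBracket G (lieBracket G Z X) Y + lieBracket G X (lieBracket G Z Y) := by
  obtain ⟨c, hc, hc0, hv, -⟩ := exists_curve (1 : G) Z
  subst hv
  have hX := (hc.isSmoothAt 0).Ad ((isSmooth_const X).isSmoothAt 0)
  have hY := (hc.isSmoothAt 0).Ad ((isSmooth_const Y).isSmoothAt 0)
  -- Differentiate `Ad_c [X, Y] = [Ad_c X, Ad_c Y]` at the identity. This derivation form does not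
  -- require skew-symmetry.
  simp_rw [← dd_Ad_left (hc.isSmoothAt 0) hc0, Ad_lieBracket]
  have := dd_bilinear (bracket 𝔤 G) (dSmooth_bracket 𝔤 G) hX hY 1
  simpa [hc0, Ad_one, bracket_apply] using this

/-- Differentiate the constant `Ad_g Ad_{g⁻¹} Y = Y`, with separate times for the two factors. -/
theorem dd_Ad_inv_left {g : W → G} {r : W} (hg : IsSmoothAt g r) (h1 : g r = 1) (Y : 𝔤) (w : W) :
    dd (fun s => Ad (g s)⁻¹ Y) r w = - lieBracket G (vel 𝔤 g r w) Y := by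
  have hc : IsSmoothAt (fun t : ℝ => g (r + t • w)) 0 := hg.comp' (by fun_prop) (by simp)
  have hh : IsSmoothAt (fun z : ℝ × ℝ => Ad (g (r + z.1 • w)) (Ad (g (r + z.2 • w))⁻¹ Y)) 0 :=
    (hc.comp' contDiff_fst rfl).Ad ((hc.comp' contDiff_snd rfl).inv.Ad
      ((isSmooth_const Y).isSmoothAt _))
  have := deriv_diag hh
  simp only [Ad_Ad_inv, deriv_const', zero_smul, add_zero, h1, inv_one, Ad_one] at this
  rw [← dd_Ad_left hg h1, dd, dd]
  exact eq_neg_of_add_eq_zero_right this.symm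

/-- Infinitesimal invariance of an `Ad`-invariant smooth multilinear map. -/
theorem sum_update_lieBracket_eq_zero {F : Type*} [AddCommGroup F] [Module ℝ F]
    [TopologicalSpace F] [DiffeologicalSpace F] [ConvenientSpace F] {k : ℕ}
    (φ : MultilinearMap ℝ (fun _ : Fin k => 𝔤) F) (hφ : DSmooth (fun a : Fin k → 𝔤 => φ a))
    (hinv : ∀ (g : G) a, φ (fun i => Ad g (a i)) = φ a) (X : 𝔤) (a : Fin k → 𝔤) :
    ∑ i, φ (Function.update a i (lieBracket G X (a i))) = 0 := by
  obtain ⟨c, hc, hc0, hv, -⟩ := exists_curve (1 : G) X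
  subst hv
  have := dd_multilinear φ hφ (c := fun s i => Ad (c s) (a i)) (r := 0)
    (fun i => (hc.isSmoothAt 0).Ad ((isSmooth_const (a i)).isSmoothAt 0)) 1
  simp only [hinv, dd_const, dd_Ad_left (hc.isSmoothAt 0) hc0, hc0, Ad_one] at this
  exact this.symm

end LieGroup

/-! ### Chern forms on finite-dimensional spaces -/

/-! ### Signed sums over permutations -/

section Combinatorics

open Equiv

/-- A permutation of `n + 1` letters is determined by the image `i` of 0 and a permutation of the
rest; moving `i` to the front costs the sign `(-1)^i`. The sum over omitted indices in an exterior
derivative thus merges with the skew-symmetrization. -/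
theorem sum_perm_succ_eq {n : ℕ} {V : Type*} [AddCommGroup V] [Module ℝ V]
    (T : Perm (Fin (n + 1)) → V) :
    ∑ i : Fin (n + 1), (-1 : ℝ) ^ (i : ℕ) • ∑ σ : Perm (Fin n),
      ((Perm.sign σ : ℤ) : ℝ) • T (i.cycleRange.symm * Perm.decomposeFin.symm (0, σ)) =
    ∑ ρ : Perm (Fin (n + 1)), ((Perm.sign ρ : ℤ) : ℝ) • T ρ := by
  simp_rw [Finset.smul_sum]
  rw [← Fintype.sum_prod_type']
  refine Fintype.sum_bijective
    (fun z : Fin (n + 1) × Perm (Fin n) => z.1.cycleRange.symm * Perm.decomposeFin.symm (0, z.2))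
    ?_ _ _ fun z => ?_
  · rw [Fintype.bijective_iff_injective_and_card]
    refine ⟨fun z z' h => ?_, ?_⟩
    · have h0 : z.1 = z'.1 := by
        simpa [Perm.mul_apply] using congrArg (fun ρ : Perm (Fin (n + 1)) => ρ 0) h
      simp only [h0, mul_right_inj, EmbeddingLike.apply_eq_iff_eq, Prod.mk.injEq, true_and] at h
      exact Prod.ext h0 h
    · simp [Fintype.card_perm, Nat.factorial_succ]
  · rw [smul_smul]
    congr 1
    simp [Perm.sign_mul, Perm.sign_symm, Fin.sign_cycleRange, Perm.decomposeFin.symm_sign]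

theorem succAbove_eq_cycleRange_mul {n : ℕ} (i : Fin (n + 1)) (σ : Perm (Fin n)) (j : Fin n) :
    (i.cycleRange.symm * Perm.decomposeFin.symm (0, σ)) j.succ = i.succAbove (σ j) := by
  simp [Perm.mul_apply]

theorem cycleRange_mul_zero {n : ℕ} (i : Fin (n + 1)) (σ : Perm (Fin n)) :
    (i.cycleRange.symm * Perm.decomposeFin.symm (0, σ)) 0 = i := by
  simp [Perm.mul_apply]

/-- A signed sum over permutations vanishes if its cyclic symmetrization in three of the
arguments does. -/
theorem sum_perm_eq_zero_of_cyclic {n : ℕ} {V : Type*} [AddCommGroup V] [Module ℝ V]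
    (T : Perm (Fin n) → V) (a b c : Fin n) (hab : a ≠ b) (hbc : b ≠ c)
    (h : ∀ ρ, T ρ + T (ρ * (swap a b * swap b c)) +
      T (ρ * (swap a b * swap b c) * (swap a b * swap b c)) = 0) :
    ∑ ρ : Perm (Fin n), ((Perm.sign ρ : ℤ) : ℝ) • T ρ = 0 := by
  set S := ∑ ρ : Perm (Fin n), ((Perm.sign ρ : ℤ) : ℝ) • T ρ with hS
  have hs : Perm.sign (swap a b * swap b c) = 1 := by
    simp [Perm.sign_mul, Perm.sign_swap hab, Perm.sign_swap hbc]
  have h1 : ∀ T' : Perm (Fin n) → V, ∑ ρ : Perm (Fin n), ((Perm.sign ρ : ℤ) : ℝ) • T' ρ =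
      ∑ ρ : Perm (Fin n), ((Perm.sign ρ : ℤ) : ℝ) • T' (ρ * (swap a b * swap b c)) := by
    intro T'
    refine (Fintype.sum_equiv (Equiv.mulRight (swap a b * swap b c)) _ _ fun ρ => ?_).symm
    rw [Equiv.coe_mulRight, Perm.sign_mul, hs, mul_one]
  -- The 3-cycle is even, so reindexing by it or by its square leaves the signed sum unchanged.
  -- Adding the three copies produces the cyclic sums.
  have h3 : (3 : ℝ) • S = 0 := by
    have e2 := h1 T
    have e3 := h1 fun ρ => T (ρ * (swap a b * swap b c))
    calc (3 : ℝ) • S = S + S + S := by module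
      _ = ∑ ρ : Perm (Fin n), ((Perm.sign ρ : ℤ) : ℝ) • (T ρ + T (ρ * (swap a b * swap b c)) +
          T (ρ * (swap a b * swap b c) * (swap a b * swap b c))) := by
        simp_rw [smul_add, Finset.sum_add_distrib]
        rw [← e3, ← e2]
      _ = 0 := by simp [h]
  simpa using h3

end Combinatorics

/-! ### The Bianchi identity and closedness on a vector space -/

section LocalCurvature

variable {W : Type*} [NormedAddCommGroup W] [NormedSpace ℝ W] [FiniteDimensional ℝ W]
  {𝔤 : Type*} [AddCommGroup 𝔤] [Module ℝ 𝔤] [TopologicalSpace 𝔤] [DiffeologicalSpace 𝔤]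
  [ConvenientSpace 𝔤] {G : Type*} [Group G] [DiffeologicalSpace G] [ConvManifold 𝔤 G]
  [ConvLieGroup G]

variable (G) in
/-- The curvature of the `𝔤`-valued `1`-form `A` on `W`. -/
def localCurvature (A : W → W → 𝔤) (s u v : W) : 𝔤 :=
  dd (fun s => A s v) s u - dd (fun s => A s u) s v + lieBracket G (A s u) (A s v)

theorem IsSmooth.lieBracket {X Y : W → 𝔤} (hX : IsSmooth X) (hY : IsSmooth Y) :
    IsSmooth (fun s => lieBracket G (X s) (Y s)) :=
  (hX.prodMk hY).map (dSmooth_lieBracket G)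

theorem dd_lieBracket {X Y : W → 𝔤} (hX : IsSmooth X) (hY : IsSmooth Y) (s w : W) :
    dd (fun s => lieBracket G (X s) (Y s)) s w =
      lieBracket G (dd X s w) (Y s) + lieBracket G (X s) (dd Y s w) :=
  dd_bilinear (bracket 𝔤 G) (dSmooth_bracket 𝔤 G) (hX.isSmoothAt s) (hY.isSmoothAt s) w

theorem isSmooth_localCurvature {A : W → W → 𝔤} (hA : ∀ w, IsSmooth fun s => A s w) (u v : W) :
    IsSmooth (fun s => localCurvature G A s u v) :=
  (((hA v).dd (φ := fun s => s) contDiff_id contDiff_const).sub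
    ((hA u).dd (φ := fun s => s) contDiff_id contDiff_const)).add ((hA u).lieBracket (hA v))

variable (G) in
/-- The covariant derivative of the curvature. -/
def localCovDeriv (A : W → W → 𝔤) (s u v w : W) : 𝔤 :=
  dd (fun s => localCurvature G A s v w) s u + lieBracket G (A s u) (localCurvature G A s v w)

theorem lieBracket_add_right (X Y Z : 𝔤) :
    lieBracket G X (Y + Z) = lieBracket G X Y + lieBracket G X Z := (bracket 𝔤 G X).map_add Y Z

theorem lieBracket_sub_right (X Y Z : 𝔤) :
    lieBracket G X (Y - Z) = lieBracket G X Y - lieBracket G X Z := (bracket 𝔤 G X).map_sub Y Z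

theorem lieBracket_neg_right (X Y : 𝔤) :
    lieBracket G X (-Y) = - lieBracket G X Y := (bracket 𝔤 G X).map_neg Y

/-- The Bianchi identity. -/
theorem bianchi (hanti : ∀ X Y : 𝔤, lieBracket G X Y = - lieBracket G Y X) {A : W → W → 𝔤}
    (hA : ∀ w, IsSmooth fun s => A s w) (s u v w : W) :
    localCovDeriv G A s u v w + localCovDeriv G A s v w u + localCovDeriv G A s w u v = 0 := by
  have hdA : ∀ a b : W, IsSmooth fun s => dd (fun s => A s a) s b := fun a b =>
    (hA a).dd (φ := fun s => s) contDiff_id contDiff_const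
  have key : ∀ u v w : W, localCovDeriv G A s u v w =
      dd (fun s => dd (fun s => A s w) s v) s u - dd (fun s => dd (fun s => A s v) s w) s u +
      (lieBracket G (dd (fun s => A s v) s u) (A s w) +
        lieBracket G (A s v) (dd (fun s => A s w) s u)) +
      (lieBracket G (A s u) (dd (fun s => A s w) s v) -
        lieBracket G (A s u) (dd (fun s => A s v) s w) +
        lieBracket G (A s u) (lieBracket G (A s v) (A s w))) := by
    intro u v w
    simp only [localCovDeriv, localCurvature]
    rw [dd_add ((hdA w v).sub (hdA v w)) ((hA v).lieBracket (hA w)), dd_sub (hdA w v) (hdA v w),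
      dd_lieBracket (hA v) (hA w), lieBracket_add_right, lieBracket_sub_right]
  -- Second derivatives cancel by symmetry, brackets with first derivatives by skew-symmetry, and
  -- triple brackets by the Jacobi identity.
  rw [key, key, key, dd_comm (hA w) s v u, dd_comm (hA v) s w u, dd_comm (hA u) s w v]
  have hj := lieBracket_jacobi (G := G) (A s u) (A s v) (A s w)
  rw [hanti (lieBracket G (A s u) (A s v)) (A s w),
    hanti (A s u) (A s w), lieBracket_neg_right] at hj
  rw [hj, hanti (dd (fun s => A s v) s u) (A s w), hanti (dd (fun s => A s w) s v) (A s u),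
    hanti (dd (fun s => A s u) s w) (A s v)]
  abel

variable {E : Type*} {n k : ℕ}

/-- The skew-symmetric part of `φ(K, …, K)` for a `2`-form `K`. -/
def altSum (hn : n = 2 * k) (φ : (Fin k → 𝔤) → ℂ) (K : E → E → 𝔤) (v : Fin n → E) : ℂ :=
  ((Nat.factorial n : ℕ) : ℂ)⁻¹ * ∑ σ : Equiv.Perm (Fin n), ((Equiv.Perm.sign σ : ℤ) : ℂ) *
    φ (fun i : Fin k => K (v (σ ⟨2 * (i : ℕ), by omega⟩)) (v (σ ⟨2 * (i : ℕ) + 1, by omega⟩)))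

theorem dd_const_mul (c : ℂ) {f : W → ℂ} {r : W} (hf : IsSmoothAt f r) (w : W) :
    dd (fun s => c * f s) r w = c * dd f r w := by
  refine dd_linear (LinearMap.mulLeft ℝ c) (fun n p hp => ?_) hf w
  exact isPlot_iff_contDiff.2 (contDiff_const.mul (isPlot_iff_contDiff.1 hp))

theorem dd_finset_sum {ι : Type*} (S : Finset ι) {f : ι → W → 𝔤}
    (hf : ∀ i ∈ S, IsSmooth (f i)) (r w : W) :
    dd (fun s => ∑ i ∈ S, f i s) r w = ∑ i ∈ S, dd (f i) r w := by
  classical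
  induction S using Finset.induction_on with
  | empty => simp [dd_const]
  | insert a S ha ih =>
    simp_rw [Finset.sum_insert ha]
    rw [dd_add (hf a (by simp)) (IsSmooth.sum S fun i hi => hf i (by simp [hi])),
      ih fun i hi => hf i (by simp [hi])]

theorem IsSmooth.const_mul (c : ℂ) {f : W → ℂ} (hf : IsSmooth f) :
    IsSmooth (fun s => c * f s) :=
  isSmooth_iff_contDiff.2 (contDiff_const.mul (isSmooth_iff_contDiff.1 hf))

theorem isSmooth_altSum (hn : n = 2 * k) (φ : MultilinearMap ℝ (fun _ : Fin k => 𝔤) ℂ)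
    (hφ : DSmooth (fun a : Fin k → 𝔤 => φ a)) {K : W → E → E → 𝔤}
    (hK : ∀ u v, IsSmooth fun s => K s u v) (v : Fin n → E) :
    IsSmooth (fun s => altSum hn φ (K s) v) :=
  IsSmooth.const_mul _ (IsSmooth.sum _ fun _ _ =>
    IsSmooth.const_mul _ (IsSmooth.map (IsSmooth.pi fun _ => hK _ _) hφ))

/-- Closedness of the Chern forms of an invariant polynomial. -/
theorem sum_dd_altSum_eq_zero (hanti : ∀ X Y : 𝔤, lieBracket G X Y = - lieBracket G Y X)
    (hn : n = 2 * k) (φ : MultilinearMap ℝ (fun _ : Fin k => 𝔤) ℂ)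
    (hφ : DSmooth (fun a : Fin k → 𝔤 => φ a))
    (hinv : ∀ (g : G) a, φ (fun i => Ad g (a i)) = φ a)
    {A : W → W → 𝔤} (hA : ∀ w, IsSmooth fun s => A s w) (r : W) (w : Fin (n + 1) → W) :
    ∑ i : Fin (n + 1), (-1 : ℝ) ^ (i : ℕ) •
      dd (fun s => altSum hn φ (localCurvature G A s) (fun j => w (i.succAbove j))) r (w i) = 0 := by
  let x : Fin k → Fin n := fun i => ⟨2 * (i : ℕ), by omega⟩
  let y : Fin k → Fin n := fun i => ⟨2 * (i : ℕ) + 1, by omega⟩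
  let B : Equiv.Perm (Fin (n + 1)) → Fin k → 𝔤 := fun ρ i =>
    localCurvature G A r (w (ρ (x i).succ)) (w (ρ (y i).succ))
  -- Slot 0 carries the direction of differentiation; the arguments of the `k` curvatures occupy the
  -- slots shifted by `succ`. The index `j` marks the differentiated factor of the Leibniz rule.
  let T : Equiv.Perm (Fin (n + 1)) → ℂ := fun ρ => ∑ j, φ (Function.update (B ρ) j
    (dd (fun s => localCurvature G A s (w (ρ (x j).succ)) (w (ρ (y j).succ))) r (w (ρ 0))))
  have h1 : ∀ i : Fin (n + 1),
      dd (fun s => altSum hn φ (localCurvature G A s) (fun j => w (i.succAbove j))) r (w i) =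
      ((Nat.factorial n : ℕ) : ℂ)⁻¹ * ∑ σ : Equiv.Perm (Fin n),
        ((Equiv.Perm.sign σ : ℤ) : ℝ) •
          T (i.cycleRange.symm * Equiv.Perm.decomposeFin.symm (0, σ)) := by
    intro i
    have hsm : ∀ σ : Equiv.Perm (Fin n), IsSmooth fun s => φ (fun l : Fin k =>
        localCurvature G A s (w (i.succAbove (σ (x l)))) (w (i.succAbove (σ (y l))))) := fun σ =>
      IsSmooth.map (IsSmooth.pi fun _ => isSmooth_localCurvature hA _ _) hφ
    simp only [altSum]
    rw [dd_const_mul _ ((IsSmooth.sum _ fun σ _ => (hsm σ).const_mul _).isSmoothAt r),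
      dd_finset_sum _ fun σ _ => (hsm σ).const_mul _]
    congr 1
    refine Finset.sum_congr rfl fun σ _ => ?_
    rw [dd_const_mul _ ((hsm σ).isSmoothAt r), dd_multilinear φ hφ fun l =>
      (isSmooth_localCurvature hA _ _).isSmoothAt r, Complex.real_smul]
    simp only [T, B, succAbove_eq_cycleRange_mul, cycleRange_mul_zero]
    congr 1
  have h2 : ∑ ρ : Equiv.Perm (Fin (n + 1)), ((Equiv.Perm.sign ρ : ℤ) : ℝ) • T ρ = 0 := by
    -- The added bracket terms sum to zero over `j` by infinitesimal invariance, so each derivative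
    -- may be replaced by the covariant derivative.
    have hT : ∀ ρ, T ρ = ∑ j, φ (Function.update (B ρ) j (localCovDeriv G A r (w (ρ 0))
        (w (ρ (x j).succ)) (w (ρ (y j).succ)))) := by
      intro ρ
      simp only [localCovDeriv, MultilinearMap.map_update_add, Finset.sum_add_distrib]
      rw [sum_update_lieBracket_eq_zero φ hφ hinv (A r (w (ρ 0))) (B ρ), add_zero]
    simp_rw [hT, Finset.smul_sum]
    rw [Finset.sum_comm]
    refine Finset.sum_eq_zero fun j _ => ?_
    have hxy : (x j).succ ≠ (y j).succ := by simp [x, y]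
    refine sum_perm_eq_zero_of_cyclic _ 0 (x j).succ (y j).succ (Fin.succ_ne_zero _).symm hxy
      fun ρ => ?_
    -- This 3-cycle permutes only the direction of differentiation and the two arguments of the
    -- `j`-th curvature. The other factors do not move, and the cyclic sum is the Bianchi identity
    -- inside slot `j` of `φ`.
    set τ := Equiv.swap 0 (x j).succ * Equiv.swap (x j).succ (y j).succ with hτ
    have t0 : τ 0 = (x j).succ := by
      rw [hτ, Equiv.Perm.mul_apply, Equiv.swap_apply_of_ne_of_ne (Fin.succ_ne_zero _).symm
        (Fin.succ_ne_zero _).symm, Equiv.swap_apply_left]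
    have tx : τ (x j).succ = (y j).succ := by
      rw [hτ, Equiv.Perm.mul_apply, Equiv.swap_apply_left,
        Equiv.swap_apply_of_ne_of_ne (Fin.succ_ne_zero _) hxy.symm]
    have ty : τ (y j).succ = 0 := by
      rw [hτ, Equiv.Perm.mul_apply, Equiv.swap_apply_right, Equiv.swap_apply_right]
    have tz : ∀ z : Fin n, z ≠ x j → z ≠ y j → τ z.succ = z.succ := by
      intro z hz hz'
      rw [hτ, Equiv.Perm.mul_apply,
        Equiv.swap_apply_of_ne_of_ne (a := (x j).succ) (by simpa using hz) (by simpa using hz'),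
        Equiv.swap_apply_of_ne_of_ne (Fin.succ_ne_zero _) (by simpa using hz)]
    have hB : ∀ ρ X, Function.update (B (ρ * τ)) j X = Function.update (B ρ) j X := by
      intro ρ X
      funext i
      by_cases hij : i = j
      · subst hij
        simp
      · have hij' : (i : ℕ) ≠ j := fun h => hij (Fin.ext h)
        simp only [Function.update_of_ne hij, B, Equiv.Perm.mul_apply]
        rw [tz (x i) (by simp only [x, ne_eq, Fin.mk.injEq]; omega)
          (by simp only [x, y, ne_eq, Fin.mk.injEq]; omega),
          tz (y i) (by simp only [x, y, ne_eq, Fin.mk.injEq]; omega)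
          (by simp only [y, ne_eq, Fin.mk.injEq]; omega)]
    simp only [hB, Equiv.Perm.mul_apply, t0, tx, ty]
    rw [← MultilinearMap.map_update_add, ← MultilinearMap.map_update_add, bianchi hanti hA,
      MultilinearMap.map_update_zero]
  simp_rw [h1, ← mul_smul_comm]
  rw [← Finset.mul_sum, sum_perm_succ_eq, h2, mul_zero]

end LocalCurvature

/-! ### Principal bundles and connections -/

/-! ### One-forms along plots and bilinearity of their differentials -/

section OneForms

variable {W : Type*} [NormedAddCommGroup W] [NormedSpace ℝ W] [FiniteDimensional ℝ W]
  {E V : Type*}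
  [AddCommGroup E] [Module ℝ E] [TopologicalSpace E] [DiffeologicalSpace E] [ConvenientSpace E]
  [AddCommGroup V] [Module ℝ V] [TopologicalSpace V] [DiffeologicalSpace V] [ConvenientSpace V]
  {M : Type*} [DiffeologicalSpace M] [ConvManifold E M]

/-- The components of a `1`-form along a plot. -/
def DForm.along (θ : DForm E M V 1) (p : W → M) (s w : W) : V := θ (p s) ![vel E p s w]

theorem DForm.isSmooth_along (θ : DForm E M V 1) {p : W → M} (hp : IsSmooth p) (w : W) :
    IsSmooth (fun s => θ.along p s w) := by
  convert θ.isSmooth_vel hp (fun _ => w) using 3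
  simp only [DForm.along]
  congr 1
  funext i
  fin_cases i
  rfl

theorem DForm.along_add (θ : DForm E M V 1) {p : W → M} (hp : IsSmooth p) (s v w : W) :
    θ.along p s (v + w) = θ.along p s v + θ.along p s w := by
  rw [DForm.along, vel_add (hp.isSmoothAt s)]
  exact (oneFormLinear (θ.toAlt (p s))).map_add _ _

theorem DForm.along_smul (θ : DForm E M V 1) {p : W → M} (hp : IsSmooth p) (s : W) (a : ℝ)
    (w : W) : θ.along p s (a • w) = a • θ.along p s w := by
  rw [DForm.along, vel_smul (hp.isSmoothAt s)]
  exact (oneFormLinear (θ.toAlt (p s))).map_smul _ _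

theorem DForm.extd_along (θ : DForm E M V 1) {p : W → M} (hp : IsSmooth p) (r u w : W) :
    extd θ (p r) ![vel E p r u, vel E p r w] =
      dd (fun s => θ.along p s w) r u - dd (fun s => θ.along p s u) r w :=
  θ.extd_vel hp r u w

theorem extd_swap (θ : DForm E M V 1) (x : M) (u v : E) :
    extd θ x ![u, v] = - extd θ x ![v, u] := by
  obtain ⟨q, hq, hq0, -, hv⟩ := exists_affine_plot x ![u, v]
  have h0 := hv 0
  have h1 := hv 1
  simp only [Matrix.cons_val_zero, Matrix.cons_val_one] at h0 h1
  subst hq0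
  rw [← h0, ← h1, θ.extd_along hq, θ.extd_along hq, neg_sub]

theorem extd_add_left (θ : DForm E M V 1) (x : M) (u u' v : E) :
    extd θ x ![u + u', v] = extd θ x ![u, v] + extd θ x ![u', v] := by
  obtain ⟨q, hq, hq0, -, hv⟩ := exists_affine_plot x ![u, u', v]
  have h0 := hv 0
  have h1 := hv 1
  have h2 := hv 2
  simp only [Matrix.cons_val] at h0 h1 h2
  subst hq0
  rw [← h0, ← h1, ← h2, ← vel_add (hq.isSmoothAt 0), θ.extd_along hq, θ.extd_along hq,
    θ.extd_along hq, dd_add_right ((θ.isSmooth_along hq _).isSmoothAt 0)]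
  simp_rw [θ.along_add hq]
  rw [dd_add (θ.isSmooth_along hq _) (θ.isSmooth_along hq _)]
  abel

theorem extd_smul_left (θ : DForm E M V 1) (x : M) (a : ℝ) (u v : E) :
    extd θ x ![a • u, v] = a • extd θ x ![u, v] := by
  obtain ⟨q, hq, hq0, -, hv⟩ := exists_affine_plot x ![u, v]
  have h0 := hv 0
  have h1 := hv 1
  simp only [Matrix.cons_val_zero, Matrix.cons_val_one] at h0 h1
  subst hq0
  rw [← h0, ← h1, ← vel_smul (hq.isSmoothAt 0), θ.extd_along hq, θ.extd_along hq,
    dd_smul_right ((θ.isSmooth_along hq _).isSmoothAt 0)]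
  simp_rw [θ.along_smul hq]
  rw [dd_smul contDiff_const (θ.isSmooth_along hq _)]
  simp [smul_sub]

/-- The exterior derivative of a `1`-form as a bilinear map. -/
def extdBilinear (θ : DForm E M V 1) (x : M) : E →ₗ[ℝ] E →ₗ[ℝ] V :=
  LinearMap.mk₂ ℝ (fun u v => extd θ x ![u, v]) (extd_add_left θ x) (extd_smul_left θ x)
    (fun u v v' => by
      rw [extd_swap, extd_add_left, extd_swap θ x v, extd_swap θ x v', ← neg_add, neg_neg])
    (fun a u v => by rw [extd_swap, extd_smul_left, extd_swap θ x v, smul_neg, neg_neg])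

end OneForms

/-! ### Local trivializations, vertical vectors and the curvature of connections -/

section Bundle

variable {W : Type*} [NormedAddCommGroup W] [NormedSpace ℝ W] [FiniteDimensional ℝ W]
  {EM EP 𝔤 M P G : Type*}
  [AddCommGroup EM] [Module ℝ EM] [TopologicalSpace EM] [DiffeologicalSpace EM]
  [ConvenientSpace EM]
  [AddCommGroup EP] [Module ℝ EP] [TopologicalSpace EP] [DiffeologicalSpace EP]
  [ConvenientSpace EP]
  [AddCommGroup 𝔤] [Module ℝ 𝔤] [TopologicalSpace 𝔤] [DiffeologicalSpace 𝔤] [ConvenientSpace 𝔤]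
  [DiffeologicalSpace M] [ConvManifold EM M]
  [DiffeologicalSpace P] [ConvManifold EP P]
  [Group G] [DiffeologicalSpace G] [ConvManifold 𝔤 G] [ConvLieGroup G]
  {B : PrincipalBundle M P G}

theorem IsSmooth.act {p : W → P} {g : W → G} (hp : IsSmooth p) (hg : IsSmooth g) :
    IsSmooth (fun s => B.act (p s) (g s)) := (hp.prodMk hg).map B.smooth_act

theorem IsSmoothAt.act {p : W → P} {g : W → G} {r : W} (hp : IsSmoothAt p r)
    (hg : IsSmoothAt g r) : IsSmoothAt (fun s => B.act (p s) (g s)) r :=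
  (hp.prodMk hg).map B.smooth_act

theorem mapSmoothAt_act_right (g : G) (p : P) : MapSmoothAt (fun q => B.act q g) p :=
  fun _ _ _ hp _ => hp.act ((isSmooth_const g).isSmoothAt _)

theorem mapSmoothAt_act_left (p : P) (g : G) : MapSmoothAt (fun g => B.act p g) g :=
  fun _ _ _ hg _ => ((isSmooth_const p).isSmoothAt _).act hg

theorem mapSmoothAt_proj (p : P) : MapSmoothAt B.proj p :=
  mapSmoothAt_of_dSmooth B.smooth_proj p

theorem tmap_proj_act (p : P) (g : G) (v : EP) :
    tmap EP EM B.proj (B.act p g) (tmap EP EP (fun q => B.act q g) p v) =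
      tmap EP EM B.proj p v := by
  rw [tmap_comp (f := fun q => B.act q g) (mapSmoothAt_proj _) (mapSmoothAt_act_right g p)]
  simp only [B.proj_act]

/-- A local trivialization, with germwise smoothness. -/
theorem exists_trivialization (B : PrincipalBundle M P G) (x : M) :
    ∃ U : Set M, IsOpen[dTopology] U ∧ x ∈ U ∧ ∃ (s : M → P) (τ : P → G),
      (∀ y ∈ U, MapSmoothAt s y) ∧ (∀ p, B.proj p ∈ U → MapSmoothAt τ p) ∧
      DSmoothOn τ (B.proj ⁻¹' U) ∧
      (∀ y ∈ U, B.proj (s y) = y) ∧ (∀ p, B.proj p ∈ U → B.act (s (B.proj p)) (τ p) = p) ∧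
      (∀ p, B.proj p ∈ U → ∀ g, τ (B.act p g) = τ p * g) := by
  obtain ⟨U, hU, hx, s, τ, hs, hτ, h1, h2, h3⟩ := B.locally_trivial x
  have hU' : IsOpen[dTopology] (B.proj ⁻¹' U) :=
    isOpen_iff_preimages_plots.2 fun n p hp =>
      isOpen_iff_preimages_plots.1 hU n _ (B.smooth_proj n p hp)
  refine ⟨U, hU, hx, s, τ, fun y hy => hs.mapSmoothAt hU hy,
    fun p hp => hτ.mapSmoothAt hU' hp, hτ, h1, h2, fun p hp g => ?_⟩
  conv_lhs => rw [← h2 p hp, ← B.act_mul]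
  exact h3 _ hp _

/-- The action is transitive on fibres. -/
theorem exists_act_eq {p q : P} (h : B.proj p = B.proj q) : ∃ g, B.act q g = p := by
  obtain ⟨U, -, hx, s, τ, -, -, -, -, h2, -⟩ := exists_trivialization B (B.proj p)
  refine ⟨(τ q)⁻¹ * τ p, ?_⟩
  calc B.act q ((τ q)⁻¹ * τ p)
      = B.act (B.act (s (B.proj q)) (τ q)) ((τ q)⁻¹ * τ p) := by rw [h2 q (h ▸ hx)]
    _ = p := by rw [← B.act_mul, mul_inv_cancel_left, ← h, h2 p hx]

/-- Compose with a local section. Differential identities on `M` are checked on such lifts to `P`.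
-/
theorem exists_lift (B : PrincipalBundle M P G) {q : W → M} (hq : IsSmooth q) (r : W) :
    ∃ p : W → P, IsSmooth p ∧ ∀ᶠ s in 𝓝 r, B.proj (p s) = q s := by
  obtain ⟨U, hU, hx, s, τ, hs, -, -, h1, -, -⟩ := exists_trivialization B (q r)
  obtain ⟨p, hp, e⟩ := (hs _ hx).isSmoothAt (hq.isSmoothAt r)
  refine ⟨p, hp, ?_⟩
  filter_upwards [e, (hq.isSmoothAt r).eventually_mem hU hx] with t ht htU
  rw [← ht, h1 _ htU]

variable (B) in
/-- The fundamental vector field of `X`. -/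
def fundamentalVector (EP : Type*) [AddCommGroup EP] [Module ℝ EP] [TopologicalSpace EP]
    [DiffeologicalSpace EP] [ConvenientSpace EP] [ConvManifold EP P] (X : 𝔤) (p : P) : EP :=
  tmap 𝔤 EP (fun g : G => B.act p g) 1 X

/-- Vertical vectors are values of fundamental vector fields. -/
theorem exists_fundamentalVector_eq {p : P} {v : EP} (hv : tmap EP EM B.proj p v = 0) :
    ∃ X : 𝔤, v = fundamentalVector B EP X p := by
  obtain ⟨U, hU, hx, s, τ, hs, hτ, -, h1, h2, h3⟩ := exists_trivialization B (B.proj p)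
  obtain ⟨c, hc, hc0, hcv, -⟩ := exists_curve p v
  have hc' := hc.isSmoothAt 0
  have hπc : IsSmoothAt (fun t => B.proj (c t)) 0 := hc'.map B.smooth_proj
  have hτc : IsSmoothAt (fun t => τ (c t)) 0 :=
    (hτ p hx).isSmoothAt' hc' hc0
  have hsc : IsSmoothAt (fun t => s (B.proj (c t))) 0 :=
    (hs _ hx).isSmoothAt' hπc (by rw [hc0])
  have hp : B.act (s (B.proj p)) (τ p) = p := h2 p hx
  -- Write `c(t) = s(π(c(t))) · τ(c(t))` and separate the two times. The base factor has zero
  -- velocity since `v` is vertical; the group factor gives a fundamental vector, with `X` the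
  -- velocity of `τ(p)⁻¹ τ(c(t))`.
  have hH : IsSmoothAt (fun z : ℝ × ℝ => B.act (s (B.proj (c z.1))) (τ (c z.2))) 0 :=
    (hsc.comp' contDiff_fst rfl).act (hτc.comp' contDiff_snd rfl)
  have hHp : B.act (s (B.proj (c 0))) (τ (c 0)) = p := by rw [hc0, hp]
  have key := vel_add (E := EP) hH (1, 0) (0, 1)
  have e1 : vel EP (fun z : ℝ × ℝ => B.act (s (B.proj (c z.1))) (τ (c z.2))) 0
      ((1, 0) + (0, 1)) = v := by
    rw [← vel_comp_line]
    rw [← hcv]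
    refine vel_congr ?_ _
    filter_upwards [hπc.eventually_mem hU (by rwa [hc0])] with t ht
    simpa using h2 _ ht
  have e2 : vel EP (fun z : ℝ × ℝ => B.act (s (B.proj (c z.1))) (τ (c z.2))) 0 (1, 0) = 0 := by
    rw [← vel_comp_line]
    have hm : MapSmoothAt (fun y => B.act (s y) (τ p)) (B.proj p) :=
      (mapSmoothAt_act_right (τ p) _).comp (hs _ hx)
    have := tmap_vel' (F := EP) (E := EM) hm hπc (by rw [hc0]) 1
    rw [← tmap_vel' (E := EP) (F := EM) (mapSmoothAt_proj p) hc' hc0, hcv, hv, tmap_zero hm] at this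
    simpa [hc0] using this.symm
  have hg : IsSmoothAt (fun t => (τ p)⁻¹ * τ (c t)) 0 := ((isSmooth_const _).isSmoothAt _).mul hτc
  have e3 : vel EP (fun z : ℝ × ℝ => B.act (s (B.proj (c z.1))) (τ (c z.2))) 0 (0, 1) =
      fundamentalVector B EP (vel 𝔤 (fun t => (τ p)⁻¹ * τ (c t)) 0 1) p := by
    rw [← vel_comp_line, fundamentalVector,
      tmap_vel' (mapSmoothAt_act_left p 1) hg (by simp [hc0])]
    congr 1
    funext t
    have : B.act p ((τ p)⁻¹ * τ (c t)) = B.act (s (B.proj p)) (τ (c t)) := by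
      calc B.act p ((τ p)⁻¹ * τ (c t))
          = B.act (B.act (s (B.proj p)) (τ p)) ((τ p)⁻¹ * τ (c t)) := by rw [hp]
        _ = _ := by rw [← B.act_mul, mul_inv_cancel_left]
    rw [this]
    simp [hc0]
  rw [e1, e2, e3, zero_add] at key
  exact ⟨_, key⟩

variable (θ θ' : Connection EP 𝔤 B)

/-- Evaluate `dθ` on the surface `(a, t) ↦ c(t) · g(a)`. Along `a = 0`, `θ(∂_a)` is the constant
`X`; along `t = 0`, `θ(∂_t) = Ad_{g(a)⁻¹} θ(v)`, whose derivative is `-[X, θ(v)]`. -/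
theorem extd_fundamentalVector (X : 𝔤) (p : P) (v : EP) :
    extd θ.form p ![fundamentalVector B EP X p, v] = - lieBracket G X (θ.form p ![v]) := by
  obtain ⟨c, hc, hc0, hcv, -⟩ := exists_curve p v
  obtain ⟨g, hg, hg0, hgX, -⟩ := exists_curve (1 : G) X
  have hH : IsSmooth (fun z : ℝ × ℝ => B.act (c z.2) (g z.1)) :=
    (hc.comp contDiff_snd).act (hg.comp contDiff_fst)
  have hHp : B.act (c 0) (g 0) = p := by rw [hc0, hg0, B.act_one]
  have v1 : ∀ t : ℝ, vel EP (fun z : ℝ × ℝ => B.act (c z.2) (g z.1)) (0, t) (1, 0) =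
      fundamentalVector B EP X (c t) := by
    intro t
    rw [fundamentalVector, ← hgX,
      tmap_vel' (mapSmoothAt_act_left (c t) 1) (hg.isSmoothAt 0) hg0, ← vel_comp_line]
    simp
  have v2 : ∀ t : ℝ, vel EP (fun z : ℝ × ℝ => B.act (c z.2) (g z.1)) (t, 0) (0, 1) =
      tmap EP EP (fun q => B.act q (g t)) p v := by
    intro t
    rw [← hcv, tmap_vel' (mapSmoothAt_act_right (g t) p) (hc.isSmoothAt 0) hc0, ← vel_comp_line]
    simp
  have v20 : vel EP (fun z : ℝ × ℝ => B.act (c z.2) (g z.1)) (0, 0) (0, 1) = v := by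
    rw [v2, hg0]
    simp only [B.act_one]
    exact tmap_id p v
  have key := θ.form.extd_along hH (0, 0) (1, 0) (0, 1)
  rw [v1, v20] at key
  simp only [hHp] at key
  rw [hc0] at key
  rw [key]
  have d1 : dd (fun s => θ.form.along (fun z : ℝ × ℝ => B.act (c z.2) (g z.1)) s (0, 1)) (0, 0)
      (1, 0) = - lieBracket G X (θ.form p ![v]) := by
    rw [← hgX, ← dd_Ad_inv_left (hg.isSmoothAt 0) hg0, dd, dd]
    congr 1
    funext t
    simp only [Prod.smul_mk, Prod.mk_add_mk, smul_zero, add_zero, DForm.along, v2]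
    rw [hc0]
    exact θ.equivariant p _ v
  have d2 : dd (fun s => θ.form.along (fun z : ℝ × ℝ => B.act (c z.2) (g z.1)) s (1, 0)) (0, 0)
      (0, 1) = 0 := by
    rw [dd, ← deriv_const' X 0]
    congr 1
    funext t
    simp only [Prod.smul_mk, Prod.mk_add_mk, smul_zero, add_zero, DForm.along, v1, hg0, B.act_one]
    exact θ.fundamental _ X
  rw [d1, d2, sub_zero]

/-- Skew-symmetry of the Lie bracket, obtained from a connection. -/
theorem lieBracket_anticomm (θ : Connection EP 𝔤 B) (p : P) (X Y : 𝔤) : lieBracket G X Y = - lieBracket G Y X := by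
  have h1 := extd_fundamentalVector θ X p (fundamentalVector B EP Y p)
  have h2 := extd_fundamentalVector θ Y p (fundamentalVector B EP X p)
  -- On fundamental vectors `dθ` equals minus the bracket of the generators, and `dθ` is
  -- alternating.
  rw [extd_swap, h2] at h1
  have hX : θ.form p ![fundamentalVector B EP X p] = X := θ.fundamental p X
  have hY : θ.form p ![fundamentalVector B EP Y p] = Y := θ.fundamental p Y
  rw [hX, hY, neg_neg] at h1
  rw [h1, neg_neg]

theorem extd_act (p : P) (g : G) (u v : EP) :
    extd θ.form (B.act p g) ![tmap EP EP (fun q => B.act q g) p u,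
      tmap EP EP (fun q => B.act q g) p v] = Ad g⁻¹ (extd θ.form p ![u, v]) := by
  obtain ⟨q, hq, hq0, -, hv⟩ := exists_affine_plot p ![u, v]
  have h0 := hv 0
  have h1 := hv 1
  simp only [Matrix.cons_val_zero, Matrix.cons_val_one] at h0 h1
  subst hq0
  have hqg : IsSmooth (fun s => B.act (q s) g) := hq.act (isSmooth_const g)
  have hal : ∀ w s, θ.form.along (fun s => B.act (q s) g) s w =
      AdLinear 𝔤 g⁻¹ (θ.form.along q s w) := by
    intro w s
    rw [DForm.along, DForm.along,
      ← tmap_vel' (E := EP) (F := EP) (mapSmoothAt_act_right g (q s)) (hq.isSmoothAt s) rfl]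
    exact θ.equivariant _ _ _
  rw [← h0, ← h1, tmap_vel' (mapSmoothAt_act_right g (q 0)) (hq.isSmoothAt 0) rfl,
    tmap_vel' (mapSmoothAt_act_right g (q 0)) (hq.isSmoothAt 0) rfl,
    θ.form.extd_along hqg, θ.form.extd_along hq]
  simp_rw [hal]
  rw [dd_linear _ (dSmooth_AdLinear _) ((θ.form.isSmooth_along hq _).isSmoothAt 0),
    dd_linear _ (dSmooth_AdLinear _) ((θ.form.isSmooth_along hq _).isSmoothAt 0), ← map_sub]
  rfl

/-! ### The curvature of the segment between two connections -/

/-- The `1`-form of the connection `(1 - t) θ + t θ'`. -/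
def segmentForm (t : ℝ) (p : P) : EP →ₗ[ℝ] 𝔤 :=
  (1 - t) • oneFormLinear (θ.form.toAlt p) + t • oneFormLinear (θ'.form.toAlt p)

/-- The curvature at `(t, p)` of the connection `(1 - t) θ + t θ'` on `ℝ × P`. -/
def segmentCurvature (t : ℝ) (p : P) : (ℝ × EP) →ₗ[ℝ] (ℝ × EP) →ₗ[ℝ] 𝔤 :=
  ((1 - t) • extdBilinear θ.form p + t • extdBilinear θ'.form p +
    (bracket 𝔤 G).compl₁₂ (segmentForm θ θ' t p) (segmentForm θ θ' t p)).compl₁₂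
      (LinearMap.snd ℝ ℝ EP) (LinearMap.snd ℝ ℝ EP) +
  (LinearMap.lsmul ℝ 𝔤).compl₁₂ (LinearMap.fst ℝ ℝ EP)
    ((oneFormLinear (θ'.form.toAlt p) - oneFormLinear (θ.form.toAlt p)) ∘ₗ
      LinearMap.snd ℝ ℝ EP) -
  ((LinearMap.lsmul ℝ 𝔤).compl₁₂ (LinearMap.fst ℝ ℝ EP)
    ((oneFormLinear (θ'.form.toAlt p) - oneFormLinear (θ.form.toAlt p)) ∘ₗ
      LinearMap.snd ℝ ℝ EP)).flip

theorem segmentForm_apply (t : ℝ) (p : P) (v : EP) :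
    segmentForm θ θ' t p v = (1 - t) • θ.form p ![v] + t • θ'.form p ![v] := rfl

/-- The last two terms are `dt ∧ (θ' - θ)`, produced by differentiating the coefficients `1 - t` and
`t`. -/
theorem segmentCurvature_apply (t : ℝ) (p : P) (a b : ℝ × EP) :
    segmentCurvature θ θ' t p a b =
      (1 - t) • extd θ.form p ![a.2, b.2] + t • extd θ'.form p ![a.2, b.2] +
      lieBracket G (segmentForm θ θ' t p a.2) (segmentForm θ θ' t p b.2) +
      a.1 • (θ'.form p ![b.2] - θ.form p ![b.2]) -
      b.1 • (θ'.form p ![a.2] - θ.form p ![a.2]) := rfl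

theorem segmentCurvature_zero (p : P) (u v : EP) :
    segmentCurvature θ θ' 0 p (0, u) (0, v) = θ.curvature p u v := by
  simp [segmentCurvature_apply, segmentForm_apply, Connection.curvature]

theorem segmentCurvature_one (p : P) (u v : EP) :
    segmentCurvature θ θ' 1 p (0, u) (0, v) = θ'.curvature p u v := by
  simp [segmentCurvature_apply, segmentForm_apply, Connection.curvature]

theorem segmentCurvature_swap (t : ℝ) (p : P) (a b : ℝ × EP) :
    segmentCurvature θ θ' t p a b = - segmentCurvature θ θ' t p b a := by
  rw [segmentCurvature_apply, segmentCurvature_apply, extd_swap, extd_swap θ'.form,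
    lieBracket_anticomm θ p (segmentForm θ θ' t p a.2)]
  module

/-- Both forms take the value `X` on a fundamental vector, so the `dt` term vanishes, and `dθ(X, ·)
= -[X, θ]` cancels the bracket term. -/
theorem segmentCurvature_vertical (t : ℝ) (p : P) {u : EP} (hu : tmap EP EM B.proj p u = 0)
    (b : ℝ × EP) : segmentCurvature θ θ' t p (0, u) b = 0 := by
  obtain ⟨X, rfl⟩ := exists_fundamentalVector_eq (𝔤 := 𝔤) hu
  have hX : θ.form p ![fundamentalVector B EP X p] = X := θ.fundamental p X
  have hX' : θ'.form p ![fundamentalVector B EP X p] = X := θ'.fundamental p X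
  rw [segmentCurvature_apply, segmentForm_apply θ θ' t p (fundamentalVector B EP X p), hX, hX',
    extd_fundamentalVector, extd_fundamentalVector, ← add_smul, sub_add_cancel, one_smul,
    segmentForm_apply, lieBracket_add_right]
  have e1 : ∀ (a : ℝ) (Y : 𝔤), lieBracket G X (a • Y) = a • lieBracket G X Y :=
    fun a Y => (bracket 𝔤 G X).map_smul a Y
  rw [e1, e1]
  simp
  abel

theorem segmentCurvature_act (t : ℝ) (p : P) (g : G) (a b : ℝ × EP) :
    segmentCurvature θ θ' t (B.act p g) (a.1, tmap EP EP (fun q => B.act q g) p a.2)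
      (b.1, tmap EP EP (fun q => B.act q g) p b.2) = Ad g⁻¹ (segmentCurvature θ θ' t p a b) := by
  have hs : ∀ v : EP, segmentForm θ θ' t (B.act p g) (tmap EP EP (fun q => B.act q g) p v) =
      Ad g⁻¹ (segmentForm θ θ' t p v) := by
    intro v
    rw [segmentForm_apply, segmentForm_apply, θ.equivariant, θ'.equivariant]
    simp only [← AdLinear_apply, map_add, map_smul]
  rw [segmentCurvature_apply, segmentCurvature_apply]
  simp only [hs, extd_act, θ.equivariant, θ'.equivariant, ← Ad_lieBracket]
  simp only [← AdLinear_apply, map_add, map_smul, map_sub]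

/-- The connection form `(1 - t) θ + t θ'` on `ℝ × P` along a plot of `P`. -/
def segmentAlong (p : W → P) (z w : ℝ × W) : 𝔤 :=
  (1 - z.1) • θ.form.along p z.2 w.2 + z.1 • θ'.form.along p z.2 w.2

theorem isSmooth_segmentAlong {p : W → P} (hp : IsSmooth p) (w : ℝ × W) :
    IsSmooth (fun z => segmentAlong θ θ' p z w) :=
  (IsSmooth.smul (by fun_prop) ((θ.form.isSmooth_along hp w.2).comp contDiff_snd)).add
    (IsSmooth.smul (by fun_prop) ((θ'.form.isSmooth_along hp w.2).comp contDiff_snd))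

/-- Along a plot the pointwise curvature is that of a 1-form on the vector space `ℝ × W`, to which
the Bianchi identity applies. -/
theorem localCurvature_segmentAlong {p : W → P} (hp : IsSmooth p) (z u v : ℝ × W) :
    localCurvature G (segmentAlong θ θ' p) z u v =
      segmentCurvature θ θ' z.1 (p z.2) (u.1, vel EP p z.2 u.2) (v.1, vel EP p z.2 v.2) := by
  have hd : ∀ u v : ℝ × W, dd (fun z => segmentAlong θ θ' p z v) z u =
      (1 - z.1) • dd (fun s => θ.form.along p s v.2) z.2 u.2 +
        z.1 • dd (fun s => θ'.form.along p s v.2) z.2 u.2 +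
        u.1 • (θ'.form.along p z.2 v.2 - θ.form.along p z.2 v.2) := by
    intro u v
    have h1 : IsSmooth (fun z : ℝ × W => θ.form.along p z.2 v.2) :=
      (θ.form.isSmooth_along hp v.2).comp contDiff_snd
    have h2 : IsSmooth (fun z : ℝ × W => θ'.form.along p z.2 v.2) :=
      (θ'.form.isSmooth_along hp v.2).comp contDiff_snd
    simp only [segmentAlong]
    rw [dd_add (IsSmooth.smul (by fun_prop) h1) (IsSmooth.smul (by fun_prop) h2),
      dd_smul (by fun_prop) h1, dd_smul (by fun_prop) h2]
    have f1 : fderiv ℝ (fun z : ℝ × W => 1 - z.1) z u = - u.1 := by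
      rw [fderiv_const_sub, fderiv_fst]
      rfl
    have f2 : fderiv ℝ (fun z : ℝ × W => z.1) z u = u.1 := by
      rw [fderiv_fst]
      rfl
    have g1 : dd (fun z : ℝ × W => θ.form.along p z.2 v.2) z u =
        dd (fun s => θ.form.along p s v.2) z.2 u.2 := rfl
    have g2 : dd (fun z : ℝ × W => θ'.form.along p z.2 v.2) z u =
        dd (fun s => θ'.form.along p s v.2) z.2 u.2 := rfl
    rw [f1, f2, g1, g2]
    module
  rw [localCurvature, hd, hd, segmentCurvature_apply, θ.form.extd_along hp, θ'.form.extd_along hp]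
  simp only [segmentForm_apply, segmentAlong, DForm.along]
  module

end Bundle

/-! ### Skew-symmetrization of a polynomial in a two-form -/

section AltForm

variable {E 𝔤 : Type*} [AddCommGroup E] [Module ℝ E] [AddCommGroup 𝔤] [Module ℝ 𝔤] {n k : ℕ}

/-- Each vector enters exactly one pair, in its first or second slot according to the parity of `j`.
Multilinearity in the vectors thus follows from that of `φ`. -/
theorem exists_update_pair (hn : n = 2 * k) (K : E →ₗ[ℝ] E →ₗ[ℝ] 𝔤) (v : Fin n → E) (j : Fin n) :
    ∃ (l : Fin k) (L : E →ₗ[ℝ] 𝔤), ∀ a : E, (fun i : Fin k =>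
      K (Function.update v j a ⟨2 * (i : ℕ), by omega⟩)
        (Function.update v j a ⟨2 * (i : ℕ) + 1, by omega⟩)) =
      Function.update (fun i : Fin k =>
        K (v ⟨2 * (i : ℕ), by omega⟩) (v ⟨2 * (i : ℕ) + 1, by omega⟩)) l (L a) := by
  obtain ⟨j, hj⟩ := j
  have hl : j / 2 < k := by omega
  rcases Nat.even_or_odd' j with ⟨c, rfl | rfl⟩
  · refine ⟨⟨c, by omega⟩, K.flip (v ⟨2 * c + 1, by omega⟩), fun a => funext fun i => ?_⟩
    by_cases hi : (i : ℕ) = c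
    · obtain ⟨i, hi'⟩ := i
      subst hi
      simp
    · rw [Function.update_of_ne, Function.update_of_ne, Function.update_of_ne] <;>
        simp only [ne_eq, Fin.ext_iff] <;> omega
  · refine ⟨⟨c, by omega⟩, K (v ⟨2 * c, by omega⟩), fun a => funext fun i => ?_⟩
    by_cases hi : (i : ℕ) = c
    · obtain ⟨i, hi'⟩ := i
      subst hi
      simp
    · rw [Function.update_of_ne, Function.update_of_ne, Function.update_of_ne] <;>
        simp only [ne_eq, Fin.ext_iff] <;> omega

/-- The multilinear map `v ↦ φ(K(v₀, v₁), K(v₂, v₃), …)`. -/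
def pairForm (hn : n = 2 * k) (φ : MultilinearMap ℝ (fun _ : Fin k => 𝔤) ℂ)
    (K : E →ₗ[ℝ] E →ₗ[ℝ] 𝔤) : MultilinearMap ℝ (fun _ : Fin n => E) ℂ :=
  MultilinearMap.mk' (fun v => φ fun i : Fin k =>
      K (v ⟨2 * (i : ℕ), by omega⟩) (v ⟨2 * (i : ℕ) + 1, by omega⟩))
    (fun v j a b => by
      obtain ⟨l, L, h⟩ := exists_update_pair hn K v j
      simp only [h, map_add, MultilinearMap.map_update_add])
    (fun v j c a => by
      obtain ⟨l, L, h⟩ := exists_update_pair hn K v j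
      simp only [h, map_smul, MultilinearMap.map_update_smul])

/-- `altSum` as an alternating map. -/
def altForm (hn : n = 2 * k) (φ : MultilinearMap ℝ (fun _ : Fin k => 𝔤) ℂ)
    (K : E →ₗ[ℝ] E →ₗ[ℝ] 𝔤) : E [⋀^Fin n]→ₗ[ℝ] ℂ :=
  ((Nat.factorial n : ℕ) : ℝ)⁻¹ • MultilinearMap.alternatization (pairForm hn φ K)

theorem altForm_apply (hn : n = 2 * k) (φ : MultilinearMap ℝ (fun _ : Fin k => 𝔤) ℂ)
    (K : E →ₗ[ℝ] E →ₗ[ℝ] 𝔤) (v : Fin n → E) :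
    altForm hn φ K v = altSum hn φ (fun a b => K a b) v := by
  rw [altForm, AlternatingMap.smul_apply, MultilinearMap.alternatization_apply, altSum,
    Complex.real_smul]
  push_cast
  congr 1
  refine Finset.sum_congr rfl fun σ _ => ?_
  rw [MultilinearMap.domDomCongr_apply, Units.smul_def, zsmul_eq_mul]
  rfl

theorem altSum_eq_zero (hn : n = 2 * k) (φ : MultilinearMap ℝ (fun _ : Fin k => 𝔤) ℂ)
    (K : E → E → 𝔤) (v : Fin n → E) (i : Fin n) (h : ∀ b, K (v i) b = 0)
    (h' : ∀ b, K b (v i) = 0) : altSum hn φ K v = 0 := by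
  rw [altSum]
  refine mul_eq_zero_of_right _ (Finset.sum_eq_zero fun σ _ => mul_eq_zero_of_right _ ?_)
  obtain ⟨j, rfl⟩ := σ.surjective i
  obtain ⟨j, hj⟩ := j
  rcases Nat.even_or_odd' j with ⟨c, rfl | rfl⟩
  · exact φ.map_coord_zero ⟨c, by omega⟩ (h _)
  · exact φ.map_coord_zero ⟨c, by omega⟩ (h' _)

/-- Arguments are exchanged one at a time; each error term has an argument in `N` and vanishes. -/
theorem map_eq_of_sub_mem {F : Type*} [AddCommGroup F] [Module ℝ F]
    (A : E [⋀^Fin n]→ₗ[ℝ] F) (N : E → Prop) (h : ∀ (v : Fin n → E) (i : Fin n), N (v i) → A v = 0)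
    (v v' : Fin n → E) (hv : ∀ i, N (v i - v' i)) : A v = A v' := by
  have key : ∀ s : Finset (Fin n), A (s.piecewise v v') = A v' := by
    intro s
    induction s using Finset.induction_on with
    | empty => simp
    | insert a s ha ih =>
      have e : v a = v' a + (v a - v' a) := by abel
      rw [Finset.piecewise_insert, e, A.map_update_add,
        h (Function.update _ a (v a - v' a)) a (by simpa using hv a), add_zero]
      have : Function.update (s.piecewise v v') a (v' a) = s.piecewise v v' := by
        conv_rhs => rw [← Function.update_eq_self a (s.piecewise v v')]
        rw [Finset.piecewise_eq_of_notMem s v v' ha]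
      rw [this, ih]
  simpa using key Finset.univ

end AltForm

/-! ### Basic forms -/

section Basic

variable {W : Type*} [NormedAddCommGroup W] [NormedSpace ℝ W] [FiniteDimensional ℝ W]
  {EM EP 𝔤 M P G : Type*}
  [AddCommGroup EM] [Module ℝ EM] [TopologicalSpace EM] [DiffeologicalSpace EM]
  [ConvenientSpace EM]
  [AddCommGroup EP] [Module ℝ EP] [TopologicalSpace EP] [DiffeologicalSpace EP]
  [ConvenientSpace EP]
  [AddCommGroup 𝔤] [Module ℝ 𝔤] [TopologicalSpace 𝔤] [DiffeologicalSpace 𝔤] [ConvenientSpace 𝔤]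
  [DiffeologicalSpace M] [ConvManifold EM M]
  [DiffeologicalSpace P] [ConvManifold EP P]
  [Group G] [DiffeologicalSpace G] [ConvManifold 𝔤 G] [ConvLieGroup G]
  {B : PrincipalBundle M P G} {n : ℕ}

variable (EM B) in
/-- Horizontal and invariant forms on the total space. -/
structure IsBasic (β : P → (EP [⋀^Fin n]→ₗ[ℝ] ℂ)) : Prop where
  horizontal : ∀ (p : P) (v : Fin n → EP) (i : Fin n), tmap EP EM B.proj p (v i) = 0 → β p v = 0
  invariant : ∀ (p : P) (g : G) (v : Fin n → EP),
    β (B.act p g) (fun i => tmap EP EP (fun q => B.act q g) p (v i)) = β p v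

/-- A basic form only depends on the projections of its arguments. -/
theorem IsBasic.eq_of_proj_eq {β : P → (EP [⋀^Fin n]→ₗ[ℝ] ℂ)} (hβ : IsBasic EM B β) {p q : P}
    (h : B.proj p = B.proj q) {v w : Fin n → EP}
    (hvw : ∀ i, tmap EP EM B.proj p (v i) = tmap EP EM B.proj q (w i)) : β p v = β q w := by
  obtain ⟨g, rfl⟩ := exists_act_eq h
  rw [← hβ.invariant q g w]
  refine map_eq_of_sub_mem _ (fun u => tmap EP EM B.proj (B.act q g) u = 0)
    (hβ.horizontal _) _ _ fun i => ?_
  rw [tmap_sub (mapSmoothAt_proj _), tmap_proj_act, hvw, sub_self]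

/-- The projection sends velocities of the lift to velocities of the plot below. The equality holds
near `r`, so it may be differentiated. -/
theorem IsBasic.eq_of_lift {β : P → (EP [⋀^Fin n]→ₗ[ℝ] ℂ)}
    {α : M → (Fin n → EM) → ℂ} (hα : ∀ p v, pullback EP EM B.proj α p v = β p v)
    {q : W → M} {p : W → P} (hp : IsSmooth p) {r : W} (h : ∀ᶠ s in 𝓝 r, B.proj (p s) = q s)
    (w : Fin n → W) : ∀ᶠ s in 𝓝 r, α (q s) (fun i => vel EM q s (w i)) =
      β (p s) (fun i => vel EP p s (w i)) := by
  filter_upwards [h.eventually_nhds] with s hs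
  have hs' : (fun s => B.proj (p s)) =ᶠ[𝓝 s] q := hs
  rw [← hα, pullback, hs'.eq_of_nhds]
  congr 1
  funext i
  rw [tmap_vel' (mapSmoothAt_proj (p s)) (hp.isSmoothAt s) rfl, vel_congr hs']

/-- Basic forms descend to the base. -/
theorem IsBasic.exists_dForm {β : P → (EP [⋀^Fin n]→ₗ[ℝ] ℂ)} (hβ : IsBasic EM B β)
    (hs : ∀ (m : ℕ) (p : EuclideanSpace ℝ (Fin m) × (Fin n → ℝ) → P), IsSmooth p →
      ∀ w : Fin n → EuclideanSpace ℝ (Fin m) × (Fin n → ℝ),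
      IsSmooth (fun r => β (p r) (fun i => vel EP p r (w i)))) :
    ∃ α : DForm EM M ℂ n, ∀ p v, pullback EP EM B.proj α p v = β p v := by
  have hsec : ∀ x : M, ∃ s : M → P, MapSmoothAt s x ∧ B.proj (s x) = x ∧
      ∀ v : EM, tmap EP EM B.proj (s x) (tmap EM EP s x v) = v := by
    intro x
    obtain ⟨U, hU, hx, s, -, hs, -, -, h1, -, -⟩ := exists_trivialization B x
    refine ⟨s, hs x hx, h1 x hx, fun v => ?_⟩
    rw [tmap_comp (mapSmoothAt_proj _) (hs x hx), tmap_congr (g := fun y => y) hU hx h1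
      ((mapSmoothAt_proj _).comp (hs x hx)) (mapSmoothAt_id x), tmap_id]
  choose s hsm h1 h2 using hsec
  -- The section is chosen separately at each point, without any regularity in `x`. Basicness makes
  -- the value independent of the choice.
  let a : M → (EM [⋀^Fin n]→ₗ[ℝ] ℂ) := fun x =>
    (β (s x x)).compLinearMap (tmapLinear (E := EM) (F := EP) (hsm x))
  have ha : ∀ p v, pullback EP EM B.proj (fun x v => a x v) p v = β p v := by
    intro p v
    refine hβ.eq_of_proj_eq (h1 _) fun i => ?_
    exact h2 _ _
  refine ⟨DForm.ofPlots a fun m q hq w => isSmooth_of_isSmoothAt fun r => ?_, ha⟩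
  -- By that independence the form can be evaluated on one smooth local lift, which gives
  -- smoothness.
  obtain ⟨p, hp, hpq⟩ := exists_lift B hq r
  refine ((hs m p hp w).isSmoothAt r).congr ?_
  filter_upwards [IsBasic.eq_of_lift ha hp hpq w] with t ht using ht.symm

/-- Local sections split the tangent map of the projection, so all tangent vectors of `M` are
reached. -/
theorem eq_of_pullback_eq {α α' : DForm EM M ℂ n}
    (h : ∀ p v, pullback EP EM B.proj α p v = pullback EP EM B.proj α' p v) : α = α' := by
  refine DForm.ext (funext fun x => AlternatingMap.ext fun v => ?_)
  obtain ⟨U, hU, hx, s, -, hs, -, -, h1, -, -⟩ := exists_trivialization B x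
  have h2 : ∀ v : EM, tmap EP EM B.proj (s x) (tmap EM EP s x v) = v := fun v => by
    rw [tmap_comp (mapSmoothAt_proj _) (hs x hx), tmap_congr (g := fun y => y) hU hx h1
      ((mapSmoothAt_proj _).comp (hs x hx)) (mapSmoothAt_id x), tmap_id]
  have := h (s x) fun i => tmap EM EP s x (v i)
  simpa only [pullback, h1 x hx, h2] using this

end Basic

/-! ### Invariant polynomials -/

section InvariantPolynomials

variable {W : Type*} [NormedAddCommGroup W] [NormedSpace ℝ W] [FiniteDimensional ℝ W]
  {EP 𝔤 M P G : Type*}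
  [AddCommGroup EP] [Module ℝ EP] [TopologicalSpace EP] [DiffeologicalSpace EP]
  [ConvenientSpace EP]
  [AddCommGroup 𝔤] [Module ℝ 𝔤] [TopologicalSpace 𝔤] [DiffeologicalSpace 𝔤] [ConvenientSpace 𝔤]
  [DiffeologicalSpace M]
  [DiffeologicalSpace P] [ConvManifold EP P]
  [Group G] [DiffeologicalSpace G] [ConvManifold 𝔤 G] [ConvLieGroup G]
  {B : PrincipalBundle M P G} {k : ℕ}

theorem dSmooth_invPoly_apply (f : invPoly 𝔤 B k) (p : P) :
    DSmooth (fun a : Fin k → 𝔤 => f.1 p a) :=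
  fun n a ha => f.2.1 n (fun r => (p, a r)) ⟨isPlot_const, ha⟩

/-- The connection form does not contribute to the commutator. -/
theorem commutator_eq (θ : Connection EP 𝔤 B) (f : invPoly 𝔤 B k) (s : Fin k → P → 𝔤) (p : P)
    (v : EP) : commutator θ f s p v = tmap EP ℂ (fun q : P => f.1 q (fun i => s i q)) p v
      - ∑ i : Fin k, f.1 p (Function.update (fun j => s j p) i (tmap EP 𝔤 (s i) p v)) := by
  simp only [commutator, Connection.covDeriv, MultilinearMap.map_update_add,
    Finset.sum_add_distrib]
  rw [sum_update_lieBracket_eq_zero (f.1 p) (dSmooth_invPoly_apply f p) (f.2.2.2.2 p)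
    (θ.form p ![v]) (fun j => s j p), add_zero]

/-- A polynomial commuting with a connection has vanishing derivatives along the total space. -/
theorem tmap_invPoly_eq_zero {θ : Connection EP 𝔤 B} {f : InvPolynomial 𝔤 B}
    (h : CommutesWith θ f) (k : ℕ+) (p : P) (a : Fin k → 𝔤) (v : EP) :
    tmap EP ℂ (fun q => (f k).1 q a) p v = 0 := by
  obtain ⟨U, hU, hx, -, τ, -, hτ, hτU, -, -, h3⟩ := exists_trivialization B (B.proj p)
  -- These local sections are equivariant and equal `aᵢ` at `p`, while invariance of `f` removes the
  -- factor `Ad` at every `q`.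
  have hc := h k U hU (fun i q => Ad ((τ q)⁻¹ * τ p) (a i))
    (fun i => fun n q hq hqU => isSmooth_iff_isPlot.1 (isSmooth_of_isSmoothAt fun r =>
      ((((isSmooth_iff_isPlot.2 (hτU n q hq hqU)).isSmoothAt r).inv.mul
        ((isSmooth_const _).isSmoothAt r)).Ad ((isSmooth_const _).isSmoothAt r))))
    (fun i q hq g => by rw [h3 q hq, mul_inv_rev, mul_assoc, Ad_mul]) p hx v
  rw [commutator_eq] at hc
  have e1 : (fun q => (f k).1 q fun i => Ad ((τ q)⁻¹ * τ p) (a i)) = fun q => (f k).1 q a :=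
    funext fun q => (f k).2.2.2.2 q _ a
  rw [e1] at hc
  obtain ⟨c, hcs, hc0, hcv, -⟩ := exists_curve p v
  have hτc : IsSmoothAt (fun t => (τ (c t))⁻¹ * τ p) 0 :=
    ((hτ p hx).isSmoothAt' (hcs.isSmoothAt 0) hc0).inv.mul ((isSmooth_const _).isSmoothAt 0)
  -- With the base point of `f` frozen at `p`, the value on the sections is constant by invariance.
  -- Hence the Leibniz sum in the commutator vanishes, and only the derivative of `q ↦ f(q; a)`
  -- remains.
  have e2 := dd_multilinear ((f k).1 p) (dSmooth_invPoly_apply (f k) p) (r := (0 : ℝ))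
    (c := fun t i => Ad ((τ (c t))⁻¹ * τ p) (a i))
    (fun i => hτc.Ad ((isSmooth_const (a i)).isSmoothAt 0)) 1
  have e3 : ∀ i, tmap EP 𝔤 (fun q => Ad ((τ q)⁻¹ * τ p) (a i)) p v =
      dd (fun t => Ad ((τ (c t))⁻¹ * τ p) (a i)) 0 1 := by
    intro i
    have hm : MapSmoothAt (fun q => Ad ((τ q)⁻¹ * τ p) (a i)) p := fun n q r hq hqr =>
      (((hτ p hx).isSmoothAt' hq hqr).inv.mul ((isSmooth_const _).isSmoothAt r)).Ad
        ((isSmooth_const _).isSmoothAt r)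
    rw [← hcv, tmap_vel' hm (hcs.isSmoothAt 0) hc0, vel_model]
  have e4 : ∀ g, ((f k).1 p fun i => Ad g (a i)) = (f k).1 p a := fun g => (f k).2.2.2.2 p g a
  simp only [e4, dd_const, hc0, inv_mul_cancel, Ad_one] at e2
  simp only [e3, inv_mul_cancel, Ad_one] at hc
  rw [← e2, sub_zero] at hc
  exact hc

theorem dd_eq_fderiv {F : Type*} [NormedAddCommGroup F] [NormedSpace ℝ F] {f : W → F} {r : W}
    (hf : DifferentiableAt ℝ f r) (w : W) : dd f r w = fderiv ℝ f r w := by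
  have h1 : HasFDerivAt f (fderiv ℝ f r) (r + (0 : ℝ) • w) := by
    rw [zero_smul, add_zero]
    exact hf.hasFDerivAt
  have h2 : HasDerivAt (fun t : ℝ => r + t • w) w 0 := by
    simpa using ((hasDerivAt_id (0 : ℝ)).smul_const w).const_add r
  exact (h1.comp_hasDerivAt (0 : ℝ) h2).deriv

/-- A polynomial commuting with a connection is constant along plots. -/
theorem invPoly_eq_of_plot {θ : Connection EP 𝔤 B} {f : InvPolynomial 𝔤 B}
    (h : CommutesWith θ f) (k : ℕ+) {p : W → P} (hp : IsSmooth p) (s : W) :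
    (f k).1 (p s) = (f k).1 (p 0) := by
  ext a
  have hs : IsSmooth (fun s => (f k).1 (p s) a) :=
    IsSmooth.map (hp.prodMk (isSmooth_const a)) (f k).2.1
  have hd := (isSmooth_iff_contDiff.1 hs).differentiable (by simp)
  refine is_const_of_fderiv_eq_zero (𝕜 := ℝ) hd (fun r => ?_) s 0
  ext w
  rw [← dd_eq_fderiv (hd r), ← vel_model]
  have hm : MapSmoothAt (fun q => (f k).1 q a) (p r) := fun n q r hq _ =>
    IsSmoothAt.map (f := fun z : P × (Fin k → 𝔤) => (f k).1 z.1 z.2) (p := fun s => (q s, a))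
      (hq.prodMk ((isSmooth_const a).isSmoothAt r)) (f k).2.1
  rw [← tmap_vel' (E := EP) (F := ℂ) hm (hp.isSmoothAt r) rfl, tmap_invPoly_eq_zero h]
  rfl

end InvariantPolynomials

/-! ### Integration over the unit interval -/

section Integration

variable {W : Type*} [NormedAddCommGroup W] [NormedSpace ℝ W] [FiniteDimensional ℝ W]

theorem dd_slice {F : Type*} [AddCommGroup F] [Module ℝ F] [TopologicalSpace F] (f : ℝ × W → F)
    (t : ℝ) (r w : W) : dd f (t, r) (0, w) = dd (fun s => f (t, s)) r w := by
  simp [dd]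

/-- The homotopy formula on `[0, 1] × W`. -/
theorem sum_dd_integral_eq_sub {ι : Type*} [Fintype ι] (c : ι → ℝ) (e : ι → W) {C : ℝ × W → ℂ}
    {S : ι → ℝ × W → ℂ} (hC : IsSmooth C) (hS : ∀ i, IsSmooth (S i)) (r : W)
    (h : ∀ t : ℝ, dd C (t, r) (1, 0) = ∑ i, c i • dd (S i) (t, r) (0, e i)) :
    ∑ i, c i • dd (fun s => ∫ t in (0 : ℝ)..1, S i (t, s)) r (e i) = C (1, r) - C (0, r) := by
  have hC' : ContDiff ℝ ∞ C := isSmooth_iff_contDiff.1 hC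
  have hS' : ∀ i, ContDiff ℝ ∞ (S i) := fun i => isSmooth_iff_contDiff.1 (hS i)
  have hcs : ∀ i, Continuous fun t : ℝ => dd (S i) (t, r) (0, e i) := fun i => by
    simp_rw [dd_eq_fderiv ((hS' i).differentiable (by simp) _)]
    exact (((hS' i).continuous_fderiv (by simp)).comp (by fun_prop)).clm_apply continuous_const
  have h1 : ∀ i, dd (fun s => ∫ t in (0 : ℝ)..1, S i (t, s)) r (e i) =
      ∫ t in (0 : ℝ)..1, dd (S i) (t, r) (0, e i) := by
    intro i
    have hd := hasFDerivAt_parametric_integral ((hS' i).of_le (by simp)) r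
    rw [dd_eq_fderiv hd.differentiableAt, hd.fderiv,
      ContinuousLinearMap.intervalIntegral_apply]
    · refine intervalIntegral.integral_congr fun t _ => ?_
      simp only [dd_eq_fderiv ((hS' i).differentiable (by simp) _)]
      rfl
    · exact ((((hS' i).continuous_fderiv (by simp)).comp (by fun_prop)).clm_comp
        continuous_const).intervalIntegrable _ _
  have h2 : ∀ t : ℝ, HasDerivAt (fun t => C (t, r)) (dd C (t, r) (1, 0)) t := by
    intro t
    rw [dd_eq_fderiv (hC'.differentiable (by simp) _)]
    exact ((hC'.differentiable (by simp) (t, r)).hasFDerivAt).comp_hasDerivAt t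
      ((hasDerivAt_id t).prodMk (hasDerivAt_const t r))
  rw [← intervalIntegral.integral_eq_sub_of_hasDerivAt (fun t _ => h2 t)]
  · simp_rw [h, h1]
    rw [intervalIntegral.integral_finsetSum (f := fun i t => c i • dd (S i) (t, r) (0, e i))
      fun i _ => ((hcs i).const_smul (c i)).intervalIntegrable _ _]
    simp_rw [intervalIntegral.integral_smul]
  · simp_rw [h]
    exact (continuous_finsetSum _ fun i _ => (hcs i).const_smul (c i)).intervalIntegrable _ _

end Integration

section Transgression

variable {W : Type*} [NormedAddCommGroup W] [NormedSpace ℝ W] [FiniteDimensional ℝ W]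
  {EM EP 𝔤 M P G : Type*}
  [AddCommGroup EM] [Module ℝ EM] [TopologicalSpace EM] [DiffeologicalSpace EM]
  [ConvenientSpace EM]
  [AddCommGroup EP] [Module ℝ EP] [TopologicalSpace EP] [DiffeologicalSpace EP]
  [ConvenientSpace EP]
  [AddCommGroup 𝔤] [Module ℝ 𝔤] [TopologicalSpace 𝔤] [DiffeologicalSpace 𝔤] [ConvenientSpace 𝔤]
  [DiffeologicalSpace M] [ConvManifold EM M]
  [DiffeologicalSpace P] [ConvManifold EP P]
  [Group G] [DiffeologicalSpace G] [ConvManifold 𝔤 G] [ConvLieGroup G]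
  {B : PrincipalBundle M P G} {k n m : ℕ} (θ θ' : Connection EP 𝔤 B)

/-! ### The Chern form of the segment between two connections -/

/-- The Chern form at `(t, p)` of the connection `(1 - t) θ + t θ'` on `ℝ × P`. -/
def segmentChern (hn : n = 2 * k) (f : invPoly 𝔤 B k) (t : ℝ) (p : P) :
    (ℝ × EP) [⋀^Fin n]→ₗ[ℝ] ℂ :=
  altForm hn (f.1 p) (segmentCurvature θ θ' t p)

theorem segmentChern_apply (hn : n = 2 * k) (f : invPoly 𝔤 B k) (t : ℝ) (p : P)
    (a : Fin n → ℝ × EP) : segmentChern θ θ' hn f t p a =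
      altSum hn (f.1 p) (fun a b => segmentCurvature θ θ' t p a b) a := altForm_apply _ _ _ _

theorem segmentChern_horizontal (hn : n = 2 * k) (f : invPoly 𝔤 B k) (t : ℝ) (p : P)
    (a : Fin n → ℝ × EP) (i : Fin n) (h1 : (a i).1 = 0)
    (h2 : tmap EP EM B.proj p (a i).2 = 0) : segmentChern θ θ' hn f t p a = 0 := by
  have e : a i = (0, (a i).2) := Prod.ext h1 rfl
  have hv : ∀ b, segmentCurvature θ θ' t p (a i) b = 0 := fun b => by
    rw [e]
    exact segmentCurvature_vertical θ θ' t p h2 b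
  rw [segmentChern_apply]
  exact altSum_eq_zero hn _ _ _ i hv fun b => by rw [segmentCurvature_swap, hv, neg_zero]

theorem segmentChern_act (hn : n = 2 * k) (f : invPoly 𝔤 B k) (t : ℝ) (p : P) (g : G)
    (a : Fin n → ℝ × EP) : segmentChern θ θ' hn f t (B.act p g)
      (fun i => ((a i).1, tmap EP EP (fun q => B.act q g) p (a i).2)) =
      segmentChern θ θ' hn f t p a := by
  rw [segmentChern_apply, segmentChern_apply]
  simp only [altSum, segmentCurvature_act, f.2.2.2.1]

/-- At fixed `p` only the coefficients depend on `t`; this gives integrability in the transgression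
form without assuming that `f` commutes with a connection. -/
theorem isSmooth_segmentChern_left (hn : n = 2 * k) (f : invPoly 𝔤 B k) (p : P)
    (a : Fin n → ℝ × EP) : IsSmooth (fun t => segmentChern θ θ' hn f t p a) := by
  simp_rw [segmentChern_apply]
  refine isSmooth_altSum hn _ (dSmooth_invPoly_apply f p) (fun u v => ?_) a
  have hs : ∀ v, IsSmooth fun t => segmentForm θ θ' t p v := fun v =>
    (IsSmooth.smul (by fun_prop) (isSmooth_const _)).add
      (IsSmooth.smul (by fun_prop) (isSmooth_const _))
  simp_rw [segmentCurvature_apply]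
  exact (((((IsSmooth.smul (by fun_prop) (isSmooth_const _)).add
    (IsSmooth.smul (by fun_prop) (isSmooth_const _))).add ((hs _).lieBracket (hs _))).add
    (isSmooth_const _)).sub (isSmooth_const _))

variable {θ₀ : Connection EP 𝔤 B} {f : InvPolynomial 𝔤 B}

/-- Constancy of `f` along the plot replaces the varying polynomial by the fixed invariant form `f(p
0)`. Smoothness and closedness thereby become statements on `ℝ × W`. -/
theorem segmentChern_along (h : CommutesWith θ₀ f) {k : ℕ+} (hn : n = 2 * (k : ℕ)) {p : W → P}
    (hp : IsSmooth p) (z : ℝ × W) (u : Fin n → ℝ × W) :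
    segmentChern θ θ' hn (f k) z.1 (p z.2) (fun i => ((u i).1, vel EP p z.2 (u i).2)) =
      altSum hn ((f k).1 (p 0)) (localCurvature G (segmentAlong θ θ' p) z) u := by
  rw [segmentChern_apply, invPoly_eq_of_plot h k hp]
  simp only [altSum, localCurvature_segmentAlong θ θ' hp]

theorem isSmooth_segmentChern (h : CommutesWith θ₀ f) {k : ℕ+} (hn : n = 2 * (k : ℕ)) {p : W → P}
    (hp : IsSmooth p) (u : Fin n → ℝ × W) : IsSmooth (fun z : ℝ × W =>
      segmentChern θ θ' hn (f k) z.1 (p z.2) (fun i => ((u i).1, vel EP p z.2 (u i).2))) := by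
  simp_rw [segmentChern_along θ θ' h hn hp]
  exact isSmooth_altSum hn _ (dSmooth_invPoly_apply _ _)
    (isSmooth_localCurvature (isSmooth_segmentAlong θ θ' hp)) u

theorem sum_dd_segmentChern_eq_zero (h : CommutesWith θ₀ f) {k : ℕ+} (hn : n = 2 * (k : ℕ))
    {p : W → P} (hp : IsSmooth p) (r : ℝ × W) (u : Fin (n + 1) → ℝ × W) :
    ∑ i : Fin (n + 1), (-1 : ℝ) ^ (i : ℕ) • dd (fun z : ℝ × W =>
      segmentChern θ θ' hn (f k) z.1 (p z.2) (fun j => ((u (i.succAbove j)).1,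
        vel EP p z.2 (u (i.succAbove j)).2))) r (u i) = 0 := by
  have := fun (i : Fin (n + 1)) (z : ℝ × W) =>
    segmentChern_along θ θ' h hn hp z fun j => u (i.succAbove j)
  simp_rw [this]
  exact sum_dd_altSum_eq_zero (lieBracket_anticomm θ (p 0)) hn _ (dSmooth_invPoly_apply _ _)
    ((f k).2.2.2.2 _) (isSmooth_segmentAlong θ θ' hp) r u

/-! ### The Chern form of a connection -/

/-- `chernForm` as an alternating map. -/
def chernAlt (f : invPoly 𝔤 B k) (p : P) : EP [⋀^Fin (2 * k)]→ₗ[ℝ] ℂ :=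
  -- The degenerate segment from `θ` to itself, so that results about segments specialize.
  (segmentChern θ θ rfl f 0 p).compLinearMap (LinearMap.inr ℝ ℝ EP)

theorem chernAlt_eq (f : invPoly 𝔤 B k) (p : P) (v : Fin (2 * k) → EP) :
    chernAlt θ f p v = segmentChern θ θ rfl f 0 p (fun i => (0, v i)) := rfl

theorem chernAlt_apply (f : invPoly 𝔤 B k) (p : P) (v : Fin (2 * k) → EP) :
    chernAlt θ f p v = chernForm θ f p v := by
  rw [chernAlt_eq, segmentChern_apply]
  simp only [altSum, segmentCurvature_zero]
  rfl

theorem segmentChern_zero (hn : n = 2 * k) (f : invPoly 𝔤 B k) (p : P) (v : Fin (2 * k) → EP) :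
    segmentChern θ θ' hn f 0 p (fun i => (0, v (Fin.cast hn i))) = chernForm θ f p v := by
  subst hn
  rw [segmentChern_apply]
  simp only [altSum, segmentCurvature_zero]
  rfl

theorem segmentChern_one (hn : n = 2 * k) (f : invPoly 𝔤 B k) (p : P) (v : Fin (2 * k) → EP) :
    segmentChern θ θ' hn f 1 p (fun i => (0, v (Fin.cast hn i))) = chernForm θ' f p v := by
  subst hn
  rw [segmentChern_apply]
  simp only [altSum, segmentCurvature_one]
  rfl

theorem isBasic_chernAlt (f : invPoly 𝔤 B k) : IsBasic EM B (chernAlt θ f) where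
  horizontal p v i hv := segmentChern_horizontal θ θ rfl f 0 p (fun i => (0, v i)) i rfl hv
  invariant p g v := segmentChern_act θ θ rfl f 0 p g (fun i => (0, v i))

theorem isSmooth_chernAlt (h : CommutesWith θ₀ f) (k : ℕ+) {p : W → P} (hp : IsSmooth p)
    (w : Fin (2 * (k : ℕ)) → W) :
    IsSmooth (fun r => chernAlt θ (f k) (p r) (fun i => vel EP p r (w i))) :=
  (isSmooth_segmentChern θ θ h rfl hp fun i => (0, w i)).comp (φ := fun s : W => ((0 : ℝ), s))
    (by fun_prop)

theorem sum_dd_chernAlt_eq_zero (h : CommutesWith θ₀ f) (k : ℕ+) {p : W → P} (hp : IsSmooth p)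
    (r : W) (w : Fin (2 * (k : ℕ) + 1) → W) :
    ∑ i : Fin (2 * (k : ℕ) + 1), (-1 : ℝ) ^ (i : ℕ) • dd (fun s =>
      chernAlt θ (f k) (p s) (fun j => vel EP p s (w (i.succAbove j)))) r (w i) = 0 := by
  rw [← sum_dd_segmentChern_eq_zero θ θ h rfl hp (0, r) fun i => (0, w i)]
  refine Finset.sum_congr rfl fun i _ => ?_
  rw [dd_slice]
  rfl

theorem extd_chernForm_eq_zero (h : CommutesWith θ₀ f) (k : ℕ+) (p : P)
    (v : Fin (2 * (k : ℕ) + 1) → EP) : extd (chernForm θ (f k)) p v = 0 := by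
  obtain ⟨q, hq, -, hev, -⟩ := exists_affine_plot p v
  rw [extd_eq_sum_dd _ p v hev]
  simp_rw [← chernAlt_apply]
  exact sum_dd_chernAlt_eq_zero θ h k hq 0 fun i => Pi.single i 1

/-- The exterior derivative on `M` is computed on an affine plot; its local lift turns the sum into
the one already known to vanish on `P`. -/
theorem extd_eq_zero_of_pullback_eq (h : CommutesWith θ₀ f) (k : ℕ+)
    {α : M → (Fin (2 * (k : ℕ)) → EM) → ℂ}
    (hα : ∀ p v, pullback EP EM B.proj α p v = chernForm θ (f k) p v) (x : M)
    (v : Fin (2 * (k : ℕ) + 1) → EM) : extd α x v = 0 := by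
  obtain ⟨q, hq, -, hev, -⟩ := exists_affine_plot x v
  obtain ⟨p, hp, hpq⟩ := exists_lift B hq 0
  simp_rw [← chernAlt_apply] at hα
  rw [extd_eq_sum_dd _ x v hev, ← sum_dd_chernAlt_eq_zero θ h k hp 0 fun i => Pi.single i 1]
  exact Finset.sum_congr rfl fun i _ => congrArg _ (dd_congr (IsBasic.eq_of_lift hα hp hpq _) _)

/-! ### Transgression -/

/-- The interior product of `segmentChern` with `∂/∂t`, restricted to `P`. -/
def segmentContraction (hn : m + 1 = 2 * k) (f : invPoly 𝔤 B k) (t : ℝ) (p : P) :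
    EP [⋀^Fin m]→ₗ[ℝ] ℂ :=
  ((segmentChern θ θ' hn f t p).curryLeft (1, 0)).compLinearMap (LinearMap.inr ℝ ℝ EP)

theorem segmentContraction_apply (hn : m + 1 = 2 * k) (f : invPoly 𝔤 B k) (t : ℝ) (p : P)
    (v : Fin m → EP) : segmentContraction θ θ' hn f t p v =
      segmentChern θ θ' hn f t p (Fin.cons (1, 0) fun i => (0, v i)) := rfl

theorem intervalIntegrable_segmentContraction (hn : m + 1 = 2 * k) (f : invPoly 𝔤 B k) (p : P)
    (v : Fin m → EP) : IntervalIntegrable (fun t => segmentContraction θ θ' hn f t p v)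
      MeasureTheory.volume 0 1 :=
  (isSmooth_iff_contDiff.1 (isSmooth_segmentChern_left θ θ' hn f p _)).continuous.intervalIntegrable
    _ _

/-- The transgression form of two connections. -/
def transgression (hn : m + 1 = 2 * k) (f : invPoly 𝔤 B k) (p : P) : EP [⋀^Fin m]→ₗ[ℝ] ℂ :=
  { MultilinearMap.mk' (fun v : Fin m → EP =>
        ∫ t in (0 : ℝ)..1, segmentContraction θ θ' hn f t p v)
      (fun v i x y => by
        simp only [AlternatingMap.map_update_add]
        exact intervalIntegral.integral_add (intervalIntegrable_segmentContraction θ θ' hn f p _)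
          (intervalIntegrable_segmentContraction θ θ' hn f p _))
      (fun v i c x => by
        simp only [AlternatingMap.map_update_smul]
        exact intervalIntegral.integral_smul c _) with
    map_eq_zero_of_eq' := fun v i j hv hij => by
      simp [AlternatingMap.map_eq_zero_of_eq _ v hv hij] }

theorem transgression_apply (hn : m + 1 = 2 * k) (f : invPoly 𝔤 B k) (p : P) (v : Fin m → EP) :
    transgression θ θ' hn f p v = ∫ t in (0 : ℝ)..1, segmentContraction θ θ' hn f t p v := rfl

theorem isBasic_transgression (hn : m + 1 = 2 * k) (f : invPoly 𝔤 B k) :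
    IsBasic EM B (transgression θ θ' hn f) where
  horizontal p v i hv := by
    have : ∀ t, segmentContraction θ θ' hn f t p v = 0 := fun t =>
      segmentChern_horizontal θ θ' hn f t p (Fin.cons (1, 0) fun i => (0, v i)) i.succ rfl hv
    simp [transgression_apply, this]
  invariant p g v := by
    rw [transgression_apply, transgression_apply]
    congr 1
    funext t
    rw [segmentContraction_apply, segmentContraction_apply, ← segmentChern_act θ θ' hn f t p g]
    congr 1
    funext i
    refine Fin.cases ?_ (fun i => rfl) i
    simp [tmap_zero (mapSmoothAt_act_right g p)]

theorem segmentContraction_along (hn : m + 1 = 2 * k) (f : invPoly 𝔤 B k) {p : W → P}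
    (hp : IsSmooth p) (z : ℝ × W) (w : Fin m → W) :
    segmentContraction θ θ' hn f z.1 (p z.2) (fun i => vel EP p z.2 (w i)) =
      segmentChern θ θ' hn f z.1 (p z.2) (fun i =>
        (((Fin.cons (1, 0) fun j => (0, w j) : Fin (m + 1) → ℝ × W) i).1,
          vel EP p z.2 ((Fin.cons (1, 0) fun j => (0, w j) : Fin (m + 1) → ℝ × W) i).2)) := by
  rw [segmentContraction_apply]
  congr 1
  funext i
  refine Fin.cases ?_ (fun i => rfl) i
  have : vel EP p z.2 0 = 0 := by simpa using vel_smul (E := EP) (hp.isSmoothAt z.2) 0 0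
  simp [this]

theorem isSmooth_segmentContraction (h : CommutesWith θ₀ f) {k : ℕ+}
    (hn : m + 1 = 2 * (k : ℕ)) {p : W → P} (hp : IsSmooth p) (w : Fin m → W) :
    IsSmooth (fun z : ℝ × W =>
      segmentContraction θ θ' hn (f k) z.1 (p z.2) (fun i => vel EP p z.2 (w i))) := by
  simp_rw [segmentContraction_along θ θ' hn (f k) hp]
  exact isSmooth_segmentChern θ θ' h hn hp _

theorem isSmooth_transgression {W : Type} [NormedAddCommGroup W] [NormedSpace ℝ W]
    [FiniteDimensional ℝ W] (h : CommutesWith θ₀ f) {k : ℕ+} (hn : m + 1 = 2 * (k : ℕ))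
    {p : W → P} (hp : IsSmooth p) (w : Fin m → W) :
    IsSmooth (fun r => transgression θ θ' hn (f k) (p r) (fun i => vel EP p r (w i))) :=
  isSmooth_iff_contDiff.2 (contDiff_parametric_integral
    (isSmooth_iff_contDiff.1 (isSmooth_segmentContraction θ θ' h hn hp w)))

/-- The difference of two Chern forms is the differential of the transgression form. -/
theorem sum_dd_transgression (h : CommutesWith θ₀ f) {k : ℕ+} (hn : m + 1 = 2 * (k : ℕ))
    {p : W → P} (hp : IsSmooth p) (r : W) (e : Fin (m + 1) → W) :
    ∑ i : Fin (m + 1), (-1 : ℝ) ^ (i : ℕ) • dd (fun s => transgression θ θ' hn (f k) (p s)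
      (fun j => vel EP p s (e (i.succAbove j)))) r (e i) =
    segmentChern θ θ' hn (f k) 1 (p r) (fun i => (0, vel EP p r (e i))) -
      segmentChern θ θ' hn (f k) 0 (p r) (fun i => (0, vel EP p r (e i))) := by
  refine sum_dd_integral_eq_sub (fun i : Fin (m + 1) => (-1 : ℝ) ^ (i : ℕ)) e
    (C := fun z => segmentChern θ θ' hn (f k) z.1 (p z.2) (fun i => (0, vel EP p z.2 (e i))))
    (S := fun i z => segmentContraction θ θ' hn (f k) z.1 (p z.2)
      (fun j => vel EP p z.2 (e (i.succAbove j))))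
    (isSmooth_segmentChern θ θ' h hn hp fun i => (0, e i))
    (fun i => isSmooth_segmentContraction θ θ' h hn hp _) r fun t => ?_
  -- Closedness on `∂/∂t` followed by the directions `e`: the term of index 0 is the time derivative
  -- of the Chern form, and the others, shifted by one and hence of opposite sign, form the
  -- differential of the contraction.
  have := sum_dd_segmentChern_eq_zero θ θ' h hn hp (t, r) (Fin.cons (1, 0) fun j => (0, e j))
  rw [Fin.sum_univ_succ] at this
  simp only [Fin.val_zero, pow_zero, one_smul, Fin.zero_succAbove, Fin.cons_zero, Fin.cons_succ,
    Fin.val_succ, pow_succ, mul_neg, mul_one, neg_smul, Finset.sum_neg_distrib,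
    ← sub_eq_add_neg] at this
  rw [sub_eq_zero.1 this]
  refine Finset.sum_congr rfl fun i _ => ?_
  congr 2
  funext z
  rw [segmentContraction_along θ θ' hn (f k) hp]
  have hc : ∀ j, (Fin.cons (1, 0) fun j => (0, e j) : Fin (m + 2) → ℝ × W) (i.succ.succAbove j) =
      (Fin.cons (1, 0) fun j => (0, e (i.succAbove j)) : Fin (m + 1) → ℝ × W) j := fun j => by
    refine Fin.cases ?_ (fun j => ?_) j
    · rw [Fin.succ_succAbove_zero]
      rfl
    · rw [Fin.succ_succAbove_succ]
      rfl
  simp only [hc]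

theorem cohomologous_of_pullback_eq (h : CommutesWith θ₀ f) (k : ℕ+)
    {α α' : DForm EM M ℂ (2 * (k : ℕ))}
    (hα : ∀ p v, pullback EP EM B.proj α p v = chernForm θ (f k) p v)
    (hα' : ∀ p v, pullback EP EM B.proj α' p v = chernForm θ' (f k) p v) :
    Cohomologous α α' := by
  -- Positivity of `k` provides the degree `2k - 1` of the transgression form.
  obtain ⟨m, hm⟩ : ∃ m, m + 1 = 2 * (k : ℕ) :=
    ⟨2 * (k : ℕ) - 1, by have := k.pos; omega⟩
  -- The segment runs from `θ'` to `θ`, so that the value at 1 minus the value at 0 is `α - α'` in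
  -- this order.
  obtain ⟨η, hη⟩ := (isBasic_transgression (EM := EM) θ' θ hm (f k)).exists_dForm
    fun l p hp w => isSmooth_transgression θ' θ h hm hp w
  refine ⟨m, hm, η, fun x v => ?_⟩
  obtain ⟨q, hq, hq0, hev, hv⟩ := exists_affine_plot x fun i => v (Fin.cast hm i)
  obtain ⟨p, hp, hpq⟩ := exists_lift B hq 0
  have hd : ∀ i : Fin (m + 1), dd (fun t => η (q t)
      (fun j => vel EM q t (Pi.single (i.succAbove j) 1))) 0 (Pi.single i 1) =
      dd (fun t => transgression θ' θ hm (f k) (p t)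
        (fun j => vel EP p t (Pi.single (i.succAbove j) 1))) 0 (Pi.single i 1) := fun i =>
    dd_congr (IsBasic.eq_of_lift hη hp hpq _) _
  rw [extd_eq_sum_dd _ x _ hev]
  simp_rw [hd]
  rw [sum_dd_transgression θ' θ h hm hp 0 fun i => Pi.single i 1]
  have key : ∀ {τ : Connection EP 𝔤 B} {β : DForm EM M ℂ (2 * (k : ℕ))},
      (∀ p v, pullback EP EM B.proj β p v = chernForm τ (f k) p v) → β.toAlt x v =
        chernForm τ (f k) (p 0) (fun i => vel EP p 0 (Pi.single (Fin.cast hm.symm i) 1)) := by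
    intro τ β hβ
    simp_rw [← chernAlt_apply] at hβ ⊢
    rw [← (IsBasic.eq_of_lift hβ hp hpq fun i => Pi.single (Fin.cast hm.symm i) 1).self_of_nhds]
    simp_rw [hv]
    rw [hq0]
    rfl
  rw [key hα, key hα', ← segmentChern_one θ' θ hm, ← segmentChern_zero θ' θ hm]
  rfl

end Transgression

/-! ### Polynomials commuting with connections -/

section Commuting

variable {EM EP 𝔤 M P G : Type*}
  [AddCommGroup EM] [Module ℝ EM] [TopologicalSpace EM] [DiffeologicalSpace EM]
  [ConvenientSpace EM]
  [AddCommGroup EP] [Module ℝ EP] [TopologicalSpace EP] [DiffeologicalSpace EP]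
  [ConvenientSpace EP]
  [AddCommGroup 𝔤] [Module ℝ 𝔤] [TopologicalSpace 𝔤] [DiffeologicalSpace 𝔤] [ConvenientSpace 𝔤]
  [DiffeologicalSpace M] [ConvManifold EM M]
  [DiffeologicalSpace P] [ConvManifold EP P]
  [Group G] [DiffeologicalSpace G] [ConvManifold 𝔤 G] [ConvLieGroup G]
  {B : PrincipalBundle M P G}

/-- Commuting with a connection does not depend on the connection. -/
theorem CommutesWith.of_connection {θ : Connection EP 𝔤 B} {f : InvPolynomial 𝔤 B}
    (h : CommutesWith θ f) (θ' : Connection EP 𝔤 B) : CommutesWith θ' f := by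
  intro k U hU s hs hs' p hp v
  -- The formula in `commutator_eq` contains no connection.
  rw [commutator_eq, ← commutator_eq θ]
  exact h k U hU s hs hs' p hp v

/-- An `Ad`-invariant symmetric form on the Lie algebra, as an invariant polynomial. -/
def invPolyOfForm (B : PrincipalBundle M P G) {k : ℕ} (φ : MultilinearMap ℝ (fun _ : Fin k => 𝔤) ℂ)
    (hφ : DSmooth (fun a : Fin k → 𝔤 => φ a))
    (hsymm : ∀ (σ : Equiv.Perm (Fin k)) (a : Fin k → 𝔤), φ (fun i => a (σ i)) = φ a)
    (hinv : ∀ (g : G) (a : Fin k → 𝔤), φ (fun i => Ad g (a i)) = φ a) : invPoly 𝔤 B k :=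
  ⟨fun _ => φ, fun n p hp => hφ n (fun r => (p r).2) hp.2, fun _ => hsymm, fun _ g => hinv g⁻¹,
    fun _ => hinv⟩

/-- When `f` does not vary with the point, the claim is the Leibniz rule for one fixed multilinear
map. -/
theorem commutator_eq_zero_of_const (θ : Connection EP 𝔤 B) {k : ℕ} {f : invPoly 𝔤 B k}
    (hf : ∀ p q, f.1 p = f.1 q) {s : Fin k → P → 𝔤} {p : P} (hs : ∀ i, MapSmoothAt (s i) p)
    (v : EP) : commutator θ f s p v = 0 := by
  obtain ⟨c, hc, hc0, hv, -⟩ := exists_curve p v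
  have hsc : ∀ i, IsSmoothAt (fun t => s i (c t)) 0 := fun i =>
    (hs i).isSmoothAt' (hc.isSmoothAt 0) hc0
  have hm : MapSmoothAt (fun q => f.1 p fun i => s i q) p := fun n q r hq hqr =>
    (IsSmoothAt.pi fun i => (hs i).isSmoothAt' hq hqr).map (dSmooth_invPoly_apply f p)
  have e := dd_multilinear (f.1 p) (dSmooth_invPoly_apply f p) (c := fun t i => s i (c t)) hsc 1
  rw [commutator_eq]
  simp_rw [fun q => hf q p]
  rw [← hv, tmap_vel' (E := EP) (F := ℂ) hm (hc.isSmoothAt 0) hc0, vel_model, e, hc0, sub_eq_zero]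
  refine Finset.sum_congr rfl fun i _ => ?_
  rw [tmap_vel' (E := EP) (F := 𝔤) (hs i) (hc.isSmoothAt 0) hc0, vel_model]

theorem commutesWith_of_const (θ : Connection EP 𝔤 B) {f : InvPolynomial 𝔤 B}
    (hf : ∀ (k : ℕ+) (p q : P), (f k).1 p = (f k).1 q) : CommutesWith θ f :=
  fun k _ hU _ hs _ _ hp v => commutator_eq_zero_of_const θ (hf k)
    (fun i => (hs i).mapSmoothAt
      (isOpen_iff_preimages_plots.2 fun n q hq =>
        isOpen_iff_preimages_plots.1 hU n _ (B.smooth_proj n q hq)) hp) v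

end Commuting

end ChernWeil

end

/-! ### The Chern–Weil theorem -/

theorem mainTheorem8
    {EM EP 𝔤 M P G : Type*}
    [AddCommGroup EM] [Module ℝ EM] [TopologicalSpace EM] [DiffeologicalSpace EM]
    [ConvenientSpace EM]
    [AddCommGroup EP] [Module ℝ EP] [TopologicalSpace EP] [DiffeologicalSpace EP]
    [ConvenientSpace EP]
    [AddCommGroup 𝔤] [Module ℝ 𝔤] [TopologicalSpace 𝔤] [DiffeologicalSpace 𝔤] [ConvenientSpace 𝔤]
    [DiffeologicalSpace M] [ConvManifold EM M]
    [DiffeologicalSpace P] [ConvManifold EP P]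
    [Group G] [DiffeologicalSpace G] [ConvManifold 𝔤 G] [ConvLieGroup G]
    (B : PrincipalBundle M P G) :
    (∀ f : InvPolynomial 𝔤 B, (∃ θ : Connection EP 𝔤 B, CommutesWith θ f) →
      (∀ θ : Connection EP 𝔤 B, CommutesWith θ f) ∧
      (∀ (θ : Connection EP 𝔤 B) (k : ℕ+),
        (∃ α : DForm EP P ℂ (2 * k), ∀ p v, α p v = chernForm θ (f k) p v) ∧
        (∀ p v, extd (chernForm θ (f k)) p v = 0) ∧
        (∀ p v, (∃ i, tmap EP EM B.proj p (v i) = 0) → chernForm θ (f k) p v = 0) ∧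
        (∃! α : DForm EM M ℂ (2 * k),
          ∀ p v, pullback EP EM B.proj α p v = chernForm θ (f k) p v) ∧
        (∀ α : DForm EM M ℂ (2 * k),
          (∀ p v, pullback EP EM B.proj α p v = chernForm θ (f k) p v) →
          ∀ x v, extd α x v = 0)) ∧
      (∀ (θ θ' : Connection EP 𝔤 B) (k : ℕ+) (α α' : DForm EM M ℂ (2 * k)),
        (∀ p v, pullback EP EM B.proj α p v = chernForm θ (f k) p v) →
        (∀ p v, pullback EP EM B.proj α' p v = chernForm θ' (f k) p v) →
        Cohomologous α α')) ∧
    (∀ (k : ℕ+) (φ : MultilinearMap ℝ (fun _ : Fin k => 𝔤) ℂ),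
      DSmooth (fun a : Fin k → 𝔤 => φ a) →
      (∀ (σ : Equiv.Perm (Fin k)) (a : Fin k → 𝔤), φ (fun i => a (σ i)) = φ a) →
      (∀ (g : G) (a : Fin k → 𝔤), φ (fun i => Ad g (a i)) = φ a) →
      ∃ f : invPoly 𝔤 B k, (∀ p, f.1 p = φ) ∧
        ∀ θ : Connection EP 𝔤 B,
          CommutesWith θ (DirectSum.of (fun k : ℕ+ => invPoly 𝔤 B k) k f)) := by
  refine ⟨fun f ⟨θ₀, h⟩ => ⟨h.of_connection, fun θ k => ⟨?_, ?_, ?_, ?_, ?_⟩,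
    fun θ θ' k α α' hα hα' => cohomologous_of_pullback_eq θ θ' h k hα hα'⟩,
    fun k φ hφ hsymm hinv => ⟨invPolyOfForm B φ hφ hsymm hinv, fun _ => rfl, fun θ => ?_⟩⟩
  · exact ⟨DForm.ofPlots (chernAlt θ (f k)) fun n p hp w => isSmooth_chernAlt θ h k hp w,
      fun p v => chernAlt_apply θ (f k) p v⟩
  · exact extd_chernForm_eq_zero θ h k
  · rintro p v ⟨i, hi⟩
    rw [← chernAlt_apply]
    exact (isBasic_chernAlt θ (f k)).horizontal p v i hi
  · obtain ⟨α, hα⟩ := (isBasic_chernAlt (EM := EM) θ (f k)).exists_dForm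
      fun n p hp w => isSmooth_chernAlt θ h k hp w
    simp_rw [chernAlt_apply] at hα
    exact ⟨α, hα, fun β hβ => eq_of_pullback_eq (EP := EP) (B := B) fun p v => by
      rw [hβ p v, hα p v]⟩
  · exact fun α hα => extd_eq_zero_of_pullback_eq θ h k hα
  · refine commutesWith_of_const θ fun l p q => ?_
    -- The components in degrees other than `k` are zero, hence also constant on `P`.
    by_cases hl : k = l
    · subst hl
      rw [DirectSum.of_eq_same]
      rfl
    · rw [DirectSum.of_eq_of_ne _ _ _ (Ne.symm hl)]
      rfl
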